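/- Let $\mathfrak g$ be a finite-dimensional reductive complex Lie algebra with a nondegenerate invariant symmetric bilinear form $\kappa$, let $\mathfrak h$ be a Cartan subalgebra, $R$ the set of roots, $B$ a base of $R$ and $R_+$ the positive roots. Let $\tau:B_1\to B_2$ be a bijection between subsets of $B$ such that $(\tau\alpha,\tau\beta)=(\alpha,\beta)$ for all $\alpha,\beta\in B_1$, where $(\cdot,\cdot)$ is the form on $\mathfrak h^*$ induced by $\kappa$, and such that for each $\alpha\in B_1$ there is $t$ with $\tau^t(\alpha)\notin B_1$. Let $R_1=R\cap\mathbb Z B_1$ and extend $\tau$ additively to $\mathbb ZB_1$. Choose $e_\alpha\in\mathfrak g^\alpha$ ($\alpha\in R$) with $\kappa(e_\alpha,e_\beta)=\delta_{\alpha,-\beta}$ and compatible with $\tau$ in the sense that $[e_\alpha,e_\beta]=c\,e_{\alpha+\beta}$ implies $[e_{\tau\alpha},e_{\tau\beta}]=c\,e_{\tau\alpha+\tau\beta}$ whenever $\alpha,\beta,\alpha+\beta\in R_1$. Set $h_\alpha=[e_\alpha,e_{-\alpha}]$, and let $f_0\in\operatorname{End}\mathfrak h$ satisfy $f_0+f_0^*=1$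 and $f_0(h_\alpha)=(f_0-1)(h_{\tau(\alpha)})$ for all $\alpha\in B_1$; so $(\tau,f_0)$ is an admissible quadruple. For $\alpha,\beta\in R_+$ write $\alpha\preceq\beta$ if $\beta=\tau^j(\alpha)$ for some integer $j\ge0$. The operator associated to $(\tau,f_0)$ is the linear map $f:\mathfrak g\to\mathfrak g$ given by $$f(e_\alpha)=-\sum_{\beta\succ\alpha}e_\beta,\qquad f(e_{-\alpha})=\sum_{\beta\preceq\alpha}e_{-\beta}\quad(\alpha\in R_+),\qquad f|_{\mathfrak h}=f_0 .$$ Then $f$ is well defined, and $(\mathfrak g,f)$ is a factorizable Lie bialgebra, i.e. $f+f^*=1$ and $[f(x),f(y)]=f([x,f(y)]+[f(x),y]-[x,y])$ for all $x,y\in\mathfrak g$. Put $\mathfrak c_1=\operatorname{Im}(f-1)$; this is a Lie subalgebra that contains $\mathfrak c_1^\perp=\operatorname{Ker}f$ as an ideal, and $\kappa$ and $f$ induce a form $\tilde\kappa$ and an operator $\tilde f$ on $\mathfrak c_1/\mathfrak c_1^\perp$. Moreover: 1. $\mathfrak c_1/\mathfrak c_1^\perp$ is a reductive Lie algebra, and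 $(\mathfrak c_1/\mathfrak c_1^\perp,\tilde f)$ is a factorizable Lie bialgebra with respect to $\tilde\kappa$. 2. $\operatorname{Im}(f_0-1)^\perp\subseteq\operatorname{Im}(f_0-1)$ (orthogonal complement in $\mathfrak h$), and the natural map identifies $\tilde{\mathfrak h}=\operatorname{Im}(f_0-1)/\operatorname{Im}(f_0-1)^\perp$ with a Cartan subalgebra of $\mathfrak c_1/\mathfrak c_1^\perp$. 3. Each $\alpha\in R_1$ induces a functional $\tilde\alpha$ on $\tilde{\mathfrak h}$, and $\alpha\mapsto\tilde\alpha$ is a bijection, preserving the forms $(\cdot,\cdot)$, from $R_1$ onto the set of roots of $\mathfrak c_1/\mathfrak c_1^\perp$ with respect to $\tilde{\mathfrak h}$. 4. Identify $R_1$ with this root system, take $B_1$ as its base and the classes of the $e_\alpha$ ($\alpha\in R_1$) as root vectors, and let $\tilde\tau=\tau|_{\tau^{-1}(B_1\cap B_2)}$ and let $\tilde f_0$ be the map induced by $f_0$ on $\tilde{\mathfrak h}$. Then $(\tilde\tau,\tilde f_0)$ is an admissible quadruple (these root vectors being normalised as above and compatible with $\tilde\tau$), and $\tilde f$ is the operator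 associated to it. -/

import Mathlib

open Module

namespace BelavinDrinfeld

section Factorizable

variable {g : Type*} [LieRing g] [LieAlgebra ℂ g]

/-- The factorizable Lie bialgebra `(g, f)`: a Lie algebra with a nondegenerate invariant symmetric
bilinear form `κ` and an operator `f` such that `f + f* = 1` (adjoint for `κ`) and
`[f x, f y] = f ([x, f y] + [f x, y] - [x, y])`. -/
structure IsFactorizable (κ : LinearMap.BilinForm ℂ g) (f : End ℂ g) : Prop where
  symm : κ.IsSymm
  nondegenerate : κ.Nondegenerate
  invariant : κ.lieInvariant g
  add_adjoint : ∀ x y : g, κ (f x) y + κ x (f y) = κ x y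
  lie_map : ∀ x y : g, ⁅f x, f y⁆ = f (⁅x, f y⁆ + ⁅f x, y⁆ - ⁅x, y⁆)

namespace IsFactorizable

variable {κ : LinearMap.BilinForm ℂ g} {f : End ℂ g} (hF : IsFactorizable κ f)

/-- The Lie subalgebra `c₁ = Im (f - 1)`. -/
def c₁ : LieSubalgebra ℂ g where
  __ := LinearMap.range (f - 1)
  lie_mem' := by
    rintro _ _ ⟨x, rfl⟩ ⟨y, rfl⟩
    refine ⟨⁅x, f y⁆ + ⁅f x, y⁆ - ⁅x, y⁆, ?_⟩
    simp only [LinearMap.sub_apply, Module.End.one_apply, ← hF.lie_map, lie_sub, sub_lie]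
    abel

lemma mem_c₁ {x : g} : x ∈ hF.c₁ ↔ ∃ y, f y - y = x := Iff.rfl

lemma map_mem_c₁ {x : g} (hx : x ∈ hF.c₁) : f x ∈ hF.c₁ := by
  obtain ⟨y, rfl⟩ := hF.mem_c₁.1 hx
  exact hF.mem_c₁.2 ⟨f y, by simp⟩

/-- The orthogonal complement `c₁^⊥` of `c₁` in `g` is the kernel of `f`. -/
lemma forall_c₁_eq_zero_iff {x : g} : (∀ y ∈ hF.c₁, κ y x = 0) ↔ f x = 0 := by
  have key : ∀ z, κ (f z - z) x = - κ z (f x) := fun z => by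
    have := hF.add_adjoint z x
    rw [map_sub, LinearMap.sub_apply, ← this]; abel
  constructor
  · intro h
    refine hF.nondegenerate.2 _ fun z => ?_
    have := h (f z - z) ⟨z, rfl⟩
    rwa [key, neg_eq_zero] at this
  · rintro h _ ⟨z, rfl⟩
    change κ (f z - z) x = 0
    rw [key, h, map_zero, neg_zero]

/-- The orthogonal complement `c₁^⊥` is contained in `c₁`. -/
lemma mem_c₁_of_forall {x : g} (h : ∀ y ∈ hF.c₁, κ y x = 0) : x ∈ hF.c₁ :=
  hF.mem_c₁.2 ⟨-x, by simp [(hF.forall_c₁_eq_zero_iff).1 h]⟩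

/-- The orthogonal complement `c₁^⊥`, which is contained in `c₁`, as a Lie ideal of `c₁`. -/
def c₁Perp : LieIdeal ℂ hF.c₁ where
  carrier := {x | ∀ y ∈ hF.c₁, κ y (x : g) = 0}
  add_mem' ha hb y hy := by simp [ha y hy, hb y hy]
  zero_mem' y _ := by simp
  smul_mem' c x hx y hy := by simp [hx y hy]
  lie_mem := by
    intro x m hm y hy
    have h := hF.invariant (x : g) y (m : g)
    rw [hm _ (hF.c₁.lie_mem x.2 hy)] at h
    simpa using h.symm

/-- The Lie algebra `c₁ / c₁^⊥`. -/
abbrev Red : Type _ := hF.c₁ ⧸ hF.c₁Perp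

/-- The projection `c₁ → c₁ / c₁^⊥`. -/
abbrev proj : hF.c₁ →ₗ[ℂ] hF.Red := (hF.c₁Perp.toSubmodule).mkQ

/-- `x` lies in `c₁` and `y` is its class in `c₁ / c₁^⊥`. -/
def IsClass (x : g) (y : hF.Red) : Prop := ∃ hx : x ∈ hF.c₁, hF.proj ⟨x, hx⟩ = y

/-- The bilinear form induced by `κ` on `c₁ / c₁^⊥`. -/
def redForm : LinearMap.BilinForm ℂ hF.Red :=
  (hF.c₁Perp.toSubmodule).liftQ
    (LinearMap.flip ((hF.c₁Perp.toSubmodule).liftQ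
      (κ.compl₁₂ hF.c₁.toSubmodule.subtype hF.c₁.toSubmodule.subtype).flip
      (fun x hx => LinearMap.ext fun y => hx y y.2)))
    (fun x hx => by
      refine LinearMap.ext fun y => ?_
      obtain ⟨y, rfl⟩ := Submodule.mkQ_surjective _ y
      have := hx y y.2
      rw [hF.symm.eq_iff] at this
      exact this)

lemma redForm_proj (x y : hF.c₁) : hF.redForm (hF.proj x) (hF.proj y) = κ x y := rfl

/-- The operator `f̃` induced by `f` on `c₁ / c₁^⊥`. -/
def redOp : End ℂ hF.Red :=
  (hF.c₁Perp.toSubmodule).mapQ (hF.c₁Perp.toSubmodule)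
    (f.restrict (p := hF.c₁.toSubmodule) (q := hF.c₁.toSubmodule) fun _ hx => hF.map_mem_c₁ hx)
    (fun x hx y hy => by
      have h := hF.add_adjoint y x
      rw [hx _ (hF.map_mem_c₁ hy), hx y hy, zero_add] at h
      exact h)

lemma redOp_proj (x : hF.c₁) : hF.redOp (hF.proj x) = hF.proj ⟨f x, hF.map_mem_c₁ x.2⟩ := rfl

end IsFactorizable

end Factorizable

section Quadruple

variable {g : Type*} [LieRing g] [LieAlgebra ℂ g]

/-- The set `R` of roots of `g` with respect to the Cartan subalgebra `H`. -/
def roots (H : LieSubalgebra ℂ g) [H.IsCartanSubalgebra] : Set (Dual ℂ H) :=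
  {α | α ≠ 0 ∧ LieAlgebra.rootSpace H α ≠ ⊥}

/-- `B` is a base of the root system of `g` with respect to `H`. -/
structure IsBase (H : LieSubalgebra ℂ g) [H.IsCartanSubalgebra] (B : Set (Dual ℂ H)) : Prop where
  subset : B ⊆ roots H
  linearIndepOn : LinearIndepOn ℂ id B
  pos_or_neg : ∀ α ∈ roots H, α ∈ AddSubmonoid.closure B ∨ -α ∈ AddSubmonoid.closure B

/-- The additive extension of `τ : B₁ → B₂`: `TauRel τ B₁ α β` says that `α` lies in the subgroup
generated by `B₁` and `β = τ(α)`, where `τ` is extended additively to that subgroup (`B₁` being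
linearly independent). -/
def TauRel {V : Type*} [AddCommGroup V] (τ : V → V) (B₁ : Set V) (α β : V) : Prop :=
  (α, β) ∈ AddSubgroup.closure ((fun b => (b, τ b)) '' B₁)

open Classical in
/-- An admissible quadruple `(τ : B₁ → B₂, f₀)` for a Lie algebra `g` with bilinear form `κ` and
Cartan subalgebra `H`, together with the choices of a base `B` and of root vectors `e α` on which
the associated operator depends. The values of `τ` outside `B₁` and of `e` outside the set of roots
are irrelevant. -/
structure AdmissibleQuadruple (κ : LinearMap.BilinForm ℂ g)
    (H : LieSubalgebra ℂ g) [H.IsCartanSubalgebra] where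
  /-- the base -/
  B : Set (Dual ℂ H)
  isBase : IsBase H B
  /-- the domain of `τ` -/
  B₁ : Set (Dual ℂ H)
  /-- the range of `τ` -/
  B₂ : Set (Dual ℂ H)
  B₁_subset : B₁ ⊆ B
  B₂_subset : B₂ ⊆ B
  /-- the root vectors -/
  e : Dual ℂ H → g
  e_mem : ∀ α ∈ roots H, e α ∈ LieAlgebra.rootSpace H α
  form_e : ∀ α ∈ roots H, ∀ β ∈ roots H, κ (e α) (e β) = if α = -β then 1 else 0
  /-- the bijection `τ` -/
  τ : Dual ℂ H → Dual ℂ H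
  bijOn : Set.BijOn τ B₁ B₂
  /-- `(τ α, τ β) = (α, β)`. As `κ (e α) (e (-α)) = 1`, the vector `h α = [e α, e (-α)]` of `H`
  represents `α` via `κ`, so that `(α, β) = κ (h α) (h β)`. -/
  isometry : ∀ α ∈ B₁, ∀ β ∈ B₁,
    κ ⁅e (τ α), e (-τ α)⁆ ⁅e (τ β), e (-τ β)⁆ = κ ⁅e α, e (-α)⁆ ⁅e β, e (-β)⁆
  nilpotent : ∀ α ∈ B₁, ∃ t : ℕ, τ^[t] α ∉ B₁
  /-- The root vectors are compatible with `τ`: the map `e α ↦ e (τ α)` preserves the structure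
  constants of the subalgebra generated by the `e α`, `e (-α)` with `α ∈ B₁`. -/
  compatible : ∀ α ∈ roots H, ∀ β ∈ roots H, α + β ∈ roots H → ∀ α' β' : Dual ℂ H,
    TauRel τ B₁ α α' → TauRel τ B₁ β β' → ∀ c : ℂ,
      ⁅e α, e β⁆ = c • e (α + β) → ⁅e α', e β'⁆ = c • e (α' + β')
  /-- the operator `f₀` on the Cartan subalgebra -/
  f₀ : End ℂ H
  f₀_add_adjoint : ∀ x y : H, κ (f₀ x : g) (y : g) + κ (x : g) (f₀ y : g) = κ (x : g) (y : g)
  /-- `f₀ (h α) = (f₀ - 1) (h (τ α))` for `α ∈ B₁` -/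
  f₀_tau : ∀ α ∈ B₁, ∀ h h' : H, (h : g) = ⁅e α, e (-α)⁆ → (h' : g) = ⁅e (τ α), e (-τ α)⁆ →
    f₀ h = f₀ h' - h'

namespace AdmissibleQuadruple

variable {κ : LinearMap.BilinForm ℂ g} {H : LieSubalgebra ℂ g} [H.IsCartanSubalgebra]
variable (D : AdmissibleQuadruple κ H)

/-- The bilinear form `(α, β) = κ (h α) (h β)` on roots. -/
def pairing (α β : Dual ℂ H) : ℂ := κ ⁅D.e α, D.e (-α)⁆ ⁅D.e β, D.e (-β)⁆

/-- The positive roots. -/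
def posRoots : Set (Dual ℂ H) := {α ∈ roots H | α ∈ AddSubmonoid.closure D.B}

/-- The root system `R₁` generated by `B₁`: the roots that are integral combinations of `B₁`. -/
def R₁ : Set (Dual ℂ H) := {α ∈ roots H | α ∈ AddSubgroup.closure D.B₁}

/-- `D.Le α β` is `α ⪯ β`: there is a nonnegative integer `j` with `β = τ ^ j (α)`. -/
def Le (α β : Dual ℂ H) : Prop := Relation.ReflTransGen (TauRel D.τ D.B₁) α β

/-- `f` is the operator associated to the admissible quadruple. -/
structure IsOperator (f : End ℂ g) : Prop where
  map_e_pos : ∀ α ∈ D.posRoots,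
    f (D.e α) = - ∑ᶠ β ∈ {β ∈ D.posRoots | D.Le α β ∧ β ≠ α}, D.e β
  map_e_neg : ∀ α ∈ D.posRoots,
    f (D.e (-α)) = ∑ᶠ β ∈ {β ∈ D.posRoots | D.Le β α}, D.e (-β)
  map_cartan : ∀ h : H, f (h : g) = (D.f₀ h : g)

/-- `Im (f₀ - 1)`. -/
def N : Submodule ℂ H := LinearMap.range (D.f₀ - 1)

/-- The orthogonal complement of `Im (f₀ - 1)` in `H`. -/
def NPerp : Submodule ℂ H where
  carrier := {x | ∀ y ∈ D.N, κ (y : g) (x : g) = 0}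
  add_mem' ha hb y hy := by simp [ha y hy, hb y hy]
  zero_mem' y _ := by simp
  smul_mem' c x hx y hy := by simp [hx y hy]

/-- `Im (f₀ - 1) / Im (f₀ - 1)^⊥`. -/
abbrev HTilde : Type _ := D.N ⧸ D.NPerp.submoduleOf D.N

lemma f₀_mem_N {x : H} (hx : x ∈ D.N) : D.f₀ x ∈ D.N := by
  obtain ⟨y, rfl⟩ := hx
  exact ⟨D.f₀ y, by simp⟩

/-- The map `f̃₀` induced by `f₀` on `Im (f₀ - 1) / Im (f₀ - 1)^⊥`. -/
def f₀Tilde : End ℂ D.HTilde :=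
  (D.NPerp.submoduleOf D.N).mapQ (D.NPerp.submoduleOf D.N)
    (D.f₀.restrict (p := D.N) (q := D.N) fun _ hx => D.f₀_mem_N hx)
    (fun x hx y hy => by
      have h := D.f₀_add_adjoint y x
      have h1 : κ (D.f₀ y : g) ((x : H) : g) = 0 := hx _ (D.f₀_mem_N hy)
      have h2 : κ (y : g) ((x : H) : g) = 0 := hx y hy
      rw [h1, h2, zero_add] at h
      exact h)

end AdmissibleQuadruple

end Quadruple

end BelavinDrinfeld

/-! The operator `f` is studied through its Cayley transform, the set `graph f` of pairs `(f x - x,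
f x)` in `g × g`. The identity `f + f* = 1` says that κ takes equal values on the first and on the
second components of two such pairs; the bracket identity says that the pairs are closed under the
componentwise bracket. Both conditions are bilinear, so a spanning set suffices
(`isFactorizable_of_graph`).

The sums defining `f` telescope along τ: `f e_α = f e_{τα} - e_{τα}`, with a dual rule for negative
roots (`isOperator_iff_isRecursive`). Since τ is nilpotent on `B₁`, the relation it generates has no
cycles on positive roots, and induction along τ is legitimate. Hence the graph is spanned by the
pairs `(e_α, e_{τα})` with `α ∈ R₁`, `(e_α, 0)` with α positive outside `ℤB₁`, `(0, e_{-β})` with β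
positive outside `ℤB₂`, and `((f₀ - 1) h, f₀ h)`. Brackets of these are controlled by the equality
of structure constants under τ, by the fact that the nilradical of a parabolic is stable under its
Levi part, and by the two conditions on `f₀`. That τ maps `R₁` to roots is proved by induction on
height through reflections (`map_mem_roots_of_isometry`).

The first components of the generators span `c₁`, and those with `α ∉ ℤB₁` are killed by `f`. So the
reduction is spanned by the image of `Im (f₀ - 1)` and the classes of `e_α`, `α ∈ R₁`. From this
root decomposition one reads off the Cartan subalgebra, the roots and the centrality of the radical
(`hasCentralRadical_of_root_decomposition`). The map `α ↦ α̃` is injective because the vectors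
`h_b`, `b ∈ B₁`, lie in `Im (f₀ - 1)`, and a complex combination of `B₁` orthogonal to `B₁` is zero
(`eq_zero_of_mem_span_of_apply_dualVec_eq_zero`), by positivity of the Killing form. Finally the
recursion for `f` descends to `f̃`: if `τα ∉ ℤB₁` with α positive, the class of `e_{τα}` vanishes,
so the chain stops there (`isRecursive_redOp`). -/

namespace BelavinDrinfeld

/-! ### Root theory of a reductive Lie algebra, transported from the semisimple image of `ad`. -/

section Reductive

open LieAlgebra LieModule

variable {g q : Type*} [LieRing g] [LieAlgebra ℂ g] [LieRing q] [LieAlgebra ℂ q]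

/-- The preimage of an abelian ideal has its derived ideal in the center, so it is solvable, hence
lies in the radical, which is the center and is killed by `π`. -/
lemma hasTrivialRadical_of_ker_eq_center [FiniteDimensional ℂ g] [HasCentralRadical ℂ g]
    (π : g →ₗ⁅ℂ⁆ q) (hsurj : Function.Surjective π) (hker : π.ker = center ℂ g) :
    HasTrivialRadical ℂ q := by
  rw [hasTrivialRadical_iff_no_abelian_ideals]
  intro J hJ
  have hJ' : ∀ x ∈ J, ∀ y ∈ J, ⁅x, y⁆ = 0 := fun x hx y hy => by
    simpa [Subtype.ext_iff] using hJ.trivial ⟨x, hx⟩ ⟨y, hy⟩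
  have h1 : ⁅J.comap π, J.comap π⁆ ≤ center ℂ g := by
    rw [LieSubmodule.lie_le_iff]
    intro x hx y hy
    rw [← hker, LieHom.mem_ker, LieHom.map_lie]
    exact hJ' _ (by simpa using hx) _ (by simpa using hy)
  have h2 : derivedSeriesOfIdeal ℂ g 2 (J.comap π) = ⊥ := by
    rw [derivedSeriesOfIdeal_succ, derivedSeriesOfIdeal_succ, derivedSeriesOfIdeal_zero, eq_bot_iff,
      LieSubmodule.lie_le_iff]
    intro x _ y hy
    exact (mem_maxTrivSubmodule ℂ g g y).1 (h1 hy) x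
  have h3 : IsSolvable (J.comap π) :=
    IsSolvable.mk (R := ℂ) (k := 2) ((LieIdeal.derivedSeries_eq_bot_iff _ _).2 h2)
  have h4 : J.comap π ≤ center ℂ g := by
    rw [← HasCentralRadical.radical_eq_center (R := ℂ) (L := g)]
    exact (LieIdeal.solvable_iff_le_radical ℂ g _).1 h3
  rw [eq_bot_iff]
  intro x hx
  obtain ⟨y, rfl⟩ := hsurj x
  have : y ∈ center ℂ g := h4 (by simpa using hx)
  rw [← hker, LieHom.mem_ker] at this
  simp [this]

lemma center_le_of_isCartanSubalgebra (H : LieSubalgebra ℂ g) [H.IsCartanSubalgebra] {x : g}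
    (hx : x ∈ center ℂ g) : x ∈ H := by
  rw [← LieSubalgebra.IsCartanSubalgebra.self_normalizing (H := H),
    LieSubalgebra.mem_normalizer_iff']
  intro y _
  rw [(mem_maxTrivSubmodule ℂ g g x).1 hx y]
  exact H.zero_mem

/-- The restriction of a Lie algebra homomorphism to a subalgebra and its image. -/
def mapHom (H : LieSubalgebra ℂ g) (π : g →ₗ⁅ℂ⁆ q) : H →ₗ⁅ℂ⁆ H.map π where
  toFun x := ⟨π x, (LieSubalgebra.mem_map _ _ _).2 ⟨x, x.2, rfl⟩⟩
  map_add' x y := by ext; simp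
  map_smul' c x := by ext; simp
  map_lie' := by intro x y; ext; simp

@[simp] lemma coe_mapHom (H : LieSubalgebra ℂ g) (π : g →ₗ⁅ℂ⁆ q) (x : H) :
    (mapHom H π x : q) = π x := rfl

lemma mapHom_surjective (H : LieSubalgebra ℂ g) (π : g →ₗ⁅ℂ⁆ q) :
    Function.Surjective (mapHom H π) := by
  rintro ⟨_, x, hx, rfl⟩
  exact ⟨⟨x, hx⟩, rfl⟩

/-- Self-normalization descends because `H` contains the kernel, which is the center. -/
lemma isCartanSubalgebra_map (H : LieSubalgebra ℂ g) [H.IsCartanSubalgebra]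
    (π : g →ₗ⁅ℂ⁆ q) (hsurj : Function.Surjective π) (hker : π.ker = center ℂ g) :
    (H.map π).IsCartanSubalgebra where
  nilpotent := (mapHom_surjective H π).lieAlgebra_isNilpotent
  self_normalizing := by
    refine le_antisymm (fun x hx => ?_) (LieSubalgebra.le_normalizer _)
    obtain ⟨y, rfl⟩ := hsurj x
    rw [LieSubalgebra.mem_normalizer_iff'] at hx
    refine LieSubalgebra.mem_map _ _ _ |>.2 ⟨y, ?_, rfl⟩
    rw [← LieSubalgebra.IsCartanSubalgebra.self_normalizing (H := H),
      LieSubalgebra.mem_normalizer_iff']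
    intro z hz
    obtain ⟨w, hw, hwz⟩ := LieSubalgebra.mem_map _ _ _ |>.1
      (hx (π z) (LieSubalgebra.mem_map _ _ _ |>.2 ⟨z, hz, rfl⟩))
    rw [← LieHom.map_lie, ← sub_eq_zero, ← map_sub, ← LieHom.mem_ker, hker] at hwz
    have := H.sub_mem hw (center_le_of_isCartanSubalgebra H hwz)
    simpa using this

section

variable (H : LieSubalgebra ℂ g) [H.IsCartanSubalgebra] (π : g →ₗ⁅ℂ⁆ q)
  [(H.map π).IsCartanSubalgebra]

lemma map_mem_rootSpace {α : H → ℂ} {μ : H.map π → ℂ} (h : ∀ x, α x = μ (mapHom H π x)) {x : g}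
    (hx : x ∈ rootSpace H α) : π x ∈ rootSpace (H.map π) μ := by
  rw [mem_genWeightSpace] at hx ⊢
  intro y
  obtain ⟨y, rfl⟩ := mapHom_surjective H π y
  obtain ⟨k, hk⟩ := hx y
  refine ⟨k, ?_⟩
  have : (toEnd ℂ (H.map π) q (mapHom H π y) - μ (mapHom H π y) • (1 : End ℂ q)) ∘ₗ
      (π : g →ₗ[ℂ] q) = (π : g →ₗ[ℂ] q) ∘ₗ (toEnd ℂ H g y - α y • (1 : End ℂ g)) := by
    ext z
    simp [h]
  have h2 := LinearMap.congr_fun (Module.End.commute_pow_left_of_commute this k) x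
  simpa [hk] using h2

omit [(LieSubalgebra.map π H).IsCartanSubalgebra] in
-- An arbitrary lift `y` of `x` is an eigenvector only up to central elements. Bracketing once more
-- with some `h0` on which the weight is nonzero removes the central error. Commutativity of `H` is
-- not available at this stage; it is enough that its commutators are central.
lemma exists_lift_of_lie_eq_smul (hab : ∀ x y : H.map π, ⁅x, y⁆ = 0)
    (hsurj : Function.Surjective π) (hker : π.ker = center ℂ g)
    {μ : Dual ℂ (H.map π)} (hμ : μ ≠ 0) {x : q} (hx : ∀ y : H.map π, ⁅(y : q), x⁆ = μ y • x) :
    ∃ y, π y = x ∧ y ∈ rootSpace H (μ ∘ₗ (mapHom H π : H →ₗ[ℂ] H.map π)) := by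
  obtain ⟨h0, hh0⟩ : ∃ h0, μ h0 ≠ 0 := by
    by_contra! h
    exact hμ (LinearMap.ext h)
  obtain ⟨h0, rfl⟩ := mapHom_surjective H π h0
  obtain ⟨y, rfl⟩ := hsurj x
  refine ⟨(μ (mapHom H π h0))⁻¹ • ⁅(h0 : g), y⁆, ?_, Submodule.smul_mem _ _ ?_⟩
  · have := hx (mapHom H π h0)
    rw [coe_mapHom] at this
    rw [map_smul, LieHom.map_lie, this, inv_smul_smul₀ hh0]
  · refine weightSpace_le_genWeightSpace g _ ?_
    rw [mem_weightSpace]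
    intro h
    have h1 : ∀ z : g, ⁅z, ⁅(h : g), y⁆ - μ (mapHom H π h) • y⁆ = 0 := by
      refine (mem_maxTrivSubmodule ℂ g g _).1 ?_
      change _ ∈ center ℂ g
      rw [← hker, LieHom.mem_ker, map_sub, LieHom.map_lie, map_smul, sub_eq_zero]
      exact hx (mapHom H π h)
    have h2 : ∀ z : g, ⁅z, ⁅(h : g), (h0 : g)⁆⁆ = 0 := by
      refine (mem_maxTrivSubmodule ℂ g g _).1 ?_
      change _ ∈ center ℂ g
      rw [← hker, LieHom.mem_ker, LieHom.map_lie]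
      have := hab (mapHom H π h) (mapHom H π h0)
      simpa [Subtype.ext_iff] using this
    have h3 : ⁅⁅(h : g), (h0 : g)⁆, y⁆ = 0 := by rw [← lie_skew, h2, neg_zero]
    have h4 := h1 h0
    rw [lie_sub, sub_eq_zero, lie_smul] at h4
    change ⁅(h : g), ⁅(h0 : g), y⁆⁆ = _
    rw [leibniz_lie, h3, zero_add, h4]
    rfl

end




section

variable (H : LieSubalgebra ℂ g) [H.IsCartanSubalgebra] (π : g →ₗ⁅ℂ⁆ q)
  [(H.map π).IsCartanSubalgebra]

omit [(LieSubalgebra.map π H).IsCartanSubalgebra] in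
-- The kernel of `π` acts by zero on `g`, so every weight vanishes on it.
lemma apply_eq_zero_of_map_eq_zero (hker : π.ker = center ℂ g) {α : Dual ℂ H} (hα : α ∈ roots H)
    {x : H} (hx : π x = 0) : α x = 0 := by
  obtain ⟨e, he, he0⟩ := (Submodule.ne_bot_iff _).1 ((LieSubmodule.toSubmodule_eq_bot _).not.2 hα.2)
  obtain ⟨k, hk⟩ := (mem_genWeightSpace _ _ _).1 he x
  have hx0 : toEnd ℂ H g x = 0 := by
    rw [← LieHom.mem_ker, hker] at hx
    ext y
    have := (mem_maxTrivSubmodule ℂ g g _).1 hx y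
    rw [← lie_skew, neg_eq_zero] at this
    exact this
  rw [hx0, zero_sub, ← neg_smul, smul_pow, one_pow] at hk
  simp only [LinearMap.smul_apply, Module.End.one_apply, smul_eq_zero, he0, or_false] at hk
  simpa using eq_zero_of_pow_eq_zero hk

omit [(LieSubalgebra.map π H).IsCartanSubalgebra] in
-- The kernel lies in `H`, the zero root space, which meets the other root spaces trivially.
lemma eq_zero_of_mem_rootSpace_of_map_eq_zero [FiniteDimensional ℂ g] (hker : π.ker = center ℂ g)
    {α : Dual ℂ H} (hα : α ≠ 0) {x : g} (hx : x ∈ rootSpace H α) (h : π x = 0) : x = 0 := by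
  rw [← LieHom.mem_ker, hker] at h
  have h1 : x ∈ rootSpace H (0 : H → ℂ) := by
    rw [rootSpace_zero_eq]
    exact center_le_of_isCartanSubalgebra H h
  have hne : (α : H → ℂ) ≠ 0 := fun h => hα (DFunLike.coe_injective h)
  have := (disjoint_genWeightSpace ℂ H g hne).eq_bot
  rw [LieSubmodule.eq_bot_iff] at this
  exact this x ⟨hx, h1⟩

lemma exists_weight_of_mem_roots [FiniteDimensional ℂ g] (hker : π.ker = center ℂ g)
    {α : Dual ℂ H} (hα : α ∈ roots H) :
    ∃ μ : Weight ℂ (H.map π) q, μ.IsNonZero ∧ ∀ x, α x = μ (mapHom H π x) := by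
  -- The root factors through the image of `H`; composing it with a linear section gives the factor.
  obtain ⟨s, hs⟩ := LinearMap.exists_rightInverse_of_surjective
    (mapHom H π : H →ₗ[ℂ] H.map π) (LinearMap.range_eq_top.2 (mapHom_surjective H π))
  have hs' : ∀ y, mapHom H π (s y) = y := fun y => LinearMap.congr_fun hs y
  have key : ∀ x, α x = α (s (mapHom H π x)) := by
    intro x
    rw [← sub_eq_zero, ← map_sub]
    refine apply_eq_zero_of_map_eq_zero H π hker hα ?_
    have := hs' (mapHom H π x)
    rw [← coe_mapHom, map_sub, this, sub_self, ZeroMemClass.coe_zero]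
  refine ⟨⟨fun y => α (s y), ?_⟩, ?_, key⟩
  · obtain ⟨e, he, he0⟩ :=
      (Submodule.ne_bot_iff _).1 ((LieSubmodule.toSubmodule_eq_bot _).not.2 hα.2)
    intro h
    refine he0 (eq_zero_of_mem_rootSpace_of_map_eq_zero H π hker hα.1 he ?_)
    have := map_mem_rootSpace H π (μ := fun y => α (s y)) key he
    rwa [rootSpace, h, LieSubmodule.mem_bot] at this
  · intro h
    refine hα.1 (LinearMap.ext fun x => ?_)
    rw [key]
    exact congr_fun h _

variable [FiniteDimensional ℂ g] [FiniteDimensional ℂ q] [IsKilling ℂ q]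

omit [FiniteDimensional ℂ g] in
lemma exists_lift_of_mem_rootSpace (hsurj : Function.Surjective π) (hker : π.ker = center ℂ g)
    {α : Dual ℂ H} (hα : α ≠ 0) {μ : Weight ℂ (H.map π) q} (h : ∀ x, α x = μ (mapHom H π x))
    {x : q} (hx : x ∈ rootSpace (H.map π) μ) : ∃ y ∈ rootSpace H α, π y = x := by
  have hμ : μ.toLinear ≠ 0 := by
    rintro h0
    refine hα (LinearMap.ext fun x => ?_)
    rw [h]
    exact LinearMap.congr_fun h0 _
  obtain ⟨y, hy, hy'⟩ := exists_lift_of_lie_eq_smul H π (trivial_lie_zero _ _) hsurj hker hμ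
    (x := x) (fun y => IsKilling.lie_eq_smul_of_mem_rootSpace hx y)
  refine ⟨y, ?_, hy⟩
  convert hy'
  ext x
  simp [h]

omit [FiniteDimensional ℂ g] in
lemma mem_roots_of_weight (hsurj : Function.Surjective π) (hker : π.ker = center ℂ g)
    {α : Dual ℂ H} {μ : Weight ℂ (H.map π) q} (hμ : μ.IsNonZero)
    (h : ∀ x, α x = μ (mapHom H π x)) : α ∈ roots H := by
  have hα : α ≠ 0 := by
    rintro rfl
    refine hμ ?_
    ext y
    obtain ⟨y, rfl⟩ := mapHom_surjective H π y
    simp [← h]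
  refine ⟨hα, ?_⟩
  obtain ⟨e, he, he0⟩ := (Submodule.ne_bot_iff _).1
    ((LieSubmodule.toSubmodule_eq_bot _).not.2 μ.genWeightSpace_ne_bot)
  obtain ⟨y, hy, rfl⟩ := exists_lift_of_mem_rootSpace H π hsurj hker hα h he
  intro h0
  rw [h0, LieSubmodule.mem_bot] at hy
  simp [hy] at he0

lemma exists_smul_eq_of_mem_rootSpace_aux (hker : π.ker = center ℂ g)
    {α : Dual ℂ H} (hα : α ∈ roots H) {x y : g} (hx : x ∈ rootSpace H α) (hx0 : x ≠ 0)
    (hy : y ∈ rootSpace H α) : ∃ c : ℂ, y = c • x := by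
  obtain ⟨μ, hμ, h⟩ := exists_weight_of_mem_roots H π hker hα
  have h1 := map_mem_rootSpace H π h hx
  have h2 := map_mem_rootSpace H π h hy
  have h3 : (⟨π x, h1⟩ : rootSpace (H.map π) μ) ≠ 0 := by
    intro h0
    exact hx0 (eq_zero_of_mem_rootSpace_of_map_eq_zero H π hker hα.1 hx (congr_arg Subtype.val h0))
  obtain ⟨c, hc⟩ := (finrank_eq_one_iff_of_nonzero' _ h3).1
    (IsKilling.finrank_rootSpace_eq_one μ hμ) ⟨π y, h2⟩
  refine ⟨c, ?_⟩
  rw [← sub_eq_zero]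
  refine eq_zero_of_mem_rootSpace_of_map_eq_zero H π hker hα.1
    (sub_mem hy (Submodule.smul_mem _ c hx)) ?_
  have := congr_arg Subtype.val hc
  rw [map_sub, map_smul, sub_eq_zero]
  exact this.symm

/-- The bracket of lifts of the root vectors of an `sl₂`-triple in `q` is a lift of the coroot. -/
lemma exists_coroot_aux (hsurj : Function.Surjective π) (hker : π.ker = center ℂ g)
    {α : Dual ℂ H} (hα : α ∈ roots H) {μ : Weight ℂ (H.map π) q} (hμ : μ.IsNonZero)
    (h : ∀ x, α x = μ (mapHom H π x)) :
    ∃ c : H, mapHom H π c = IsKilling.coroot μ ∧ (∃ e ∈ rootSpace H α, ∃ f ∈ rootSpace H ⇑(-α),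
      (c : g) = ⁅e, f⁆ ∧ e ≠ 0 ∧ f ≠ 0) := by
  obtain ⟨h', e', f', ht, he', hf'⟩ := IsKilling.exists_isSl2Triple_of_weight_isNonZero hμ
  have hh := ht.h_eq_coroot hμ he' hf'
  obtain ⟨e, he, rfl⟩ := exists_lift_of_mem_rootSpace H π hsurj hker hα.1 h he'
  obtain ⟨f, hf, rfl⟩ := exists_lift_of_mem_rootSpace H π hsurj hker (α := -α) (μ := -μ)
    (neg_ne_zero.2 hα.1) (by simp [h]) hf'
  have hmem : ⁅e, f⁆ ∈ H := by
    have := lie_mem_genWeightSpace_of_mem_genWeightSpace he hf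
    have h0 : (α : H → ℂ) + ⇑(-α) = 0 := by ext; simp
    rw [h0] at this
    change _ ∈ rootSpace H (0 : H → ℂ) at this
    rw [rootSpace_zero_eq] at this
    exact this
  refine ⟨⟨_, hmem⟩, ?_, e, he, f, hf, rfl, ?_, ?_⟩
  · ext
    rw [coe_mapHom, ← hh, ← ht.lie_e_f, LieHom.map_lie]
  · rintro rfl
    simpa using ht.e_ne_zero
  · rintro rfl
    simpa using ht.f_ne_zero

end

section

variable [FiniteDimensional ℂ g] (H : LieSubalgebra ℂ g) [H.IsCartanSubalgebra]

section

variable (π : g →ₗ⁅ℂ⁆ q) [(H.map π).IsCartanSubalgebra] [FiniteDimensional ℂ q] [IsKilling ℂ q]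

lemma lie_eq_smul_of_mem_rootSpace_aux (hker : π.ker = center ℂ g)
    {α : Dual ℂ H} (hα : α ∈ roots H) {x : g} (hx : x ∈ rootSpace H α) (h : H) :
    ⁅(h : g), x⁆ = α h • x := by
  obtain ⟨μ, hμ, hαμ⟩ := exists_weight_of_mem_roots H π hker hα
  rw [← sub_eq_zero]
  refine eq_zero_of_mem_rootSpace_of_map_eq_zero H π hker hα.1
    (sub_mem (LieSubmodule.lie_mem (x := h) _ hx) (Submodule.smul_mem _ _ hx)) ?_
  rw [map_sub, map_smul, LieHom.map_lie, sub_eq_zero, hαμ]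
  exact IsKilling.lie_eq_smul_of_mem_rootSpace (map_mem_rootSpace H π hαμ hx) (mapHom H π h)

/-- Modulo the center, `H` is spanned by brackets `⁅e, f⁆` of opposite root vectors, on which `x`
acts by `α x - α x = 0`. -/
lemma lie_eq_zero_of_mem_cartan_aux (hsurj : Function.Surjective π) (hker : π.ker = center ℂ g)
    (x y : H) : ⁅(x : g), (y : g)⁆ = 0 := by
  -- `W` is the centralizer of `x` in `H`; it suffices that `W` maps onto the image of `H`.
  let W : Submodule ℂ H :=
    LinearMap.ker ((toEnd ℂ H g x).comp H.toSubmodule.subtype)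
  have hW : ∀ y : H, y ∈ W ↔ ⁅(x : g), (y : g)⁆ = 0 := fun y => Iff.rfl
  suffices h : ∀ z ∈ (⊤ : Submodule ℂ (H.map π)), ∃ y ∈ W, mapHom H π y = z by
    obtain ⟨z, hz, hzy⟩ := h (mapHom H π y) trivial
    have h1 : π ((y : g) - z) = 0 := by
      rw [map_sub, ← coe_mapHom, ← hzy, coe_mapHom, sub_self]
    rw [← LieHom.mem_ker, hker] at h1
    have h2 := (mem_maxTrivSubmodule ℂ g g _).1 h1 x
    rwa [lie_sub, (hW z).1 hz, sub_zero] at h2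
  rw [← RootPairing.IsRootSystem.span_coroot_eq_top (P := IsKilling.rootSystem (H.map π))]
  intro z hz
  induction hz using Submodule.span_induction with
  | zero => exact ⟨0, W.zero_mem, map_zero _⟩
  | add a b _ _ ha hb =>
    obtain ⟨a, ha, rfl⟩ := ha
    obtain ⟨b, hb, rfl⟩ := hb
    exact ⟨a + b, W.add_mem ha hb, map_add _ _ _⟩
  | smul c a _ ha =>
    obtain ⟨a, ha, rfl⟩ := ha
    exact ⟨c • a, W.smul_mem c ha, map_smul _ _ _⟩
  | mem z hz =>
    obtain ⟨μ, rfl⟩ := hz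
    have hμ : (μ : Weight ℂ (H.map π) q).IsNonZero := LieSubalgebra.isNonZero_coe_root _
    let α : Dual ℂ H := (μ : Weight ℂ (H.map π) q).toLinear ∘ₗ (mapHom H π : H →ₗ[ℂ] H.map π)
    have hαμ : ∀ x, α x = (μ : Weight ℂ (H.map π) q) (mapHom H π x) := fun _ => rfl
    have hα : α ∈ roots H := mem_roots_of_weight H π hsurj hker hμ hαμ
    have hα' : -α ∈ roots H := mem_roots_of_weight H π hsurj hker hμ.neg fun x => by
      simp [hαμ]
    obtain ⟨c, hc, e, he, f, hf, hef, -⟩ := exists_coroot_aux H π hsurj hker hα hμ hαμ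
    refine ⟨c, ?_, hc⟩
    rw [hW, hef, leibniz_lie, lie_eq_smul_of_mem_rootSpace_aux H π hker hα he,
      lie_eq_smul_of_mem_rootSpace_aux H π hker hα' hf]
    simp

end

variable [HasCentralRadical ℂ g]

attribute [local instance] LieRing.ofAssociativeRing

omit [FiniteDimensional ℂ g] [HasCentralRadical ℂ g] in
lemma ker_rangeRestrict_ad : (ad ℂ g).rangeRestrict.ker = center ℂ g := by
  rw [← self_module_ker_eq_center, ← ad_ker_eq_self_module_ker]
  ext x
  simp only [LieHom.mem_ker, LieHom.rangeRestrict_apply]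
  exact Subtype.ext_iff

instance isKilling_range_ad : IsKilling ℂ (ad ℂ g).range :=
  have := hasTrivialRadical_of_ker_eq_center _ (ad ℂ g).surjective_rangeRestrict
    ker_rangeRestrict_ad
  inferInstance

instance isCartanSubalgebra_map_rangeRestrict_ad :
    (H.map (ad ℂ g).rangeRestrict).IsCartanSubalgebra :=
  isCartanSubalgebra_map H _ (ad ℂ g).surjective_rangeRestrict ker_rangeRestrict_ad

variable {H}

lemma lie_eq_zero_of_mem_cartan (x y : H) : ⁅(x : g), (y : g)⁆ = 0 :=
  lie_eq_zero_of_mem_cartan_aux H _ (ad ℂ g).surjective_rangeRestrict ker_rangeRestrict_ad x y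

lemma lie_eq_smul_of_mem_rootSpace {α : Dual ℂ H} (hα : α ∈ roots H) {x : g}
    (hx : x ∈ rootSpace H α) (h : H) : ⁅(h : g), x⁆ = α h • x :=
  lie_eq_smul_of_mem_rootSpace_aux H _ ker_rangeRestrict_ad hα hx h

lemma exists_smul_eq_of_mem_rootSpace {α : Dual ℂ H} (hα : α ∈ roots H) {x y : g}
    (hx : x ∈ rootSpace H α) (hx0 : x ≠ 0) (hy : y ∈ rootSpace H α) : ∃ c : ℂ, y = c • x :=
  exists_smul_eq_of_mem_rootSpace_aux H _ ker_rangeRestrict_ad hα hx hx0 hy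

lemma neg_mem_roots {α : Dual ℂ H} (hα : α ∈ roots H) : -α ∈ roots H := by
  obtain ⟨μ, hμ, h⟩ := exists_weight_of_mem_roots H _ ker_rangeRestrict_ad hα
  exact mem_roots_of_weight H _ (ad ℂ g).surjective_rangeRestrict ker_rangeRestrict_ad hμ.neg
    fun x => by simp [h]

lemma eq_one_or_eq_neg_one_of_smul_mem_roots {α : Dual ℂ H} (hα : α ∈ roots H) {k : ℂ}
    (hk : k • α ∈ roots H) : k = 1 ∨ k = -1 := by
  obtain ⟨μ, hμ, h⟩ := exists_weight_of_mem_roots H _ ker_rangeRestrict_ad hα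
  obtain ⟨ν, hν, h'⟩ := exists_weight_of_mem_roots H _ ker_rangeRestrict_ad hk
  obtain ⟨x, hx⟩ : ∃ x, α x ≠ 0 := by
    by_contra! h
    exact hα.1 (LinearMap.ext h)
  have h1 : (ν : H.map (ad ℂ g).rangeRestrict → ℂ) = k • μ := by
    ext y
    obtain ⟨y, rfl⟩ := mapHom_surjective H _ y
    simp [← h', ← h]
  have h2 := h' x
  rcases IsKilling.eq_neg_or_eq_of_eq_smul μ ν hν k h1 with rfl | rfl
  · right
    rw [Weight.coe_neg, Pi.neg_apply, ← h] at h2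
    refine mul_right_cancel₀ hx ?_
    simpa using h2
  · left
    rw [← h] at h2
    refine mul_right_cancel₀ hx ?_
    simpa using h2

/-- These are the only facts about coroots needed later: normalization, brackets of opposite root
vectors, integrality and reflections. -/
lemma exists_coroot {α : Dual ℂ H} (hα : α ∈ roots H) :
    ∃ c : H, α c = 2 ∧
      (∀ x ∈ rootSpace H α, ∀ y ∈ rootSpace H ⇑(-α), ∃ t : ℂ, ⁅x, y⁆ = t • (c : g)) ∧
      ∀ β ∈ roots H, (∃ n : ℤ, β c = n) ∧ β - β c • α ∈ roots H := by
  have hsurj := (ad ℂ g).surjective_rangeRestrict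
  have hker := ker_rangeRestrict_ad (g := g)
  obtain ⟨μ, hμ, h⟩ := exists_weight_of_mem_roots H _ hker hα
  obtain ⟨c, hc, e, he, f, hf, hef, he0, hf0⟩ := exists_coroot_aux H _ hsurj hker hα hμ h
  refine ⟨c, ?_, fun x hx y hy => ?_, fun β hβ => ?_⟩
  · rw [h, hc, IsKilling.root_apply_coroot hμ]
  · obtain ⟨s, rfl⟩ := exists_smul_eq_of_mem_rootSpace hα he he0 hx
    obtain ⟨t, rfl⟩ := exists_smul_eq_of_mem_rootSpace (neg_mem_roots hα) hf hf0 hy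
    exact ⟨t * s, by rw [smul_lie, lie_smul, hef, smul_smul, mul_comm]⟩
  · obtain ⟨ν, hν, h'⟩ := exists_weight_of_mem_roots H _ hker hβ
    refine ⟨⟨(chainBotCoeff μ ν - chainTopCoeff μ ν : ℤ), ?_⟩, mem_roots_of_weight H _ hsurj hker
      (IsKilling.reflectRoot_isNonZero μ ν hν) fun x => ?_⟩
    · rw [h', hc, IsKilling.apply_coroot_eq_cast]
    · rw [LinearMap.sub_apply, LinearMap.smul_apply, h', h', h, hc]
      rfl

end

section

variable [FiniteDimensional ℂ g] {H : LieSubalgebra ℂ g} [H.IsCartanSubalgebra]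

lemma toLinear_mem_roots {χ : Weight ℂ H g} (hχ : χ.IsNonZero) : χ.toLinear ∈ roots H :=
  ⟨fun h => hχ (by ext x; exact LinearMap.congr_fun h x), χ.genWeightSpace_ne_bot⟩

/-- A subspace containing a Cartan subalgebra and all root spaces is everything. -/
lemma eq_top_of_cartan_le_of_rootSpace_le {p : Submodule ℂ g} (hH : ∀ h : H, (h : g) ∈ p)
    (hp : ∀ α ∈ roots H, ∀ x ∈ rootSpace H α, x ∈ p) : p = ⊤ := by
  have h := congr_arg LieSubmodule.toSubmodule (cartan_sup_iSup_rootSpace_eq_top H)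
  rw [LieSubmodule.sup_toSubmodule, LieSubmodule.iSup_toSubmodule] at h
  rw [eq_top_iff, ← LieSubmodule.top_toSubmodule (R := ℂ) (L := H), ← h]
  refine sup_le (fun x hx => hH ⟨x, hx⟩) (iSup_le fun χ => ?_)
  rw [LieSubmodule.iSup_toSubmodule]
  exact iSup_le fun hχ x hx => hp _ (toLinear_mem_roots hχ) x hx

lemma finite_roots : (roots H).Finite := by
  refine (Set.finite_range fun χ : Weight ℂ H g => χ.toLinear).subset fun α hα => ?_
  exact ⟨⟨α, hα.2⟩, rfl⟩

lemma killingForm_eq_sum (x y : H) : killingForm ℂ g (x : g) (y : g) =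
    ∑ χ : Weight ℂ H g, (finrank ℂ (genWeightSpace g χ) : ℂ) * (χ x * χ y) := by
  have := LinearMap.congr_fun₂ (traceForm_eq_sum_finrank_nsmul ℂ H g) x y
  simp only [LinearMap.sum_apply] at this
  refine Eq.trans ?_ (this.trans (Finset.sum_congr rfl fun χ _ => ?_))
  · rfl
  · simp

omit [FiniteDimensional ℂ g] in
lemma killingForm_lie_eq (x y z : g) :
    killingForm ℂ g x ⁅y, z⁆ = killingForm ℂ g ⁅x, y⁆ z :=
  (traceForm_apply_lie_apply ℂ g g x y z).symm

variable [HasCentralRadical ℂ g]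

/-- The coroot of a root. -/
noncomputable def coroot (α : Dual ℂ H) : H :=
  open Classical in if h : α ∈ roots H then (exists_coroot h).choose else 0

lemma apply_coroot_self {α : Dual ℂ H} (hα : α ∈ roots H) : α (coroot α) = 2 := by
  rw [coroot, dif_pos hα]
  exact (exists_coroot hα).choose_spec.1

lemma lie_eq_smul_coroot {α : Dual ℂ H} (hα : α ∈ roots H) {x y : g} (hx : x ∈ rootSpace H α)
    (hy : y ∈ rootSpace H ⇑(-α)) : ∃ t : ℂ, ⁅x, y⁆ = t • (coroot α : g) := by
  rw [coroot, dif_pos hα]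
  exact (exists_coroot hα).choose_spec.2.1 x hx y hy

lemma apply_coroot_eq_intCast {α β : Dual ℂ H} (hα : α ∈ roots H) (hβ : β ∈ roots H) :
    ∃ n : ℤ, β (coroot α) = n := by
  rw [coroot, dif_pos hα]
  exact ((exists_coroot hα).choose_spec.2.2 β hβ).1

lemma sub_smul_mem_roots {α β : Dual ℂ H} (hα : α ∈ roots H) (hβ : β ∈ roots H) :
    β - β (coroot α) • α ∈ roots H := by
  rw [coroot, dif_pos hα]
  exact ((exists_coroot hα).choose_spec.2.2 β hβ).2

lemma weight_apply_coroot_eq_intCast (χ : Weight ℂ H g) {α : Dual ℂ H} (hα : α ∈ roots H) :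
    ∃ n : ℤ, χ (coroot α) = n := by
  by_cases hχ : χ.IsZero
  · exact ⟨0, by rw [hχ.eq]; simp⟩
  · exact apply_coroot_eq_intCast hα (toLinear_mem_roots hχ)

end
end Reductive

/-! ### The invariant form on the Cartan subalgebra and positivity of the Killing form. -/

section Form

open LieAlgebra LieModule

variable {g : Type*} [LieRing g] [LieAlgebra ℂ g]

/-- A nondegenerate invariant symmetric bilinear form. -/
structure IsInvariantForm (κ : LinearMap.BilinForm ℂ g) : Prop where
  symm : κ.IsSymm
  nondegenerate : κ.Nondegenerate
  invariant : κ.lieInvariant g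

variable {κ : LinearMap.BilinForm ℂ g} {H : LieSubalgebra ℂ g} [H.IsCartanSubalgebra]

lemma IsInvariantForm.lie_apply (hκ : IsInvariantForm κ) (x y z : g) :
    κ ⁅x, y⁆ z = κ x ⁅y, z⁆ := by
  rw [← lie_skew, map_neg, LinearMap.neg_apply, hκ.invariant, neg_neg]

variable [FiniteDimensional ℂ g] [HasCentralRadical ℂ g]

lemma IsInvariantForm.apply_rootSpace (hκ : IsInvariantForm κ) {α : Dual ℂ H} (hα : α ∈ roots H)
    {x : g} (hx : x ∈ rootSpace H α) (h : H) : κ h x = 0 := by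
  obtain ⟨h0, hh0⟩ : ∃ h0, α h0 ≠ 0 := by
    by_contra! h
    exact hα.1 (LinearMap.ext h)
  have h1 := hκ.lie_apply h h0 x
  rw [lie_eq_zero_of_mem_cartan, lie_eq_smul_of_mem_rootSpace hα hx, map_zero, map_smul,
    LinearMap.zero_apply, smul_eq_mul] at h1
  exact (mul_eq_zero.1 h1.symm).resolve_left hh0

/-- Root spaces are orthogonal to `H`, so an element of `H` orthogonal to `H` is orthogonal to
everything. -/
lemma IsInvariantForm.restrict_nondegenerate (hκ : IsInvariantForm κ) :
    (κ.restrict H.toSubmodule).Nondegenerate := by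
  have key : ∀ x : H, (∀ y : H, κ x y = 0) → x = 0 := by
    intro x hx
    refine Subtype.ext (hκ.nondegenerate.1 _ fun z => ?_)
    have h1 : LinearMap.ker (κ x) = ⊤ := eq_top_of_cartan_le_of_rootSpace_le (H := H) hx
      fun α hα z hz => hκ.apply_rootSpace hα hz x
    rw [← LinearMap.mem_ker, h1]
    trivial
  refine ⟨key, fun x hx => key x fun y => ?_⟩
  rw [hκ.symm.eq]
  exact hx y

/-- The isomorphism from the dual of the Cartan subalgebra to the Cartan subalgebra induced by an
invariant form. -/
noncomputable def IsInvariantForm.dualVec (hκ : IsInvariantForm κ) : Dual ℂ H ≃ₗ[ℂ] H :=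
  ((κ.restrict H.toSubmodule).toDual hκ.restrict_nondegenerate).symm

variable (hκ : IsInvariantForm κ)
include hκ

namespace IsInvariantForm

lemma dualVec_apply (v : Dual ℂ H) (x : H) : κ (hκ.dualVec v : g) (x : g) = v x :=
  LinearMap.BilinForm.apply_toDual_symm_apply (hB := hκ.restrict_nondegenerate (H := H)) v x

lemma eq_dualVec {v : Dual ℂ H} {y : H} (h : ∀ x : H, κ (y : g) (x : g) = v x) :
    y = hκ.dualVec v := by
  refine sub_eq_zero.1 (hκ.restrict_nondegenerate.1 _ fun x => ?_)
  have := hκ.dualVec_apply v x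
  change κ ((y - hκ.dualVec v : H) : g) (x : g) = 0
  rw [AddSubgroupClass.coe_sub, map_sub, LinearMap.sub_apply, h, this, sub_self]

lemma lie_eq_dualVec {α : Dual ℂ H} (hα : α ∈ roots H) {x y : g} (hx : x ∈ rootSpace H α)
    (hy : y ∈ rootSpace H ⇑(-α)) (hxy : κ x y = 1) : ⁅x, y⁆ = hκ.dualVec α := by
  obtain ⟨t, ht⟩ := lie_eq_smul_coroot hα hx hy
  rw [ht]
  suffices t • coroot α = hκ.dualVec α by rw [← this]; rfl
  refine hκ.eq_dualVec fun z => ?_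
  change κ (t • (coroot α : g)) z = _
  rw [← ht, hκ.lie_apply, ← lie_skew, lie_eq_smul_of_mem_rootSpace (neg_mem_roots hα) hy]
  simp [hxy]

end IsInvariantForm

namespace AdmissibleQuadruple

variable (D : AdmissibleQuadruple κ H)

omit hκ in
lemma form_e_neg {α : Dual ℂ H} (hα : α ∈ roots H) : κ (D.e α) (D.e (-α)) = 1 := by
  rw [D.form_e α hα _ (neg_mem_roots hα), if_pos (neg_neg α).symm]

omit hκ in
lemma e_ne_zero {α : Dual ℂ H} (hα : α ∈ roots H) : D.e α ≠ 0 := by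
  intro h
  have := D.form_e_neg hα
  simp [h] at this

omit hκ in
lemma lie_e {α : Dual ℂ H} (hα : α ∈ roots H) (h : H) : ⁅(h : g), D.e α⁆ = α h • D.e α :=
  lie_eq_smul_of_mem_rootSpace hα (D.e_mem α hα) h

lemma lie_e_e_neg {α : Dual ℂ H} (hα : α ∈ roots H) :
    ⁅D.e α, D.e (-α)⁆ = hκ.dualVec α :=
  hκ.lie_eq_dualVec hα (D.e_mem α hα) (D.e_mem _ (neg_mem_roots hα)) (D.form_e_neg hα)

omit hκ in
lemma eq_top_of_cartan_le_of_e_mem {p : Submodule ℂ g} (hH : ∀ h : H, (h : g) ∈ p)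
    (hp : ∀ α ∈ roots H, D.e α ∈ p) : p = ⊤ := by
  refine eq_top_of_cartan_le_of_rootSpace_le hH fun α hα x hx => ?_
  obtain ⟨c, rfl⟩ := exists_smul_eq_of_mem_rootSpace hα (D.e_mem α hα) (D.e_ne_zero hα) hx
  exact p.smul_mem c (hp α hα)

include D

lemma exists_dualVec_eq_smul {α : Dual ℂ H} (hα : α ∈ roots H) :
    ∃ t : ℂ, t ≠ 0 ∧ hκ.dualVec α = t • coroot α := by
  obtain ⟨t, ht⟩ := lie_eq_smul_coroot hα (D.e_mem α hα) (D.e_mem _ (neg_mem_roots hα))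
  rw [D.lie_e_e_neg hκ hα] at ht
  have ht' : hκ.dualVec α = t • coroot α := Subtype.ext ht
  refine ⟨t, ?_, ht'⟩
  rintro rfl
  rw [zero_smul, LinearEquiv.map_eq_zero_iff] at ht'
  exact hα.1 ht'

lemma apply_dualVec_self_ne_zero {α : Dual ℂ H} (hα : α ∈ roots H) :
    α (hκ.dualVec α) ≠ 0 := by
  obtain ⟨t, ht, h⟩ := D.exists_dualVec_eq_smul hκ hα
  rw [h, map_smul, apply_coroot_self hα]
  simpa using ht

lemma coroot_eq {α : Dual ℂ H} (hα : α ∈ roots H) :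
    coroot α = (2 / α (hκ.dualVec α)) • hκ.dualVec α := by
  obtain ⟨t, ht, h⟩ := D.exists_dualVec_eq_smul hκ hα
  rw [h, map_smul, apply_coroot_self hα, smul_smul, smul_eq_mul, div_mul_eq_mul_div,
    mul_comm t 2, div_self (by simpa using ht), one_smul]

/-- The Killing form pairs a coroot with an element of the Cartan subalgebra by a positive multiple
of the root. -/
lemma exists_pos_killingForm_coroot {α : Dual ℂ H} (hα : α ∈ roots H) :
    ∃ s : ℝ, 0 < s ∧ ∀ x : H, killingForm ℂ g x (coroot α) = s * α x := by
  obtain ⟨t, ht, h⟩ := D.exists_dualVec_eq_smul hκ hα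
  -- The coroot is a multiple of `⁅e_α, e_{-α}⁆`, so invariance makes the pairing a constant
  -- multiple of `α x`. Evaluating at the coroot itself identifies this constant.
  have h1 : ∀ x : H, killingForm ℂ g x (coroot α) =
      t⁻¹ * killingForm ℂ g (D.e α) (D.e (-α)) * α x := by
    intro x
    have h2 : (coroot α : g) = t⁻¹ • ⁅D.e α, D.e (-α)⁆ := by
      rw [D.lie_e_e_neg hκ hα, h]
      change _ = t⁻¹ • (t • (coroot α : g))
      rw [inv_smul_smul₀ ht]
    rw [h2, map_smul, killingForm_lie_eq, D.lie_e hα, map_smul, LinearMap.smul_apply]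
    simp only [smul_eq_mul]
    ring
  choose n hn using fun χ : Weight ℂ H g => weight_apply_coroot_eq_intCast χ hα
  have h3 : killingForm ℂ g (coroot α : g) (coroot α) =
      ((∑ χ : Weight ℂ H g, (finrank ℂ (genWeightSpace g χ) : ℝ) * (n χ : ℝ) ^ 2 : ℝ) : ℂ) := by
    rw [killingForm_eq_sum]
    push_cast
    exact Finset.sum_congr rfl fun χ _ => by rw [hn, sq]
  set S : ℝ := ∑ χ : Weight ℂ H g, (finrank ℂ (genWeightSpace g χ) : ℝ) * (n χ : ℝ) ^ 2 with hS
  have hpos : 0 < S := by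
    let χ₀ : Weight ℂ H g := ⟨α, hα.2⟩
    refine Finset.sum_pos' (fun χ _ => by positivity) ⟨χ₀, Finset.mem_univ _, ?_⟩
    have h4 : (n χ₀ : ℂ) = 2 := by rw [← hn]; exact apply_coroot_self hα
    have h5 : n χ₀ = 2 := by exact_mod_cast h4
    have h6 : 0 < finrank ℂ (genWeightSpace g χ₀) := by
      have : Nontrivial (genWeightSpace g χ₀) :=
        (LieSubmodule.nontrivial_iff_ne_bot ℂ H g).2 χ₀.genWeightSpace_ne_bot
      exact finrank_pos (R := ℂ) (M := genWeightSpace g χ₀)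
    rw [h5]
    positivity
  -- Division by 2 because `α (coroot α) = 2`.
  refine ⟨S / 2, by positivity, fun x => ?_⟩
  rw [h1, apply_coroot_self hα] at h3
  rw [h1]
  push_cast
  rw [← h3]
  ring

/-- A combination of a set of roots vanishing on the vectors dual to these roots is zero. -/
lemma eq_zero_of_mem_span_of_apply_dualVec_eq_zero {C : Set (Dual ℂ H)} (hC : C ⊆ roots H)
    {v : Dual ℂ H} (hv : v ∈ Submodule.span ℂ C) (h : ∀ b ∈ C, v (hκ.dualVec b) = 0) : v = 0 := by
  -- `x` represents `v` for the Killing form, and `y` is a complex conjugate of `x`: it exists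
  -- because weights take integer values on coroots. Then `v y` is the sum of `dim · |χ x|²` over
  -- the weights, while the hypothesis forces `v y = 0`.
  have hv' : ∃ x y : H, (∀ z : H, killingForm ℂ g z x = v z) ∧
      (∀ χ : Weight ℂ H g, χ y = starRingEnd ℂ (χ x)) ∧ y ∈ Submodule.span ℂ (coroot '' C) := by
    clear h
    induction hv using Submodule.span_induction with
    | mem b hb =>
      obtain ⟨s, hs, h⟩ := D.exists_pos_killingForm_coroot hκ (hC hb)
      refine ⟨(s : ℂ)⁻¹ • coroot b, (s : ℂ)⁻¹ • coroot b, fun z => ?_, fun χ => ?_,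
        Submodule.smul_mem _ _ (Submodule.subset_span ⟨b, hb, rfl⟩)⟩
      · change killingForm ℂ g z ((s : ℂ)⁻¹ • (coroot b : g)) = _
        rw [map_smul, h, smul_eq_mul, inv_mul_cancel_left₀ (by exact_mod_cast hs.ne')]
      · obtain ⟨n, hn⟩ := weight_apply_coroot_eq_intCast χ (hC hb)
        have h1 : χ ((s : ℂ)⁻¹ • coroot b) = (s : ℂ)⁻¹ * n := by
          rw [← hn]
          exact map_smul χ.toLinear _ _
        rw [h1]
        simp
    | zero =>
      refine ⟨0, 0, fun z => by simp, fun χ => ?_, zero_mem _⟩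
      have : χ (0 : H) = 0 := map_zero χ.toLinear
      rw [this, map_zero]
    | add v w _ _ hv hw =>
      obtain ⟨x, y, h1, h2, h3⟩ := hv
      obtain ⟨x', y', h1', h2', h3'⟩ := hw
      refine ⟨x + x', y + y', fun z => by simp [h1, h1'], fun χ => ?_, add_mem h3 h3'⟩
      have h4 : ∀ a b : H, χ (a + b) = χ a + χ b := map_add χ.toLinear
      rw [h4, h4, map_add, h2, h2']
    | smul c v _ hv =>
      obtain ⟨x, y, h1, h2, h3⟩ := hv
      refine ⟨c • x, (starRingEnd ℂ c) • y, fun z => ?_, fun χ => ?_, Submodule.smul_mem _ _ h3⟩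
      · change killingForm ℂ g z (c • (x : g)) = _
        rw [map_smul, h1]
        rfl
      · have h4 : ∀ (a : ℂ) (b : H), χ (a • b) = a * χ b := map_smul χ.toLinear
        rw [h4, h4, map_mul, h2]
  obtain ⟨x, y, hx, hxy, hy⟩ := hv'
  have h1 : v y = 0 := by
    have : Submodule.span ℂ (coroot '' C) ≤ LinearMap.ker v := by
      rw [Submodule.span_le]
      rintro _ ⟨b, hb, rfl⟩
      rw [SetLike.mem_coe, LinearMap.mem_ker, D.coroot_eq hκ (hC hb), map_smul, h b hb, smul_zero]
    exact this hy
  rw [← hx, killingForm_eq_sum] at h1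
  have h2 : ((∑ χ : Weight ℂ H g, (finrank ℂ (genWeightSpace g χ) : ℝ) * ‖χ x‖ ^ 2 : ℝ) : ℂ) = 0 := by
    rw [← h1]
    push_cast
    exact Finset.sum_congr rfl fun χ _ => by rw [hxy, Complex.conj_mul']
  norm_cast at h2
  rw [Finset.sum_eq_zero_iff_of_nonneg fun χ _ => by positivity] at h2
  ext z
  rw [← hx, killingForm_eq_sum]
  refine Finset.sum_eq_zero fun χ hχ => ?_
  rcases mul_eq_zero.1 (h2 χ hχ) with h3 | h3
  · rw [Nat.cast_eq_zero.1 h3]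
    simp
  · have : χ x = 0 := by simpa using h3
    rw [this]
    simp

/-- Symmetry of the Killing form gives `s * m = t * n` with `s` and `t` positive. -/
lemma apply_coroot_pos_comm {α β : Dual ℂ H} (hα : α ∈ roots H) (hβ : β ∈ roots H) {m n : ℤ}
    (hm : α (coroot β) = m) (hn : β (coroot α) = n) (h : 0 < n) : 0 < m := by
  obtain ⟨s, hs, h1⟩ := D.exists_pos_killingForm_coroot hκ hα
  obtain ⟨t, ht, h2⟩ := D.exists_pos_killingForm_coroot hκ hβ
  have h3 := h1 (coroot β)
  have h4 := h2 (coroot α)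
  rw [LieModule.traceForm_comm, h3, hm, hn] at h4
  have h5 : s * m = t * n := by exact_mod_cast h4
  have h6 : (0 : ℝ) < s * m := by
    rw [h5]
    have : (0 : ℝ) < n := by exact_mod_cast h
    positivity
  exact_mod_cast (pos_iff_pos_of_mul_pos h6).1 hs

end AdmissibleQuadruple

end Form

/-! ### Bases, counting functionals, and isometries that preserve roots. -/

section Base

lemma exists_linearMap_eqOn {V W : Type*} [AddCommGroup V] [Module ℂ V] [AddCommGroup W]
    [Module ℂ W] {B : Set V} (hB : LinearIndepOn ℂ id B) (φ : V → W) :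
    ∃ F : V →ₗ[ℂ] W, ∀ b ∈ B, F b = φ b := by
  refine ⟨(Basis.extend hB).constr ℂ fun b => φ b, fun b hb => ?_⟩
  have := (Basis.extend hB).constr_basis ℂ (fun b => φ b) ⟨b, Basis.subset_extend hB hb⟩
  rwa [Basis.extend_apply_self] at this

/-- For a subset `C` of a linearly independent set `B`, there is a functional which counts the
elements of `B \ C` in the nonnegative integral combinations of `B`. -/
lemma exists_counting_functional {V : Type*} [AddCommGroup V] [Module ℂ V] {B : Set V}
    (hB : LinearIndepOn ℂ id B) (C : Set V) :
    ∃ F : V →ₗ[ℂ] ℂ, (∀ b ∈ B ∩ C, F b = 0) ∧ (∀ b ∈ B \ C, F b = 1) ∧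
      ∀ x ∈ AddSubmonoid.closure B, ∃ n : ℕ, F x = n ∧ (n = 0 → x ∈ AddSubmonoid.closure C) := by
  classical
  obtain ⟨F, hF⟩ := exists_linearMap_eqOn hB fun b => if b ∈ C then (0 : ℂ) else 1
  refine ⟨F, fun b hb => ?_, fun b hb => ?_, fun x hx => ?_⟩
  · rw [hF b hb.1, if_pos hb.2]
  · rw [hF b hb.1, if_neg hb.2]
  · induction hx using AddSubmonoid.closure_induction with
    | mem b hb =>
      by_cases h : b ∈ C
      · exact ⟨0, by rw [hF b hb, if_pos h, Nat.cast_zero], fun _ => AddSubmonoid.subset_closure h⟩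
      · exact ⟨1, by rw [hF b hb, if_neg h, Nat.cast_one], fun h => absurd h one_ne_zero⟩
    | zero => exact ⟨0, by simp, fun _ => zero_mem _⟩
    | add x y _ _ hx hy =>
      obtain ⟨m, hm, hm'⟩ := hx
      obtain ⟨n, hn, hn'⟩ := hy
      refine ⟨m + n, by rw [map_add, hm, hn, Nat.cast_add], fun h => ?_⟩
      exact add_mem (hm' (by omega)) (hn' (by omega))

lemma map_eq_zero_of_mem_closure {V W : Type*} [AddCommGroup V] [AddCommGroup W] [Module ℂ V]
    [Module ℂ W] {C : Set V} {F : V →ₗ[ℂ] W} (hF : ∀ b ∈ C, F b = 0) {x : V}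
    (hx : x ∈ AddSubgroup.closure C) : F x = 0 := by
  have : AddSubgroup.closure C ≤ F.toAddMonoidHom.ker := by
    rw [AddSubgroup.closure_le]
    exact hF
  exact this hx

lemma closure_le_addSubgroup_closure {V : Type*} [AddCommGroup V] {C : Set V} {x : V}
    (hx : x ∈ AddSubmonoid.closure C) : x ∈ AddSubgroup.closure C :=
  (AddSubmonoid.closure_le (S := (AddSubgroup.closure C).toAddSubmonoid)).2
    AddSubgroup.subset_closure hx

open LieAlgebra

variable {g : Type*} [LieRing g] [LieAlgebra ℂ g]
  {κ : LinearMap.BilinForm ℂ g} {H : LieSubalgebra ℂ g} [H.IsCartanSubalgebra]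

section

variable {B : Set (Dual ℂ H)} (hB : IsBase H B)
include hB

/-- The functional counting base elements outside `C` vanishes on integral combinations of `C`, so
none occur in `x`. -/
lemma IsBase.mem_closure_of_mem_addSubgroup_closure {C : Set (Dual ℂ H)} (hC : C ⊆ B)
    {x : Dual ℂ H} (hx : x ∈ AddSubmonoid.closure B) (hx' : x ∈ AddSubgroup.closure C) :
    x ∈ AddSubmonoid.closure C := by
  obtain ⟨F, hF0, -, hF⟩ := exists_counting_functional hB.linearIndepOn C
  obtain ⟨n, hn, h⟩ := hF x hx
  refine h ?_
  rw [map_eq_zero_of_mem_closure (fun b hb => hF0 b ⟨hC hb, hb⟩) hx'] at hn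
  exact_mod_cast hn.symm

lemma IsBase.eq_zero_of_mem_of_neg_mem {x : Dual ℂ H} (hx : x ∈ AddSubmonoid.closure B)
    (hx' : -x ∈ AddSubmonoid.closure B) : x = 0 := by
  obtain ⟨F, -, -, hF⟩ := exists_counting_functional hB.linearIndepOn ∅
  obtain ⟨m, hm, h⟩ := hF x hx
  obtain ⟨n, hn, -⟩ := hF _ hx'
  rw [map_neg, hm] at hn
  have h1 : (m + n : ℂ) = 0 := by rw [← hn]; ring
  have h2 : m + n = 0 := by exact_mod_cast h1
  simpa using h (by omega)

/-- If `x` is an integral combination of `C`, `y` is a nonnegative combination of the base which is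
not an integral combination of `C`, and `x + y` is a root, then `x + y` is positive. -/
lemma IsBase.add_mem_closure {C : Set (Dual ℂ H)} (hC : C ⊆ B) {x y : Dual ℂ H}
    (hx : x ∈ AddSubgroup.closure C) (hy : y ∈ AddSubmonoid.closure B)
    (hy' : y ∉ AddSubgroup.closure C) (hxy : x + y ∈ roots H) :
    x + y ∈ AddSubmonoid.closure B := by
  refine (hB.pos_or_neg _ hxy).resolve_right fun h => hy' ?_
  obtain ⟨F, hF0, -, hF⟩ := exists_counting_functional hB.linearIndepOn C
  obtain ⟨m, hm, h1⟩ := hF y hy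
  obtain ⟨n, hn, -⟩ := hF _ h
  rw [map_neg, map_add, map_eq_zero_of_mem_closure (fun b hb => hF0 b ⟨hC hb, hb⟩) hx, hm,
    zero_add] at hn
  have h1 : (m + n : ℂ) = 0 := by rw [← hn]; ring
  have h2 : m + n = 0 := by exact_mod_cast h1
  exact closure_le_addSubgroup_closure ((‹m = 0 → _›) (by omega))

/-- The number of base elements outside `C` is additive on nonnegative combinations and is already
nonzero for `x`. -/
lemma IsBase.add_notMem_closure {C : Set (Dual ℂ H)} (hC : C ⊆ B) {x y : Dual ℂ H}
    (hx : x ∈ AddSubmonoid.closure B) (hx' : x ∉ AddSubgroup.closure C)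
    (hy : y ∈ AddSubmonoid.closure B) : x + y ∉ AddSubgroup.closure C := by
  intro hxy
  obtain ⟨F, hF0, -, hF⟩ := exists_counting_functional hB.linearIndepOn C
  obtain ⟨m, hm, h1⟩ := hF x hx
  obtain ⟨n, hn, -⟩ := hF y hy
  have h0 := map_eq_zero_of_mem_closure (fun b hb => hF0 b ⟨hC hb, hb⟩) hxy
  rw [map_add, hm, hn] at h0
  have h2 : m + n = 0 := by exact_mod_cast h0
  exact hx' (closure_le_addSubgroup_closure (h1 (by omega)))

end

variable [FiniteDimensional ℂ g] [HasCentralRadical ℂ g]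
variable (hκ : IsInvariantForm κ) (D : AdmissibleQuadruple κ H)
include hκ

namespace AdmissibleQuadruple

/-- A linear map which is isometric on a set of simple roots and maps these to roots maps the
positive roots generated by this set to roots. -/
lemma map_mem_roots_of_isometry {C : Set (Dual ℂ H)} (hC : C ⊆ D.B)
    {F : Dual ℂ H →ₗ[ℂ] Dual ℂ H} (hF : ∀ b ∈ C, F b ∈ roots H)
    (hiso : ∀ b ∈ C, ∀ b' ∈ C, F b (hκ.dualVec (F b')) = b (hκ.dualVec b'))
    {α : Dual ℂ H} (hα : α ∈ roots H) (hαC : α ∈ AddSubmonoid.closure C) : F α ∈ roots H := by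
  have hB := D.isBase
  -- With the empty set excluded every base element counts once, so `ht` is the height; the
  -- induction is on the height of `α`.
  obtain ⟨ht, -, ht1, hht⟩ := exists_counting_functional hB.linearIndepOn ∅
  have hCB : AddSubmonoid.closure C ≤ AddSubmonoid.closure D.B := AddSubmonoid.closure_mono hC
  obtain ⟨n, hn, -⟩ := hht α (hCB hαC)
  induction n using Nat.strong_induction_on generalizing α with
  | _ n ih =>
  by_cases hmem : α ∈ C
  · exact hF α hmem
  -- Some `b ∈ C` pairs positively with `α`. Otherwise every combination of `C`, including `α`
  -- itself, would pair nonpositively with the coroot of `α`, contradicting the value 2.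
  obtain ⟨b, hb, m, hm, hm0⟩ : ∃ b ∈ C, ∃ m : ℤ, α (coroot b) = m ∧ 0 < m := by
    by_contra! hcon
    have key : ∀ x ∈ AddSubmonoid.closure C, ∃ k : ℤ, x (coroot α) = k ∧ k ≤ 0 := by
      intro x hx
      induction hx using AddSubmonoid.closure_induction with
      | mem b hb =>
        obtain ⟨k, hk⟩ := apply_coroot_eq_intCast hα (hB.subset (hC hb))
        obtain ⟨l, hl⟩ := apply_coroot_eq_intCast (hB.subset (hC hb)) hα
        refine ⟨k, hk, ?_⟩
        by_contra! h
        exact absurd (D.apply_coroot_pos_comm hκ hα (hB.subset (hC hb)) hl hk h)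
          (not_lt.2 (hcon b hb l hl))
      | zero => exact ⟨0, by simp, le_rfl⟩
      | add x y _ _ hx hy =>
        obtain ⟨k, hk, hk'⟩ := hx
        obtain ⟨l, hl, hl'⟩ := hy
        exact ⟨k + l, by rw [LinearMap.add_apply, hk, hl, Int.cast_add], by omega⟩
    obtain ⟨k, hk, hk'⟩ := key α hαC
    rw [apply_coroot_self hα] at hk
    have : k = 2 := by exact_mod_cast hk.symm
    omega
  have hbR : b ∈ roots H := hB.subset (hC hb)
  have hα' := sub_smul_mem_roots hbR hα
  rw [hm] at hα'
  have hpos : α - (m : ℂ) • b ∈ AddSubmonoid.closure D.B := by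
    refine (hB.pos_or_neg _ hα').resolve_right fun hneg => ?_
    -- Reflection in `b` does not change the coefficients of the other simple roots. If the
    -- reflected root were negative, these would vanish and `α` would be a multiple of `b`, hence
    -- `b` itself.
    obtain ⟨F', hF'0, -, hF'⟩ := exists_counting_functional hB.linearIndepOn {b}
    obtain ⟨k, hk, hk'⟩ := hF' α (hCB hαC)
    obtain ⟨l, hl, -⟩ := hF' _ hneg
    rw [map_neg, map_sub, map_smul, hF'0 b ⟨hC hb, rfl⟩, smul_zero, sub_zero, hk] at hl
    have h1 : (k + l : ℂ) = 0 := by rw [← hl]; ring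
    have h2 : k + l = 0 := by exact_mod_cast h1
    obtain ⟨j, rfl⟩ := AddSubmonoid.mem_closure_singleton.1 (hk' (by omega))
    rw [← Nat.cast_smul_eq_nsmul ℂ] at hα
    rcases eq_one_or_eq_neg_one_of_smul_mem_roots hbR hα with h3 | h3
    · rw [← Nat.cast_smul_eq_nsmul ℂ, h3, one_smul] at hmem
      exact hmem hb
    · have h4 : (j + 1 : ℂ) = 0 := by rw [h3]; ring
      have h5 : j + 1 = 0 := by exact_mod_cast h4
      omega
  have hαC' : α - (m : ℂ) • b ∈ AddSubmonoid.closure C := by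
    refine hB.mem_closure_of_mem_addSubgroup_closure hC hpos ?_
    rw [Int.cast_smul_eq_zsmul]
    exact sub_mem (closure_le_addSubgroup_closure hαC)
      (zsmul_mem (AddSubgroup.subset_closure hb) m)
  obtain ⟨n', hn', -⟩ := hht _ hpos
  have hlt : n' < n := by
    rw [map_sub, map_smul, hn, ht1 b ⟨hC hb, Set.notMem_empty b⟩, smul_eq_mul, mul_one] at hn'
    have h1 : (n : ℂ) = n' + m := by rw [← hn']; ring
    have h2 : (n : ℤ) = n' + m := by exact_mod_cast h1
    omega
  have hrec := ih n' hlt hα' hαC' hn'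
  have hiso' : ∀ x ∈ AddSubmonoid.closure C, F x (hκ.dualVec (F b)) = x (hκ.dualVec b) := by
    intro x hx
    induction hx using AddSubmonoid.closure_induction with
    | mem x hx => exact hiso x hx b hb
    | zero => simp
    | add x y _ _ hx hy => rw [map_add, LinearMap.add_apply, hx, hy, LinearMap.add_apply]
  -- Being isometric on `C`, `F` preserves pairings with the coroot of `b`; reflecting the root `F
  -- (α - m b)` in `F b` therefore gives back `F α`.
  have h1 : F (α - (m : ℂ) • b) (coroot (F b)) = -m := by
    rw [D.coroot_eq hκ (hF b hb), map_smul, hiso' _ hαC', hiso b hb b hb, ← map_smul,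
      ← D.coroot_eq hκ hbR, LinearMap.sub_apply, LinearMap.smul_apply, apply_coroot_self hbR, hm]
    simp only [smul_eq_mul]
    ring
  have h2 := sub_smul_mem_roots (hF b hb) hrec
  rw [h1] at h2
  convert h2 using 1
  rw [map_sub, map_smul]
  module

end AdmissibleQuadruple

end Base

/-! ### The additive extension of τ: injectivity, absence of cycles, action on roots. -/

section Tau

lemma tauRel_iff {V : Type*} [AddCommGroup V] {τ : V → V} {B₁ : Set V} {F : V →+ V}
    (hF : ∀ b ∈ B₁, F b = τ b) {α β : V} :
    TauRel τ B₁ α β ↔ α ∈ AddSubgroup.closure B₁ ∧ F α = β := by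
  have h1 : (fun b => (b, τ b)) '' B₁ = (AddMonoidHom.prod (AddMonoidHom.id V) F) '' B₁ :=
    Set.image_congr fun b hb => by simp [hF b hb]
  rw [TauRel, h1, ← AddMonoidHom.map_closure, AddSubgroup.mem_map]
  constructor
  · rintro ⟨x, hx, h⟩
    obtain ⟨rfl, rfl⟩ := Prod.ext_iff.1 h
    exact ⟨hx, rfl⟩
  · rintro ⟨hx, rfl⟩
    exact ⟨α, hx, rfl⟩

lemma TauRel.neg {V : Type*} [AddCommGroup V] {τ : V → V} {B₁ : Set V} {α β : V}
    (h : TauRel τ B₁ α β) : TauRel τ B₁ (-α) (-β) :=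
  (AddSubgroup.closure _).neg_mem h

lemma TauRel.add {V : Type*} [AddCommGroup V] {τ : V → V} {B₁ : Set V} {α β α' β' : V}
    (h : TauRel τ B₁ α β) (h' : TauRel τ B₁ α' β') : TauRel τ B₁ (α + α') (β + β') :=
  (AddSubgroup.closure _).add_mem h h'

lemma TauRel.of_mem {V : Type*} [AddCommGroup V] {τ : V → V} {B₁ : Set V} {b : V}
    (hb : b ∈ B₁) : TauRel τ B₁ b (τ b) :=
  AddSubgroup.subset_closure ⟨b, hb, rfl⟩

/-- The conditions on `P` say that it defines a subgroup of `V × V` containing the generators. -/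
lemma tauRel_induction {V : Type*} [AddCommGroup V] {τ : V → V} {B₁ : Set V}
    {P : V → V → Prop} (mem : ∀ b ∈ B₁, P b (τ b)) (zero : P 0 0)
    (add : ∀ α β α' β', P α β → P α' β' → P (α + α') (β + β'))
    (neg : ∀ α β, P α β → P (-α) (-β)) {α β : V} (h : TauRel τ B₁ α β) : P α β := by
  let K : AddSubgroup (V × V) :=
    { carrier := {x | P x.1 x.2}
      zero_mem' := zero
      add_mem' := fun {x y} hx hy => add _ _ _ _ hx hy
      neg_mem' := fun {x} hx => neg _ _ hx }
  have : AddSubgroup.closure ((fun b => (b, τ b)) '' B₁) ≤ K := by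
    rw [AddSubgroup.closure_le]
    rintro _ ⟨b, hb, rfl⟩
    exact mem b hb
  exact this h

open LieAlgebra

variable {g : Type*} [LieRing g] [LieAlgebra ℂ g]
  {κ : LinearMap.BilinForm ℂ g} {H : LieSubalgebra ℂ g} [H.IsCartanSubalgebra]

namespace AdmissibleQuadruple

variable (D : AdmissibleQuadruple κ H)

lemma B₁_subset_roots : D.B₁ ⊆ roots H := D.B₁_subset.trans D.isBase.subset

lemma B₂_subset_roots : D.B₂ ⊆ roots H := D.B₂_subset.trans D.isBase.subset

lemma exists_tau_linearMap : ∃ F : Dual ℂ H →ₗ[ℂ] Dual ℂ H, ∀ b ∈ D.B₁, F b = D.τ b := by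
  obtain ⟨F, hF⟩ := exists_linearMap_eqOn D.isBase.linearIndepOn D.τ
  exact ⟨F, fun b hb => hF b (D.B₁_subset hb)⟩

/-- A linear extension of `τ`. -/
noncomputable def tauHat : Dual ℂ H →ₗ[ℂ] Dual ℂ H := D.exists_tau_linearMap.choose

lemma tauHat_apply {b : Dual ℂ H} (hb : b ∈ D.B₁) : D.tauHat b = D.τ b :=
  D.exists_tau_linearMap.choose_spec b hb

lemma exists_tauInv_linearMap :
    ∃ F : Dual ℂ H →ₗ[ℂ] Dual ℂ H, ∀ b ∈ D.B₁, F (D.τ b) = b := by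
  obtain ⟨F, hF⟩ := exists_linearMap_eqOn D.isBase.linearIndepOn (Function.invFunOn D.τ D.B₁)
  refine ⟨F, fun b hb => ?_⟩
  rw [hF _ (D.B₂_subset (D.bijOn.mapsTo hb))]
  exact D.bijOn.injOn.leftInvOn_invFunOn hb

/-- A linear extension of the inverse of `τ`. -/
noncomputable def tauInv : Dual ℂ H →ₗ[ℂ] Dual ℂ H := D.exists_tauInv_linearMap.choose

lemma tauInv_apply {b : Dual ℂ H} (hb : b ∈ D.B₁) : D.tauInv (D.τ b) = b :=
  D.exists_tauInv_linearMap.choose_spec b hb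

lemma tauRel_iff_tauHat {α β : Dual ℂ H} :
    TauRel D.τ D.B₁ α β ↔ α ∈ AddSubgroup.closure D.B₁ ∧ D.tauHat α = β :=
  tauRel_iff (F := D.tauHat.toAddMonoidHom) fun _ => D.tauHat_apply

lemma tauRel_tauHat {α : Dual ℂ H} (hα : α ∈ AddSubgroup.closure D.B₁) :
    TauRel D.τ D.B₁ α (D.tauHat α) :=
  D.tauRel_iff_tauHat.2 ⟨hα, rfl⟩

variable {D}

lemma _root_.BelavinDrinfeld.TauRel.mem_left {α β : Dual ℂ H} (h : TauRel D.τ D.B₁ α β) :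
    α ∈ AddSubgroup.closure D.B₁ :=
  (D.tauRel_iff_tauHat.1 h).1

lemma _root_.BelavinDrinfeld.TauRel.tauHat_eq {α β : Dual ℂ H} (h : TauRel D.τ D.B₁ α β) :
    D.tauHat α = β :=
  (D.tauRel_iff_tauHat.1 h).2

lemma _root_.BelavinDrinfeld.TauRel.tauInv_eq {α β : Dual ℂ H} (h : TauRel D.τ D.B₁ α β) :
    D.tauInv β = α := by
  refine tauRel_induction (P := fun α β => D.tauInv β = α) (fun b hb => D.tauInv_apply hb)
    (map_zero _) (fun α β α' β' h h' => ?_) (fun α β h => ?_) h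
  · rw [map_add, h, h']
  · rw [map_neg, h]

lemma _root_.BelavinDrinfeld.TauRel.right_unique {α β β' : Dual ℂ H} (h : TauRel D.τ D.B₁ α β)
    (h' : TauRel D.τ D.B₁ α β') : β = β' :=
  h.tauHat_eq.symm.trans h'.tauHat_eq

lemma _root_.BelavinDrinfeld.TauRel.left_unique {α α' β : Dual ℂ H} (h : TauRel D.τ D.B₁ α β)
    (h' : TauRel D.τ D.B₁ α' β) : α = α' :=
  h.tauInv_eq.symm.trans h'.tauInv_eq

lemma _root_.BelavinDrinfeld.TauRel.mem_right {α β : Dual ℂ H} (h : TauRel D.τ D.B₁ α β) :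
    β ∈ AddSubgroup.closure D.B₂ :=
  tauRel_induction (P := fun _ β => β ∈ AddSubgroup.closure D.B₂)
    (fun _ hb => AddSubgroup.subset_closure (D.bijOn.mapsTo hb)) (zero_mem _)
    (fun _ _ _ _ => add_mem) (fun _ _ => neg_mem) h

lemma exists_tauRel_of_mem {β : Dual ℂ H} (h : β ∈ AddSubgroup.closure D.B₂) :
    ∃ α, TauRel D.τ D.B₁ α β := by
  induction h using AddSubgroup.closure_induction with
  | mem b hb =>
    obtain ⟨a, ha, rfl⟩ := D.bijOn.surjOn hb
    exact ⟨a, TauRel.of_mem ha⟩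
  | zero => exact ⟨0, (AddSubgroup.closure _).zero_mem⟩
  | add x y _ _ hx hy =>
    obtain ⟨a, ha⟩ := hx
    obtain ⟨b, hb⟩ := hy
    exact ⟨a + b, ha.add hb⟩
  | neg x _ hx =>
    obtain ⟨a, ha⟩ := hx
    exact ⟨-a, ha.neg⟩

lemma _root_.BelavinDrinfeld.TauRel.mem_closure {α β : Dual ℂ H} (h : TauRel D.τ D.B₁ α β)
    (hα : α ∈ AddSubmonoid.closure D.B) : β ∈ AddSubmonoid.closure D.B := by
  have h1 := D.isBase.mem_closure_of_mem_addSubgroup_closure D.B₁_subset hα h.mem_left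
  rw [← h.tauHat_eq]
  clear h hα
  induction h1 using AddSubmonoid.closure_induction with
  | mem b hb =>
    rw [D.tauHat_apply hb]
    exact AddSubmonoid.subset_closure (D.B₂_subset (D.bijOn.mapsTo hb))
  | zero => rw [map_zero]; exact zero_mem _
  | add x y _ _ hx hy => rw [map_add]; exact add_mem hx hy

lemma _root_.BelavinDrinfeld.TauRel.mem_closure' {α β : Dual ℂ H} (h : TauRel D.τ D.B₁ α β)
    (hβ : β ∈ AddSubmonoid.closure D.B) : α ∈ AddSubmonoid.closure D.B := by
  have h1 := D.isBase.mem_closure_of_mem_addSubgroup_closure D.B₂_subset hβ h.mem_right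
  rw [← h.tauInv_eq]
  clear h hβ
  induction h1 using AddSubmonoid.closure_induction with
  | mem b hb =>
    obtain ⟨a, ha, rfl⟩ := D.bijOn.surjOn hb
    rw [D.tauInv_apply ha]
    exact AddSubmonoid.subset_closure (D.B₁_subset ha)
  | zero => rw [map_zero]; exact zero_mem _
  | add x y _ _ hx hy => rw [map_add]; exact add_mem hx hy

/-- The relation generated by `τ` has no cycles among the positive combinations. -/
lemma eq_zero_of_transGen {α : Dual ℂ H} (h : Relation.TransGen (TauRel D.τ D.B₁) α α)
    (hα : α ∈ AddSubmonoid.closure D.B) : α = 0 := by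
  classical
  obtain ⟨ht, -, ht1, hht⟩ := exists_counting_functional D.isBase.linearIndepOn ∅
  have hex : ∀ b, ∃ t : ℕ, D.τ^[t] b ∉ D.B₁ := fun b => by
    by_cases hb : b ∈ D.B₁
    · exact D.nilpotent b hb
    · exact ⟨0, hb⟩
  -- On a base element, `w` is the number of applications of τ needed to leave `B₁`. One step lowers
  -- it by 1 on `B₁`, hence by the height on combinations, while the height is preserved. Around a
  -- cycle of length `n` this gives `n * ht α = 0`.
  obtain ⟨w, hw⟩ := exists_linearMap_eqOn D.isBase.linearIndepOn
    fun b => ((Nat.find (hex b) : ℕ) : ℂ)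
  have hstep : ∀ b ∈ D.B₁, w b = w (D.τ b) + 1 := by
    intro b hb
    rw [hw b (D.B₁_subset hb), hw _ (D.B₂_subset (D.bijOn.mapsTo hb))]
    have : Nat.find (hex b) = Nat.find (hex (D.τ b)) + 1 := by
      refine (Nat.find_eq_iff _).2 ⟨?_, fun n hn => ?_⟩
      · rw [Function.iterate_succ_apply]
        exact Nat.find_spec (hex (D.τ b))
      · rw [not_not]
        cases n with
        | zero => exact hb
        | succ n =>
          rw [Function.iterate_succ_apply]
          exact not_not.1 (Nat.find_min (hex (D.τ b)) (by omega))
    rw [this]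
    push_cast
    rfl
  have hrel : ∀ α β, TauRel D.τ D.B₁ α β → ht β = ht α ∧ w α = w β + ht α := by
    intro α β h
    refine tauRel_induction (P := fun α β => ht β = ht α ∧ w α = w β + ht α)
      (fun b hb => ?_) (by simp) (fun α β α' β' h h' => ?_) (fun α β h => ?_) h
    · rw [ht1 b ⟨D.B₁_subset hb, Set.notMem_empty _⟩,
        ht1 _ ⟨D.B₂_subset (D.bijOn.mapsTo hb), Set.notMem_empty _⟩]
      exact ⟨rfl, hstep b hb⟩
    · simp only [map_add]
      rw [h.1, h'.1, h.2, h'.2]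
      exact ⟨rfl, by ring⟩
    · simp only [map_neg]
      rw [h.1, h.2]
      exact ⟨rfl, by ring⟩
  have htrans : ∀ β, Relation.TransGen (TauRel D.τ D.B₁) α β →
      ∃ n : ℕ, 0 < n ∧ ht β = ht α ∧ w α = w β + n * ht α := by
    intro β h
    induction h with
    | single h => exact ⟨1, one_pos, (hrel _ _ h).1, by simpa using (hrel _ _ h).2⟩
    | tail _ h ih =>
      obtain ⟨n, hn, h1, h2⟩ := ih
      obtain ⟨h3, h4⟩ := hrel _ _ h
      refine ⟨n + 1, by omega, h3.trans h1, ?_⟩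
      rw [h2, h4, h1]
      push_cast
      ring
  obtain ⟨n, hn, -, h1⟩ := htrans α h
  obtain ⟨m, hm, h2⟩ := hht α hα
  rw [left_eq_add, mul_eq_zero, hm] at h1
  simpa using h2 (by exact_mod_cast h1.resolve_left (by exact_mod_cast hn.ne'))

variable [FiniteDimensional ℂ g] [HasCentralRadical ℂ g]
variable (hκ : IsInvariantForm κ)
include hκ

lemma tau_isometry {α β : Dual ℂ H} (hα : α ∈ D.B₁) (hβ : β ∈ D.B₁) :
    D.τ α (hκ.dualVec (D.τ β)) = α (hκ.dualVec β) := by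
  have h := D.isometry α hα β hβ
  rwa [D.lie_e_e_neg hκ (D.B₁_subset_roots hα), D.lie_e_e_neg hκ (D.B₁_subset_roots hβ),
    D.lie_e_e_neg hκ (D.B₂_subset_roots (D.bijOn.mapsTo hα)),
    D.lie_e_e_neg hκ (D.B₂_subset_roots (D.bijOn.mapsTo hβ)), hκ.dualVec_apply,
    hκ.dualVec_apply] at h

lemma _root_.BelavinDrinfeld.TauRel.f₀_dualVec {α β : Dual ℂ H} (h : TauRel D.τ D.B₁ α β) :
    D.f₀ (hκ.dualVec α) = D.f₀ (hκ.dualVec β) - hκ.dualVec β := by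
  refine tauRel_induction
    (P := fun α β => D.f₀ (hκ.dualVec α) = D.f₀ (hκ.dualVec β) - hκ.dualVec β)
    (fun b hb => ?_) (by simp) (fun α γ α' γ' h h' => ?_) (fun α γ h => ?_) h
  · exact D.f₀_tau b hb _ _ (D.lie_e_e_neg hκ (D.B₁_subset_roots hb)).symm
      (D.lie_e_e_neg hκ (D.B₂_subset_roots (D.bijOn.mapsTo hb))).symm
  · simp only [map_add, h, h']
    abel
  · simp only [map_neg, h]
    abel

/-- For positive roots this is `map_mem_roots_of_isometry` applied to the linear extension of τ;
negative roots follow by a change of sign. The converse `TauRel.mem_roots'` uses the extension of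
the inverse. -/
lemma _root_.BelavinDrinfeld.TauRel.mem_roots {α β : Dual ℂ H} (h : TauRel D.τ D.B₁ α β)
    (hα : α ∈ roots H) : β ∈ roots H := by
  have key : ∀ {α}, α ∈ roots H → α ∈ AddSubgroup.closure D.B₁ →
      α ∈ AddSubmonoid.closure D.B → D.tauHat α ∈ roots H := by
    intro α hα h1 h2
    refine D.map_mem_roots_of_isometry hκ D.B₁_subset (fun b hb => ?_) (fun b hb b' hb' => ?_) hα
      (D.isBase.mem_closure_of_mem_addSubgroup_closure D.B₁_subset h2 h1)
    · rw [D.tauHat_apply hb]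
      exact D.B₂_subset_roots (D.bijOn.mapsTo hb)
    · rw [D.tauHat_apply hb, D.tauHat_apply hb', D.tau_isometry hκ hb hb']
  rw [← h.tauHat_eq]
  rcases D.isBase.pos_or_neg α hα with h1 | h1
  · exact key hα h.mem_left h1
  · rw [← neg_neg α, map_neg]
    exact neg_mem_roots (key (neg_mem_roots hα) (neg_mem h.mem_left) h1)

lemma _root_.BelavinDrinfeld.TauRel.mem_roots' {α β : Dual ℂ H} (h : TauRel D.τ D.B₁ α β)
    (hβ : β ∈ roots H) : α ∈ roots H := by
  have key : ∀ {β}, β ∈ roots H → β ∈ AddSubgroup.closure D.B₂ →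
      β ∈ AddSubmonoid.closure D.B → D.tauInv β ∈ roots H := by
    intro β hβ h1 h2
    refine D.map_mem_roots_of_isometry hκ D.B₂_subset (fun b hb => ?_) (fun b hb b' hb' => ?_) hβ
      (D.isBase.mem_closure_of_mem_addSubgroup_closure D.B₂_subset h2 h1)
    · obtain ⟨a, ha, rfl⟩ := D.bijOn.surjOn hb
      rw [D.tauInv_apply ha]
      exact D.B₁_subset_roots ha
    · obtain ⟨a, ha, rfl⟩ := D.bijOn.surjOn hb
      obtain ⟨a', ha', rfl⟩ := D.bijOn.surjOn hb'
      rw [D.tauInv_apply ha, D.tauInv_apply ha', D.tau_isometry hκ ha ha']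
  rw [← h.tauInv_eq]
  rcases D.isBase.pos_or_neg β hβ with h1 | h1
  · exact key hβ h.mem_right h1
  · rw [← neg_neg β, map_neg]
    exact neg_mem_roots (key (neg_mem_roots hβ) (neg_mem h.mem_right) h1)

lemma _root_.BelavinDrinfeld.TauRel.mem_posRoots_iff {α β : Dual ℂ H}
    (h : TauRel D.τ D.B₁ α β) : β ∈ D.posRoots ↔ α ∈ D.posRoots :=
  ⟨fun hβ => ⟨h.mem_roots' hκ hβ.1, h.mem_closure' hβ.2⟩,
    fun hα => ⟨h.mem_roots hκ hα.1, h.mem_closure hα.2⟩⟩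

end AdmissibleQuadruple

end Tau

/-! ### The recursive form of the associated operator, and its existence and uniqueness. -/

section Operator

open LieAlgebra

variable {g : Type*} [LieRing g] [LieAlgebra ℂ g]
  {κ : LinearMap.BilinForm ℂ g} {H : LieSubalgebra ℂ g} [H.IsCartanSubalgebra]

namespace AdmissibleQuadruple

variable {D : AdmissibleQuadruple κ H}

/-- The recursive characterization of the operator associated to an admissible quadruple. -/
structure IsRecursive (D : AdmissibleQuadruple κ H) (f : End ℂ g) : Prop where
  pos_tau : ∀ α ∈ D.posRoots, ∀ β, TauRel D.τ D.B₁ α β → f (D.e α) = f (D.e β) - D.e β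
  pos_of_notMem : ∀ α ∈ D.posRoots, α ∉ AddSubgroup.closure D.B₁ → f (D.e α) = 0
  neg_tau : ∀ β ∈ D.posRoots, ∀ α, TauRel D.τ D.B₁ α β →
    f (D.e (-β)) = f (D.e (-α)) + D.e (-β)
  neg_of_notMem : ∀ β ∈ D.posRoots, β ∉ AddSubgroup.closure D.B₂ → f (D.e (-β)) = D.e (-β)
  map_cartan : ∀ h : H, f (h : g) = (D.f₀ h : g)

lemma not_transGen_self {α : Dual ℂ H} (hα : α ∈ D.posRoots) :
    ¬ Relation.TransGen (TauRel D.τ D.B₁) α α :=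
  fun h => hα.1.1 (eq_zero_of_transGen h hα.2)

lemma le_iff_of_tauRel {α β γ : Dual ℂ H} (h : TauRel D.τ D.B₁ α β) :
    D.Le α γ ↔ γ = α ∨ D.Le β γ := by
  constructor
  · intro hγ
    rcases Relation.ReflTransGen.cases_head hγ with rfl | ⟨δ, hδ, hδ'⟩
    · exact .inl rfl
    · rw [h.right_unique hδ]
      exact .inr hδ'
  · rintro (rfl | hγ)
    · exact .refl
    · exact .head h hγ

lemma le_iff_of_tauRel' {α β γ : Dual ℂ H} (h : TauRel D.τ D.B₁ α β) :
    D.Le γ β ↔ γ = β ∨ D.Le γ α := by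
  constructor
  · intro hγ
    rcases Relation.ReflTransGen.cases_tail hγ with rfl | ⟨δ, hδ, hδ'⟩
    · exact .inl rfl
    · rw [h.left_unique hδ']
      exact .inr hδ
  · rintro (rfl | hγ)
    · exact .refl
    · exact .tail hγ h

lemma le_iff_of_notMem {α γ : Dual ℂ H} (h : α ∉ AddSubgroup.closure D.B₁) :
    D.Le α γ ↔ γ = α := by
  refine ⟨fun hγ => ?_, fun h => h ▸ .refl⟩
  rcases Relation.ReflTransGen.cases_head hγ with rfl | ⟨δ, hδ, -⟩
  · rfl
  · exact absurd hδ.mem_left h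

lemma le_iff_of_notMem' {β γ : Dual ℂ H} (h : β ∉ AddSubgroup.closure D.B₂) :
    D.Le γ β ↔ γ = β := by
  refine ⟨fun hγ => ?_, fun h => h ▸ .refl⟩
  rcases Relation.ReflTransGen.cases_tail hγ with rfl | ⟨δ, -, hδ⟩
  · rfl
  · exact absurd hδ.mem_right h

variable [FiniteDimensional ℂ g]

lemma finite_posRoots : D.posRoots.Finite := finite_roots.subset fun _ h => h.1

variable [HasCentralRadical ℂ g] (hκ : IsInvariantForm κ)

section

omit [FiniteDimensional ℂ g] [HasCentralRadical ℂ g] in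
lemma setOf_gt_eq_insert {α β : Dual ℂ H} (hα : α ∈ D.posRoots) (hβ : β ∈ D.posRoots)
    (h : TauRel D.τ D.B₁ α β) :
    {γ ∈ D.posRoots | D.Le α γ ∧ γ ≠ α} = insert β {γ ∈ D.posRoots | D.Le β γ ∧ γ ≠ β} := by
  ext γ
  simp only [Set.mem_ofPred_eq, Set.mem_insert_iff, le_iff_of_tauRel h]
  constructor
  · rintro ⟨hγ, hγ', hne⟩
    by_cases hγβ : γ = β
    · exact .inl hγβ
    · exact .inr ⟨hγ, hγ'.resolve_left hne, hγβ⟩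
  · rintro (rfl | ⟨hγ, hγ', hne⟩)
    · refine ⟨hβ, .inr .refl, ?_⟩
      rintro rfl
      exact not_transGen_self hα (.single h)
    · refine ⟨hγ, .inr hγ', ?_⟩
      rintro rfl
      exact not_transGen_self hα (.head' h hγ')

omit [FiniteDimensional ℂ g] [HasCentralRadical ℂ g] in
lemma setOf_le_eq_insert {α β : Dual ℂ H} (hβ : β ∈ D.posRoots) (h : TauRel D.τ D.B₁ α β) :
    {γ ∈ D.posRoots | D.Le γ β} = insert β {γ ∈ D.posRoots | D.Le γ α} := by
  ext γ
  simp only [Set.mem_ofPred_eq, Set.mem_insert_iff, le_iff_of_tauRel' h]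
  constructor
  · rintro ⟨hγ, rfl | hγ'⟩
    · exact .inl rfl
    · exact .inr ⟨hγ, hγ'⟩
  · rintro (rfl | ⟨hγ, hγ'⟩)
    · exact ⟨hβ, .inl rfl⟩
    · exact ⟨hγ, .inr hγ'⟩

omit [FiniteDimensional ℂ g] [HasCentralRadical ℂ g] in
lemma setOf_gt_eq_empty {α : Dual ℂ H} (h : α ∉ AddSubgroup.closure D.B₁) :
    {γ ∈ D.posRoots | D.Le α γ ∧ γ ≠ α} = ∅ := by
  ext γ
  simp [le_iff_of_notMem h]

omit [FiniteDimensional ℂ g] [HasCentralRadical ℂ g] in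
lemma setOf_le_eq_singleton {β : Dual ℂ H} (hβ : β ∈ D.posRoots)
    (h : β ∉ AddSubgroup.closure D.B₂) : {γ ∈ D.posRoots | D.Le γ β} = {β} := by
  ext γ
  simp only [Set.mem_ofPred_eq, le_iff_of_notMem' h, Set.mem_singleton_iff]
  exact ⟨fun h => h.2, fun h => ⟨h ▸ hβ, h⟩⟩

omit [HasCentralRadical ℂ g] in
lemma finsum_gt_eq_add {α β : Dual ℂ H} (hα : α ∈ D.posRoots) (hβ : β ∈ D.posRoots)
    (h : TauRel D.τ D.B₁ α β) : ∑ᶠ γ ∈ {γ ∈ D.posRoots | D.Le α γ ∧ γ ≠ α}, D.e γ =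
      D.e β + ∑ᶠ γ ∈ {γ ∈ D.posRoots | D.Le β γ ∧ γ ≠ β}, D.e γ := by
  rw [setOf_gt_eq_insert hα hβ h, finsum_mem_insert]
  · exact fun h => h.2.2 rfl
  · exact finite_posRoots.subset fun _ h => h.1

omit [HasCentralRadical ℂ g] in
lemma finsum_le_eq_add {α β : Dual ℂ H} (hβ : β ∈ D.posRoots)
    (h : TauRel D.τ D.B₁ α β) : ∑ᶠ γ ∈ {γ ∈ D.posRoots | D.Le γ β}, D.e (-γ) =
      D.e (-β) + ∑ᶠ γ ∈ {γ ∈ D.posRoots | D.Le γ α}, D.e (-γ) := by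
  rw [setOf_le_eq_insert hβ h, finsum_mem_insert]
  · exact fun h' => not_transGen_self hβ (.tail' h'.2 h)
  · exact finite_posRoots.subset fun _ h => h.1

omit [HasCentralRadical ℂ g] in
-- There are finitely many positive roots and τ has no cycles on them, so the strict order it
-- generates is well-founded. Here the induction runs backwards from the ends of the τ-chains, and
-- in `posRoots_induction'` forwards from their beginnings.
lemma posRoots_induction {P : Dual ℂ H → Prop}
    (ih : ∀ α ∈ D.posRoots, (∀ β ∈ D.posRoots, TauRel D.τ D.B₁ α β → P β) → P α) :
    ∀ α ∈ D.posRoots, P α := by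
  have : Finite D.posRoots := finite_posRoots
  let r : D.posRoots → D.posRoots → Prop := fun β α =>
    Relation.TransGen (TauRel D.τ D.B₁) α.1 β.1
  have : IsTrans _ r := ⟨fun a b c h h' => h'.trans h⟩
  have : Std.Irrefl r := ⟨fun a h => not_transGen_self a.2 h⟩
  have hr : WellFounded r := Finite.wellFounded_of_trans_of_irrefl r
  intro α hα
  exact hr.induction (C := fun α => P α.1) ⟨α, hα⟩ fun α h =>
    ih α.1 α.2 fun β hβ hαβ => h ⟨β, hβ⟩ (.single hαβ)

omit [HasCentralRadical ℂ g] in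
lemma posRoots_induction' {P : Dual ℂ H → Prop}
    (ih : ∀ β ∈ D.posRoots, (∀ α ∈ D.posRoots, TauRel D.τ D.B₁ α β → P α) → P β) :
    ∀ β ∈ D.posRoots, P β := by
  have : Finite D.posRoots := finite_posRoots
  let r : D.posRoots → D.posRoots → Prop := fun α β =>
    Relation.TransGen (TauRel D.τ D.B₁) α.1 β.1
  have : IsTrans _ r := ⟨fun a b c h h' => h.trans h'⟩
  have : Std.Irrefl r := ⟨fun a h => not_transGen_self a.2 h⟩
  have hr : WellFounded r := Finite.wellFounded_of_trans_of_irrefl r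
  intro α hα
  exact hr.induction (C := fun α => P α.1) ⟨α, hα⟩ fun β h =>
    ih β.1 β.2 fun α hα hαβ => h ⟨α, hα⟩ (.single hαβ)

end

include hκ

/-- As τ is injective and acyclic, replacing α by `τα` removes exactly one term from the sum over
larger roots; dually for the sum over smaller roots. Conversely the one-step rules determine the
sums by induction along the chains. -/
lemma isOperator_iff_isRecursive {f : End ℂ g} : D.IsOperator f ↔ D.IsRecursive f := by
  constructor
  · intro hf
    refine ⟨fun α hα β h => ?_, fun α hα h => ?_, fun β hβ α h => ?_, fun β hβ h => ?_,
      hf.map_cartan⟩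
    · have hβ := (h.mem_posRoots_iff hκ).2 hα
      rw [hf.map_e_pos α hα, hf.map_e_pos β hβ, finsum_gt_eq_add hα hβ h]
      abel
    · rw [hf.map_e_pos α hα, setOf_gt_eq_empty h, finsum_mem_empty, neg_zero]
    · have hα := (h.mem_posRoots_iff hκ).1 hβ
      rw [hf.map_e_neg α hα, hf.map_e_neg β hβ, finsum_le_eq_add hβ h]
      abel
    · rw [hf.map_e_neg β hβ, setOf_le_eq_singleton hβ h, finsum_mem_singleton]
  · intro hf
    refine ⟨posRoots_induction fun α hα ih => ?_, posRoots_induction' fun β hβ ih => ?_,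
      hf.map_cartan⟩
    · by_cases hα' : α ∈ AddSubgroup.closure D.B₁
      · have h := D.tauRel_tauHat hα'
        have hβ := (h.mem_posRoots_iff hκ).2 hα
        rw [hf.pos_tau α hα _ h, ih _ hβ h, finsum_gt_eq_add hα hβ h]
        abel
      · rw [hf.pos_of_notMem α hα hα', setOf_gt_eq_empty hα', finsum_mem_empty, neg_zero]
    · by_cases hβ' : β ∈ AddSubgroup.closure D.B₂
      · obtain ⟨α, h⟩ := exists_tauRel_of_mem hβ'
        have hα := (h.mem_posRoots_iff hκ).1 hβ
        rw [hf.neg_tau β hβ _ h, ih _ hα h, finsum_le_eq_add hβ h]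
        abel
      · rw [hf.neg_of_notMem β hβ hβ', setOf_le_eq_singleton hβ hβ', finsum_mem_singleton]

variable (D)

omit hκ in
lemma mem_or_neg_mem_posRoots {α : Dual ℂ H} (hα : α ∈ roots H) :
    α ∈ D.posRoots ∨ -α ∈ D.posRoots :=
  (D.isBase.pos_or_neg α hα).imp (fun h => ⟨hα, h⟩) fun h => ⟨neg_mem_roots hα, h⟩

omit hκ in
lemma eq_top_of_cartan_le_of_e_posRoots_mem {p : Submodule ℂ g} (hH : ∀ h : H, (h : g) ∈ p)
    (hpos : ∀ α ∈ D.posRoots, D.e α ∈ p) (hneg : ∀ α ∈ D.posRoots, D.e (-α) ∈ p) : p = ⊤ := by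
  refine D.eq_top_of_cartan_le_of_e_mem hH fun α hα => ?_
  rcases D.mem_or_neg_mem_posRoots hα with h | h
  · exact hpos α h
  · simpa using hneg _ h

omit hκ in
omit [FiniteDimensional ℂ g] [HasCentralRadical ℂ g] in
lemma neg_ne_of_mem_posRoots {α β : Dual ℂ H} (hα : α ∈ D.posRoots) (hβ : β ∈ D.posRoots) :
    -α ≠ β := by
  rintro rfl
  exact hα.1.1 (D.isBase.eq_zero_of_mem_of_neg_mem hα.2 hβ.2)

/-- Coordinates are read off with κ: the coefficient of `e_α` in `z` is `κ z e_{-α}`, and the Cartan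
component represents the restriction of `κ z` to `H`. -/
lemma exists_linearMap {x y : Dual ℂ H → g} (φ : End ℂ H) : ∃ f : End ℂ g,
    (∀ α ∈ D.posRoots, f (D.e α) = x α) ∧ (∀ α ∈ D.posRoots, f (D.e (-α)) = y α) ∧
    ∀ h : H, f h = φ h := by
  classical
  have hfin : D.posRoots.Finite := finite_posRoots
  let f : End ℂ g :=
    H.toSubmodule.subtype ∘ₗ φ ∘ₗ (hκ.dualVec (H := H)).toLinearMap ∘ₗ
      (LinearMap.lcomp ℂ ℂ H.toSubmodule.subtype) ∘ₗ κ +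
    ∑ α ∈ hfin.toFinset, ((κ.flip (D.e (-α))).smulRight (x α) +
      (κ.flip (D.e α)).smulRight (y α))
  have hf : ∀ z, f z = φ (hκ.dualVec (κ z ∘ₗ H.toSubmodule.subtype)) +
      ∑ α ∈ hfin.toFinset, (κ z (D.e (-α)) • x α + κ z (D.e α) • y α) := by
    intro z
    simp [f]
    rfl
  have he : ∀ α ∈ roots H, κ (D.e α) ∘ₗ H.toSubmodule.subtype = 0 := by
    intro α hα
    ext h
    change κ (D.e α) (h : g) = 0
    rw [hκ.symm.eq]
    exact hκ.apply_rootSpace hα (D.e_mem α hα) h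
  refine ⟨f, fun α hα => ?_, fun α hα => ?_, fun h => ?_⟩
  · rw [hf, he α hα.1, map_zero, map_zero, ZeroMemClass.coe_zero, zero_add,
      Finset.sum_eq_single α]
    · rw [D.form_e _ hα.1 _ (neg_mem_roots hα.1), D.form_e _ hα.1 _ hα.1, neg_neg, if_pos rfl,
        if_neg fun h => D.neg_ne_of_mem_posRoots hα hα h.symm]
      simp
    · intro β hβ hne
      replace hβ : β ∈ D.posRoots := by simpa using hβ
      rw [D.form_e _ hα.1 _ (neg_mem_roots hβ.1), D.form_e _ hα.1 _ hβ.1, neg_neg,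
        if_neg hne.symm, if_neg fun h => D.neg_ne_of_mem_posRoots hβ hα h.symm]
      simp
    · simp [hα]
  · rw [hf, he _ (neg_mem_roots hα.1), map_zero, map_zero, ZeroMemClass.coe_zero, zero_add,
      Finset.sum_eq_single α]
    · rw [D.form_e _ (neg_mem_roots hα.1) _ (neg_mem_roots hα.1),
        D.form_e _ (neg_mem_roots hα.1) _ hα.1, neg_neg, if_pos rfl,
        if_neg (D.neg_ne_of_mem_posRoots hα hα)]
      simp
    · intro β hβ hne
      replace hβ : β ∈ D.posRoots := by simpa using hβ
      rw [D.form_e _ (neg_mem_roots hα.1) _ (neg_mem_roots hβ.1),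
        D.form_e _ (neg_mem_roots hα.1) _ hβ.1, neg_neg,
        if_neg (D.neg_ne_of_mem_posRoots hα hβ), if_neg fun h => hne (neg_injective h).symm]
      simp
    · simp [hα]
  · have h0 : hκ.dualVec (κ (h : g) ∘ₗ H.toSubmodule.subtype) = h :=
      (hκ.eq_dualVec fun _ => rfl).symm
    rw [hf, h0, Finset.sum_eq_zero, add_zero]
    intro β hβ
    replace hβ : β ∈ D.posRoots := by simpa using hβ
    rw [hκ.apply_rootSpace hβ.1 (D.e_mem β hβ.1),
      hκ.apply_rootSpace (neg_mem_roots hβ.1) (D.e_mem _ (neg_mem_roots hβ.1))]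
    simp

lemma existsUnique_isOperator : ∃! f : End ℂ g, D.IsOperator f := by
  obtain ⟨f, h1, h2, h3⟩ := D.exists_linearMap hκ
    (x := fun α => - ∑ᶠ β ∈ {β ∈ D.posRoots | D.Le α β ∧ β ≠ α}, D.e β)
    (y := fun α => ∑ᶠ β ∈ {β ∈ D.posRoots | D.Le β α}, D.e (-β)) D.f₀
  refine ⟨f, ⟨h1, h2, h3⟩, fun f' hf' => ?_⟩
  rw [← LinearMap.eqLocus_eq_top]
  refine D.eq_top_of_cartan_le_of_e_posRoots_mem (fun h => ?_) (fun α hα => ?_) fun α hα => ?_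
  · exact (hf'.map_cartan h).trans (h3 h).symm
  · exact (hf'.map_e_pos α hα).trans (h1 α hα).symm
  · exact (hf'.map_e_neg α hα).trans (h2 α hα).symm

end AdmissibleQuadruple

end Operator

/-! ### The Cayley transform and the proof of factorizability. -/

section Graph

open LieAlgebra

variable {g : Type*} [LieRing g] [LieAlgebra ℂ g]
  {κ : LinearMap.BilinForm ℂ g} {H : LieSubalgebra ℂ g} [H.IsCartanSubalgebra]

/-- The space of pairs `(f x - x, f x)`. -/
def graph (f : End ℂ g) : Submodule ℂ (g × g) :=
  LinearMap.ker (f ∘ₗ (LinearMap.snd ℂ g g - LinearMap.fst ℂ g g) - LinearMap.snd ℂ g g)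

lemma mem_graph {f : End ℂ g} {a b : g} : (a, b) ∈ graph f ↔ f (b - a) = b := by
  simp [graph, sub_eq_zero]

lemma mk_mem_graph (f : End ℂ g) (x : g) : (f x - x, f x) ∈ graph f := by
  rw [mem_graph]
  congr 1
  abel

/-- Expanding `κ (f x) (f y) = κ (f x - x) (f y - y)` gives `f + f* = 1`, and closure of the pairs
under the bracket expands to the bracket identity. Both extend bilinearly from `S`. -/
lemma isFactorizable_of_graph (hκ : IsInvariantForm κ) {f : End ℂ g} {S : Set (g × g)}
    (hS : graph f ≤ Submodule.span ℂ S) (hform : ∀ u ∈ S, ∀ v ∈ S, κ u.2 v.2 = κ u.1 v.1)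
    (hlie : ∀ u ∈ S, ∀ v ∈ S, (⁅u.1, v.1⁆, ⁅u.2, v.2⁆) ∈ graph f) : IsFactorizable κ f where
  symm := hκ.symm
  nondegenerate := hκ.nondegenerate
  invariant := hκ.invariant
  add_adjoint x y := by
    have key : ∀ u ∈ Submodule.span ℂ S, ∀ v ∈ Submodule.span ℂ S, κ u.2 v.2 = κ u.1 v.1 := by
      intro u hu v hv
      induction hu, hv using Submodule.span_induction₂ with
      | mem_mem u v hu hv => exact hform u hu v hv
      | zero_left => simp
      | zero_right => simp
      | add_left u v w _ _ _ h h' => simp [h, h']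
      | add_right u v w _ _ _ h h' => simp [h, h']
      | smul_left c u v _ _ h => simp [h]
      | smul_right c u v _ _ h => simp [h]
    have h := key _ (hS (mk_mem_graph f x)) _ (hS (mk_mem_graph f y))
    simp only [map_sub, LinearMap.sub_apply] at h
    linear_combination h
  lie_map x y := by
    have key : ∀ u ∈ Submodule.span ℂ S, ∀ v ∈ Submodule.span ℂ S,
        (⁅u.1, v.1⁆, ⁅u.2, v.2⁆) ∈ graph f := by
      intro u hu v hv
      induction hu, hv using Submodule.span_induction₂ with
      | mem_mem u v hu hv => exact hlie u hu v hv
      | zero_left => simp only [Prod.fst_zero, Prod.snd_zero, zero_lie]; exact zero_mem _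
      | zero_right => simp only [Prod.fst_zero, Prod.snd_zero, lie_zero]; exact zero_mem _
      | add_left u v w _ _ _ h h' => simpa using add_mem h h'
      | add_right u v w _ _ _ h h' => simpa using add_mem h h'
      | smul_left c u v _ _ h => simpa using (graph f).smul_mem c h
      | smul_right c u v _ _ h => simpa using (graph f).smul_mem c h
    have h := key _ (hS (mk_mem_graph f x)) _ (hS (mk_mem_graph f y))
    rw [mem_graph] at h
    rw [← h]
    congr 1
    simp only [lie_sub, sub_lie]
    abel

namespace AdmissibleQuadruple

variable (D : AdmissibleQuadruple κ H)

/-- Generators of the space of pairs `(f x - x, f x)`, where `f` is the associated operator. -/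
inductive IsGenerator : g × g → Prop
  | tau {α β : Dual ℂ H} (hα : α ∈ roots H) (h : TauRel D.τ D.B₁ α β) : IsGenerator (D.e α, D.e β)
  | pos {α : Dual ℂ H} (hα : α ∈ D.posRoots) (h : α ∉ AddSubgroup.closure D.B₁) :
      IsGenerator (D.e α, 0)
  | neg {β : Dual ℂ H} (hβ : β ∈ D.posRoots) (h : β ∉ AddSubgroup.closure D.B₂) :
      IsGenerator (0, D.e (-β))
  | cartan (h : H) : IsGenerator ((D.f₀ h - h : H), (D.f₀ h : g))

variable {D} [FiniteDimensional ℂ g] [HasCentralRadical ℂ g]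

lemma exists_lie_e_e {α β : Dual ℂ H} (hα : α ∈ roots H) (hβ : β ∈ roots H)
    (h : α + β ≠ 0) : (α + β ∈ roots H ∧ ∃ c : ℂ, ⁅D.e α, D.e β⁆ = c • D.e (α + β)) ∨
      (α + β ∉ roots H ∧ ⁅D.e α, D.e β⁆ = 0) := by
  have hmem : ⁅D.e α, D.e β⁆ ∈ rootSpace H ⇑(α + β) :=
    lie_mem_genWeightSpace_of_mem_genWeightSpace (D.e_mem α hα) (D.e_mem β hβ)
  by_cases hr : α + β ∈ roots H
  · exact .inl ⟨hr, exists_smul_eq_of_mem_rootSpace hr (D.e_mem _ hr) (D.e_ne_zero hr) hmem⟩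
  · refine .inr ⟨hr, ?_⟩
    have : rootSpace H ⇑(α + β) = ⊥ := by
      by_contra hne
      exact hr ⟨h, hne⟩
    rwa [this, LieSubmodule.mem_bot] at hmem

/-- This is the adjoint form of `f₀ h_α = (f₀ - 1) h_β`. It makes the two components of a Cartan
generator act on `e_α` and `e_β` by the same scalar. -/
lemma f₀_cartan_apply (hκ : IsInvariantForm κ) {α β : Dual ℂ H} (h : TauRel D.τ D.B₁ α β)
    (x : H) : α (D.f₀ x - x) = β (D.f₀ x) := by
  have h1 := D.f₀_add_adjoint (hκ.dualVec α) x
  have h2 := D.f₀_add_adjoint (hκ.dualVec β) x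
  rw [h.f₀_dualVec hκ] at h1
  simp only [AddSubgroupClass.coe_sub, map_sub, LinearMap.sub_apply, hκ.dualVec_apply] at h1 h2
  rw [map_sub]
  linear_combination h1 - h2

lemma IsRecursive.generator_mem_graph {f : End ℂ g} (hf : D.IsRecursive f)
    (hκ : IsInvariantForm κ) {u : g × g} (hu : D.IsGenerator u) : u ∈ graph f := by
  cases hu with
  | @tau α β hα h =>
    rw [mem_graph, map_sub]
    rcases D.mem_or_neg_mem_posRoots hα with h' | h'
    · rw [hf.pos_tau α h' β h]
      abel
    · have := hf.neg_tau (-β) ((h.neg.mem_posRoots_iff hκ).2 h') (-α) h.neg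
      rw [neg_neg, neg_neg] at this
      rw [this]
      abel
  | pos hα h => rw [mem_graph, map_sub, hf.pos_of_notMem _ hα h, map_zero, sub_zero]
  | neg hβ h => rw [mem_graph, sub_zero, hf.neg_of_notMem _ hβ h]
  | cartan h =>
    rw [mem_graph, ← AddSubgroupClass.coe_sub, sub_sub_cancel, hf.map_cartan]

/-- By the recursion, the pair attached to a root vector differs from that of its neighbour in the
τ-chain by a generator, and at the end of a chain it is a generator up to sign. -/
lemma IsRecursive.graph_le_span {f : End ℂ g} (hf : D.IsRecursive f) (hκ : IsInvariantForm κ) :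
    graph f ≤ Submodule.span ℂ {u | D.IsGenerator u} := by
  let F : g →ₗ[ℂ] g × g := (f - 1).prod f
  have hF : ∀ x, F x = (f x - x, f x) := fun _ => rfl
  suffices h : (Submodule.span ℂ {u | D.IsGenerator u}).comap F = ⊤ by
    rintro ⟨a, b⟩ hab
    rw [mem_graph] at hab
    have h1 : b - a ∈ (Submodule.span ℂ {u | D.IsGenerator u}).comap F := h ▸ trivial
    rw [Submodule.mem_comap, hF, hab, sub_sub_cancel] at h1
    exact h1
  refine D.eq_top_of_cartan_le_of_e_posRoots_mem (fun h => ?_)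
    (posRoots_induction fun α hα ih => ?_) (posRoots_induction' fun β hβ ih => ?_)
  · rw [Submodule.mem_comap, hF, hf.map_cartan, ← AddSubgroupClass.coe_sub]
    exact Submodule.subset_span (.cartan h)
  · rw [Submodule.mem_comap]
    by_cases hα' : α ∈ AddSubgroup.closure D.B₁
    · have h := D.tauRel_tauHat hα'
      have h1 := ih _ ((h.mem_posRoots_iff hκ).2 hα) h
      have h2 : F (D.e α) = F (D.e (D.tauHat α)) - (D.e α, D.e (D.tauHat α)) := by
        rw [hF, hF, hf.pos_tau α hα _ h]
        ext <;> simp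
      rw [h2]
      exact sub_mem h1 (Submodule.subset_span (.tau hα.1 h))
    · have h2 : F (D.e α) = -(D.e α, 0) := by
        rw [hF, hf.pos_of_notMem α hα hα']
        ext <;> simp
      rw [h2]
      exact neg_mem (Submodule.subset_span (.pos hα hα'))
  · rw [Submodule.mem_comap]
    by_cases hβ' : β ∈ AddSubgroup.closure D.B₂
    · obtain ⟨α, h⟩ := exists_tauRel_of_mem hβ'
      have hα := (h.mem_posRoots_iff hκ).1 hβ
      have h1 := ih _ hα h
      have h2 : F (D.e (-β)) = F (D.e (-α)) + (D.e (-α), D.e (-β)) := by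
        rw [hF, hF, hf.neg_tau β hβ _ h]
        ext <;> simp
      rw [h2]
      exact add_mem h1 (Submodule.subset_span (.tau (neg_mem_roots hα.1) h.neg))
    · have h2 : F (D.e (-β)) = (0, D.e (-β)) := by
        rw [hF, hf.neg_of_notMem β hβ hβ', sub_self]
      rw [h2]
      exact Submodule.subset_span (.neg hβ hβ')

/-- The compatibility of two generators. -/
def AreCompatible (κ : LinearMap.BilinForm ℂ g) (f : End ℂ g) (u v : g × g) : Prop :=
  κ u.2 v.2 = κ u.1 v.1 ∧ (⁅u.1, v.1⁆, ⁅u.2, v.2⁆) ∈ graph f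

omit [FiniteDimensional ℂ g] [HasCentralRadical ℂ g] in
lemma AreCompatible.symm (hκ : IsInvariantForm κ) {f : End ℂ g} {u v : g × g}
    (h : AreCompatible κ f u v) : AreCompatible κ f v u := by
  refine ⟨by rw [hκ.symm.eq, h.1, hκ.symm.eq], ?_⟩
  rw [← lie_skew v.1, ← lie_skew v.2]
  exact neg_mem h.2

omit [FiniteDimensional ℂ g] [HasCentralRadical ℂ g] in
lemma form_e_eq_zero {α β : Dual ℂ H} (hα : α ∈ roots H) (hβ : β ∈ roots H)
    (h : α + β ≠ 0) : κ (D.e α) (D.e β) = 0 := by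
  rw [D.form_e α hα β hβ, if_neg fun h' => h (by rw [h', neg_add_cancel])]

section

variable {f : End ℂ g} (hf : D.IsRecursive f) (hκ : IsInvariantForm κ)
include hf hκ

/-- For opposite roots the bracket is `(h_α, h_β)`, which is in the graph by the condition linking
`f₀` and τ. Otherwise the structure constants agree, and `α + α'` is a root exactly when `β + β'`
is. -/
lemma areCompatible_tau_tau {α β α' β' : Dual ℂ H} (hα : α ∈ roots H)
    (h : TauRel D.τ D.B₁ α β) (hα' : α' ∈ roots H) (h' : TauRel D.τ D.B₁ α' β') :
    AreCompatible κ f (D.e α, D.e β) (D.e α', D.e β') := by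
  have hβ := h.mem_roots hκ hα
  have hβ' := h'.mem_roots hκ hα'
  by_cases h0 : α + α' = 0
  · obtain rfl : α' = -α := (neg_eq_of_add_eq_zero_right h0).symm
    obtain rfl : β' = -β := h'.right_unique h.neg
    refine ⟨by rw [D.form_e_neg hα, D.form_e_neg hβ], ?_⟩
    rw [D.lie_e_e_neg hκ hα, D.lie_e_e_neg hκ hβ, mem_graph, ← AddSubgroupClass.coe_sub,
      hf.map_cartan, map_sub, h.f₀_dualVec hκ, sub_sub_cancel]
  · have h1 : β + β' ≠ 0 := by
      intro h1
      refine h0 ?_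
      rw [← (h.add h').tauInv_eq, h1, map_zero]
    refine ⟨by rw [form_e_eq_zero hα hα' h0, form_e_eq_zero hβ hβ' h1], ?_⟩
    rcases exists_lie_e_e (D := D) hα hα' h0 with ⟨hr, c, hc⟩ | ⟨hr, h2⟩
    · rw [hc, D.compatible α hα α' hα' hr β β' h h' c hc]
      exact (graph f).smul_mem c (hf.generator_mem_graph hκ (.tau hr (h.add h')))
    · have hr' : β + β' ∉ roots H := fun hr' => hr ((h.add h').mem_roots' hκ hr')
      rcases exists_lie_e_e (D := D) hβ hβ' h1 with ⟨hr', -⟩ | ⟨-, h3⟩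
      · contradiction
      · rw [h2, h3]
        exact zero_mem _

omit hf hκ in
lemma lie_e_mem_of_add_mem {p : Submodule ℂ g} {α β : Dual ℂ H} (hα : α ∈ roots H)
    (hβ : β ∈ roots H) (h : α + β ≠ 0) (hp : α + β ∈ roots H → D.e (α + β) ∈ p) :
    ⁅D.e α, D.e β⁆ ∈ p := by
  rcases exists_lie_e_e (D := D) hα hβ h with ⟨hr, c, hc⟩ | ⟨-, h2⟩
  · rw [hc]
    exact p.smul_mem c (hp hr)
  · rw [h2]
    exact zero_mem _

/-- The root `α` of the Levi part may be negative, but adding it to a positive root outside `ℤB₁`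
can only give a positive root outside `ℤB₁`: the Levi part normalizes the nilradical of the
parabolic. -/
lemma areCompatible_tau_pos {α β γ : Dual ℂ H} (hα : α ∈ roots H)
    (h : TauRel D.τ D.B₁ α β) (hγ : γ ∈ D.posRoots) (hγ' : γ ∉ AddSubgroup.closure D.B₁) :
    AreCompatible κ f (D.e α, D.e β) (D.e γ, 0) := by
  have h2 : α + γ ∉ AddSubgroup.closure D.B₁ := fun h2 =>
    hγ' ((AddSubgroup.add_mem_cancel_left _ h.mem_left).1 h2)
  have h0 : α + γ ≠ 0 := fun h0 => h2 (h0 ▸ zero_mem _)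
  refine ⟨by rw [form_e_eq_zero hα hγ.1 h0, map_zero], ?_⟩
  rw [lie_zero]
  refine lie_e_mem_of_add_mem (p := (graph f).comap (LinearMap.inl ℂ g g)) hα hγ.1 h0
    fun hr => hf.generator_mem_graph hκ (.pos ⟨hr, ?_⟩ h2)
  exact D.isBase.add_mem_closure D.B₁_subset h.mem_left hγ.2 hγ' hr

lemma areCompatible_tau_neg {α β γ : Dual ℂ H} (hα : α ∈ roots H)
    (h : TauRel D.τ D.B₁ α β) (hγ : γ ∈ D.posRoots) (hγ' : γ ∉ AddSubgroup.closure D.B₂) :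
    AreCompatible κ f (D.e α, D.e β) (0, D.e (-γ)) := by
  have h2 : -β + γ ∉ AddSubgroup.closure D.B₂ := fun h2 =>
    hγ' ((AddSubgroup.add_mem_cancel_left _ (neg_mem h.mem_right)).1 h2)
  have h0 : β + -γ ≠ 0 := fun h0 => h2 (by
    have : -β + γ = -(β + -γ) := by abel
    rw [this, h0, neg_zero]
    exact zero_mem _)
  have hβ := h.mem_roots hκ hα
  refine ⟨by rw [form_e_eq_zero hβ (neg_mem_roots hγ.1) h0, map_zero], ?_⟩
  rw [lie_zero]
  refine lie_e_mem_of_add_mem (p := (graph f).comap (LinearMap.inr ℂ g g)) hβ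
    (neg_mem_roots hγ.1) h0 fun hr => ?_
  have h3 : β + -γ = -(-β + γ) := by abel
  have hr' : -β + γ ∈ roots H := by
    rw [← neg_neg (-β + γ), ← h3]
    exact neg_mem_roots hr
  rw [h3]
  exact hf.generator_mem_graph hκ (.neg ⟨hr', D.isBase.add_mem_closure D.B₂_subset
    (neg_mem h.mem_right) hγ.2 hγ' hr'⟩ h2)

lemma areCompatible_pos_pos {α γ : Dual ℂ H} (hα : α ∈ D.posRoots)
    (hα' : α ∉ AddSubgroup.closure D.B₁) (hγ : γ ∈ D.posRoots) :
    AreCompatible κ f (D.e α, 0) (D.e γ, 0) := by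
  have h0 : α + γ ≠ 0 := fun h0 => D.neg_ne_of_mem_posRoots hα hγ (neg_eq_of_add_eq_zero_right h0)
  refine ⟨by rw [form_e_eq_zero hα.1 hγ.1 h0, map_zero], ?_⟩
  rw [lie_zero]
  exact lie_e_mem_of_add_mem (p := (graph f).comap (LinearMap.inl ℂ g g)) hα.1 hγ.1 h0
    fun hr => hf.generator_mem_graph hκ (.pos ⟨hr, add_mem hα.2 hγ.2⟩
      (D.isBase.add_notMem_closure D.B₁_subset hα.2 hα' hγ.2))

lemma areCompatible_neg_neg {α γ : Dual ℂ H} (hα : α ∈ D.posRoots)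
    (hα' : α ∉ AddSubgroup.closure D.B₂) (hγ : γ ∈ D.posRoots) :
    AreCompatible κ f (0, D.e (-α)) (0, D.e (-γ)) := by
  have h0 : -α + -γ ≠ 0 := fun h0 => D.neg_ne_of_mem_posRoots hα hγ (by
    rw [← sub_eq_zero, sub_eq_add_neg, h0])
  refine ⟨by rw [form_e_eq_zero (neg_mem_roots hα.1) (neg_mem_roots hγ.1) h0, map_zero], ?_⟩
  rw [lie_zero]
  refine lie_e_mem_of_add_mem (p := (graph f).comap (LinearMap.inr ℂ g g))
    (neg_mem_roots hα.1) (neg_mem_roots hγ.1) h0 fun hr => ?_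
  have h3 : -α + -γ = -(α + γ) := by abel
  have hr' : α + γ ∈ roots H := by
    rw [← neg_neg (α + γ), ← h3]
    exact neg_mem_roots hr
  rw [h3]
  exact hf.generator_mem_graph hκ (.neg ⟨hr', add_mem hα.2 hγ.2⟩
    (D.isBase.add_notMem_closure D.B₂_subset hα.2 hα' hγ.2))

omit hf hκ in
lemma areCompatible_cartan_cartan (x y : H) :
    AreCompatible κ f ((D.f₀ x - x : H), (D.f₀ x : g)) ((D.f₀ y - y : H), (D.f₀ y : g)) := by
  refine ⟨?_, ?_⟩
  · have := D.f₀_add_adjoint x y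
    simp only [AddSubgroupClass.coe_sub, map_sub, LinearMap.sub_apply]
    linear_combination this
  · simp only [lie_eq_zero_of_mem_cartan]
    exact zero_mem _

lemma areCompatible_cartan {u : g × g} (x : H) (hu : D.IsGenerator u) :
    AreCompatible κ f ((D.f₀ x - x : H), (D.f₀ x : g)) u := by
  have hmem := hf.generator_mem_graph hκ hu
  cases hu with
  | @tau α β hα h =>
    have hβ := h.mem_roots hκ hα
    refine ⟨by rw [hκ.apply_rootSpace hα (D.e_mem α hα), hκ.apply_rootSpace hβ (D.e_mem β hβ)], ?_⟩
    simp only [D.lie_e hα, D.lie_e hβ, f₀_cartan_apply hκ h]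
    exact (graph f).smul_mem _ hmem
  | @pos α hα _ =>
    refine ⟨by rw [hκ.apply_rootSpace hα.1 (D.e_mem α hα.1), map_zero], ?_⟩
    simp only [D.lie_e hα.1, lie_zero]
    simpa using (graph f).smul_mem (α (D.f₀ x - x)) hmem
  | @neg β hβ _ =>
    have hβ' := neg_mem_roots hβ.1
    refine ⟨by rw [hκ.apply_rootSpace hβ' (D.e_mem _ hβ'), map_zero], ?_⟩
    simp only [D.lie_e hβ', lie_zero]
    simpa using (graph f).smul_mem ((-β) (D.f₀ x)) hmem
  | cartan y => exact areCompatible_cartan_cartan x y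

lemma areCompatible_pos {α : Dual ℂ H} (hα : α ∈ D.posRoots) (hα' : α ∉ AddSubgroup.closure D.B₁)
    {u : g × g} (hu : D.IsGenerator u) : AreCompatible κ f (D.e α, 0) u := by
  cases hu with
  | tau hβ h => exact (areCompatible_tau_pos hf hκ hβ h hα hα').symm hκ
  | pos hβ h => exact areCompatible_pos_pos hf hκ hα hα' hβ
  | neg hβ h => exact ⟨by simp, by simp only [lie_zero, zero_lie]; exact zero_mem _⟩
  | cartan y => exact (areCompatible_cartan hf hκ y (.pos hα hα')).symm hκ

lemma areCompatible_neg {α : Dual ℂ H} (hα : α ∈ D.posRoots) (hα' : α ∉ AddSubgroup.closure D.B₂)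
    {u : g × g} (hu : D.IsGenerator u) : AreCompatible κ f (0, D.e (-α)) u := by
  cases hu with
  | tau hβ h => exact (areCompatible_tau_neg hf hκ hβ h hα hα').symm hκ
  | pos hβ h => exact ⟨by simp, by simp only [lie_zero, zero_lie]; exact zero_mem _⟩
  | neg hβ h => exact areCompatible_neg_neg hf hκ hα hα' hβ
  | cartan y => exact (areCompatible_cartan hf hκ y (.neg hα hα')).symm hκ

lemma areCompatible_of_isGenerator {u v : g × g} (hu : D.IsGenerator u) (hv : D.IsGenerator v) :
    AreCompatible κ f u v := by
  cases hu with
  | tau hα h =>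
    cases hv with
    | tau hβ h' => exact areCompatible_tau_tau hf hκ hα h hβ h'
    | pos hβ h' => exact areCompatible_tau_pos hf hκ hα h hβ h'
    | neg hβ h' => exact areCompatible_tau_neg hf hκ hα h hβ h'
    | cartan y => exact (areCompatible_cartan hf hκ y (.tau hα h)).symm hκ
  | pos hα h => exact areCompatible_pos hf hκ hα h hv
  | neg hα h => exact areCompatible_neg hf hκ hα h hv
  | cartan x => exact areCompatible_cartan hf hκ x hv

/-- The operator associated to an admissible quadruple defines a factorizable Lie bialgebra. -/
lemma IsRecursive.isFactorizable : IsFactorizable κ f :=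
  isFactorizable_of_graph hκ (hf.graph_le_span hκ)
    (fun _ hu _ hv => (areCompatible_of_isGenerator hf hκ hu hv).1)
    (fun _ hu _ hv => (areCompatible_of_isGenerator hf hκ hu hv).2)

end

end AdmissibleQuadruple

end Graph

/-! ### The reduction as a factorizable Lie bialgebra, and Lie algebras with an explicit root
decomposition. -/

section Reduction

open LieAlgebra LieModule

variable {g : Type*} [LieRing g] [LieAlgebra ℂ g] {κ : LinearMap.BilinForm ℂ g} {f : End ℂ g}

namespace IsFactorizable

lemma isInvariantForm (hF : IsFactorizable κ f) : IsInvariantForm κ :=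
  ⟨hF.symm, hF.nondegenerate, hF.invariant⟩

variable (hF : IsFactorizable κ f)

/-- A linear extension of the projection `c₁ → c₁ / c₁^⊥`. -/
noncomputable def toRed : g →ₗ[ℂ] hF.Red :=
  (LinearMap.exists_extend (p := hF.c₁.toSubmodule) hF.proj).choose

lemma toRed_eq {x : g} (hx : x ∈ hF.c₁) : hF.toRed x = hF.proj ⟨x, hx⟩ :=
  LinearMap.congr_fun (LinearMap.exists_extend (p := hF.c₁.toSubmodule) hF.proj).choose_spec ⟨x, hx⟩

lemma isClass_toRed {x : g} (hx : x ∈ hF.c₁) : hF.IsClass x (hF.toRed x) :=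
  ⟨hx, (hF.toRed_eq hx).symm⟩

lemma lie_toRed {x y : g} (hx : x ∈ hF.c₁) (hy : y ∈ hF.c₁) :
    ⁅hF.toRed x, hF.toRed y⁆ = hF.toRed ⁅x, y⁆ := by
  rw [hF.toRed_eq hx, hF.toRed_eq hy, hF.toRed_eq (hF.c₁.lie_mem hx hy)]
  rfl

lemma toRed_eq_zero_iff {x : g} (hx : x ∈ hF.c₁) : hF.toRed x = 0 ↔ f x = 0 := by
  rw [hF.toRed_eq hx, ← hF.forall_c₁_eq_zero_iff]
  exact Submodule.Quotient.mk_eq_zero _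

lemma redForm_toRed {x y : g} (hx : x ∈ hF.c₁) (hy : y ∈ hF.c₁) :
    hF.redForm (hF.toRed x) (hF.toRed y) = κ x y := by
  rw [hF.toRed_eq hx, hF.toRed_eq hy, redForm_proj]

lemma redOp_toRed {x : g} (hx : x ∈ hF.c₁) : hF.redOp (hF.toRed x) = hF.toRed (f x) := by
  rw [hF.toRed_eq hx, redOp_proj, hF.toRed_eq]

lemma exists_toRed_eq (y : hF.Red) : ∃ x ∈ hF.c₁, hF.toRed x = y := by
  obtain ⟨x, rfl⟩ := Submodule.mkQ_surjective _ y
  exact ⟨x, x.2, hF.toRed_eq x.2⟩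

/-- The reduction of a factorizable Lie bialgebra is a factorizable Lie bialgebra. -/
lemma isFactorizable_red : IsFactorizable hF.redForm hF.redOp := by
  have hsymm : hF.redForm.IsSymm := ⟨fun x y => by
    obtain ⟨x, hx, rfl⟩ := hF.exists_toRed_eq x
    obtain ⟨y, hy, rfl⟩ := hF.exists_toRed_eq y
    rw [hF.redForm_toRed hx hy, hF.redForm_toRed hy hx, hF.symm.eq]⟩
  -- The radical of the restriction of κ to `c₁` is exactly the ideal divided out.
  have hright : ∀ x, (∀ y, hF.redForm y x = 0) → x = 0 := fun x h => by
    obtain ⟨x, hx, rfl⟩ := hF.exists_toRed_eq x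
    rw [hF.toRed_eq_zero_iff hx, ← hF.forall_c₁_eq_zero_iff]
    intro y hy
    rw [← hF.redForm_toRed hy hx, h]
  refine ⟨hsymm, ⟨fun x h => hright x fun y => ?_, hright⟩, fun x y z => ?_, fun x y => ?_,
    fun x y => ?_⟩
  · rw [hsymm.eq, h]
  · obtain ⟨x, hx, rfl⟩ := hF.exists_toRed_eq x
    obtain ⟨y, hy, rfl⟩ := hF.exists_toRed_eq y
    obtain ⟨z, hz, rfl⟩ := hF.exists_toRed_eq z
    rw [hF.lie_toRed hx hy, hF.lie_toRed hx hz, hF.redForm_toRed (hF.c₁.lie_mem hx hy) hz,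
      hF.redForm_toRed hy (hF.c₁.lie_mem hx hz), hF.invariant]
  · obtain ⟨x, hx, rfl⟩ := hF.exists_toRed_eq x
    obtain ⟨y, hy, rfl⟩ := hF.exists_toRed_eq y
    rw [hF.redOp_toRed hx, hF.redOp_toRed hy, hF.redForm_toRed (hF.map_mem_c₁ hx) hy,
      hF.redForm_toRed hx (hF.map_mem_c₁ hy), hF.redForm_toRed hx hy, hF.add_adjoint]
  · obtain ⟨x, hx, rfl⟩ := hF.exists_toRed_eq x
    obtain ⟨y, hy, rfl⟩ := hF.exists_toRed_eq y
    have hfx := hF.map_mem_c₁ hx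
    have hfy := hF.map_mem_c₁ hy
    rw [hF.redOp_toRed hx, hF.redOp_toRed hy, hF.lie_toRed hx hfy, hF.lie_toRed hfx hy,
      hF.lie_toRed hx hy, hF.lie_toRed hfx hfy, ← map_add, ← map_sub, hF.redOp_toRed, hF.lie_map]
    exact sub_mem (add_mem (hF.c₁.lie_mem hx hfy) (hF.c₁.lie_mem hfx hy)) (hF.c₁.lie_mem hx hy)

lemma mem_c₁_of_mem_graph {a b : g} (h : (a, b) ∈ graph f) : a ∈ hF.c₁ := by
  rw [mem_graph] at h
  exact hF.mem_c₁.2 ⟨b - a, by rw [h, sub_sub_cancel]⟩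

end IsFactorizable

/-- Subspaces of the generalized weight spaces which together span everything are the generalized
weight spaces. -/
lemma genWeightSpace_eq_of_iSup_eq_top {L : Type*} [LieRing L] [LieAlgebra ℂ L]
    (K : LieSubalgebra ℂ L) [LieRing.IsNilpotent K] (V : (K → ℂ) → Submodule ℂ L)
    (hV : ∀ χ, V χ ≤ (genWeightSpace L χ).toSubmodule) (htop : ⨆ χ, V χ = ⊤) (χ : K → ℂ) :
    (genWeightSpace L χ).toSubmodule = V χ := by
  have hind := (LieSubmodule.iSupIndep_toSubmodule (N := fun χ : K → ℂ => genWeightSpace L χ)).2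
    (iSupIndep_genWeightSpace ℂ K L)
  refine le_antisymm ?_ (hV χ)
  have h1 : V χ ⊔ ⨆ (χ') (_ : χ' ≠ χ), V χ' = ⊤ := by
    rw [← htop]
    refine le_antisymm (sup_le (le_iSup V χ) (iSup₂_le fun χ' _ => le_iSup V χ'))
      (iSup_le fun χ' => ?_)
    by_cases h : χ' = χ
    · exact h ▸ le_sup_left
    · exact le_sup_of_le_right (le_iSup₂_of_le χ' h le_rfl)
  have h2 := hind χ
  have h3 : (genWeightSpace L χ).toSubmodule ⊓ ⨆ (χ') (_ : χ' ≠ χ), V χ' = ⊥ :=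
    (h2.mono_right (iSup₂_mono fun χ' _ => hV χ')).eq_bot
  -- Modular law, using that the other subspaces meet this weight space trivially.
  calc (genWeightSpace L χ).toSubmodule
      = (V χ ⊔ ⨆ (χ') (_ : χ' ≠ χ), V χ') ⊓ (genWeightSpace L χ).toSubmodule := by
        rw [h1, top_inf_eq]
    _ = V χ ⊔ (⨆ (χ') (_ : χ' ≠ χ), V χ') ⊓ (genWeightSpace L χ).toSubmodule :=
        (sup_inf_assoc_of_le _ (hV χ))
    _ ≤ V χ := by rw [inf_comm, h3, sup_bot_eq]

section RootDecomposition

variable {L : Type*} [LieRing L] [LieAlgebra ℂ L] {K : LieSubalgebra ℂ L}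
  (hab : ∀ x y : K, ⁅(x : L), (y : L)⁆ = 0) {ι : Type*} {v : ι → L} {w : ι → Dual ℂ K}
  (hv : ∀ i, ∀ x : K, ⁅(x : L), v i⁆ = w i x • v i)
  (hspan : K.toSubmodule ⊔ Submodule.span ℂ (Set.range v) = ⊤)

include hab hv hspan

omit hv hspan in
lemma isNilpotent_of_lie_eq_zero : LieRing.IsNilpotent K := by
  have : IsLieAbelian K := ⟨fun x y => Subtype.ext (hab x y)⟩
  infer_instance

/-- The weight vectors `v i` and `K`, of weight 0, span `L`; independence of generalized weight
spaces leaves no room for more. -/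
lemma rootSpace_eq_span [LieRing.IsNilpotent K] (χ : K → ℂ) :
    (rootSpace K χ).toSubmodule =
      Submodule.span ℂ ({y | χ = 0 ∧ y ∈ K} ∪ {y | ∃ i, (w i : K → ℂ) = χ ∧ v i = y}) := by
  refine genWeightSpace_eq_of_iSup_eq_top K (fun χ => Submodule.span ℂ
    ({y | χ = 0 ∧ y ∈ K} ∪ {y | ∃ i, (w i : K → ℂ) = χ ∧ v i = y})) (fun χ => ?_) ?_ χ
  · rw [Submodule.span_le]
    rintro y (⟨rfl, hy⟩ | ⟨i, rfl, rfl⟩)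
    · refine weightSpace_le_genWeightSpace L _ ((mem_weightSpace _ _).2 fun x => ?_)
      rw [Pi.zero_apply, zero_smul]
      exact hab x ⟨y, hy⟩
    · exact weightSpace_le_genWeightSpace L _ ((mem_weightSpace _ _).2 (hv i))
  · rw [eq_top_iff, ← hspan]
    refine sup_le (fun y hy => ?_) (Submodule.span_le.2 ?_)
    · exact Submodule.mem_iSup_of_mem 0 (Submodule.subset_span (.inl ⟨rfl, hy⟩))
    · rintro _ ⟨i, rfl⟩
      exact Submodule.mem_iSup_of_mem (w i : K → ℂ) (Submodule.subset_span (.inr ⟨i, rfl, rfl⟩))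

lemma isCartanSubalgebra_of_root_decomposition (hw : ∀ i, w i ≠ 0) :
    K.IsCartanSubalgebra := by
  have := isNilpotent_of_lie_eq_zero hab
  refine is_cartan_of_zeroRootSubalgebra_eq ℂ L K ?_
  rw [← LieSubalgebra.toSubmodule_inj, coe_zeroRootSubalgebra, rootSpace_eq_span hab hv hspan]
  have h1 : {y | ∃ i, (w i : K → ℂ) = 0 ∧ v i = y} = ∅ := by
    refine Set.eq_empty_of_forall_notMem ?_
    rintro y ⟨i, hi, -⟩
    exact hw i (DFunLike.coe_injective hi)
  have h2 : {y | (0 : K → ℂ) = 0 ∧ y ∈ K} = (K.toSubmodule : Set L) := by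
    ext y
    simp
  rw [h1, h2, Set.union_empty, Submodule.span_eq]

lemma exists_eq_of_mem_roots [K.IsCartanSubalgebra] {χ : Dual ℂ K} (hχ : χ ∈ roots K) :
    ∃ i, w i = χ := by
  by_contra! hne
  refine hχ.2 ?_
  rw [← LieSubmodule.toSubmodule_eq_bot, rootSpace_eq_span hab hv hspan, Submodule.span_eq_bot]
  rintro y (⟨h, -⟩ | ⟨i, hi, -⟩)
  · exact absurd (DFunLike.coe_injective h) hχ.1
  · exact absurd (DFunLike.coe_injective hi) (hne i)

omit hab hspan in
lemma mem_roots_of_ne_zero [K.IsCartanSubalgebra] {i : ι} (hw : w i ≠ 0) (hi : v i ≠ 0) :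
    w i ∈ roots K := by
  refine ⟨hw, fun h => hi ?_⟩
  have : v i ∈ rootSpace K (w i) :=
    weightSpace_le_genWeightSpace L _ ((mem_weightSpace _ _).2 (hv i))
  rwa [h, LieSubmodule.mem_bot] at this

/-- A Lie algebra with a root decomposition in which every root vector is part of an
`sl₂`-triple has central radical. -/
lemma hasCentralRadical_of_root_decomposition [FiniteDimensional ℂ L] (hw : ∀ i, w i ≠ 0)
    (hinj : Function.Injective w) (hv0 : ∀ i, v i ≠ 0)
    (hsl : ∀ i, ∃ y : L, ∃ c : ℂ, c ≠ 0 ∧ ⁅⁅v i, y⁆, v i⁆ = c • v i) :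
    HasCentralRadical ℂ L := by
  have hK := isCartanSubalgebra_of_root_decomposition hab hv hspan hw
  refine hasCentralRadical_of_radical_le ℂ L ?_
  set I := radical ℂ L with hI
  -- If `v i` were in the radical, then `⁅⁅v i, y⁆, v i⁆ = c • v i` would put it in every term of
  -- the derived series, against solvability.
  have hnot : ∀ i, v i ∉ I := by
    intro i hi
    obtain ⟨y, c, hc, h⟩ := hsl i
    have key : ∀ k, v i ∈ derivedSeriesOfIdeal ℂ L k I := by
      intro k
      induction k with
      | zero => exact hi
      | succ k ih =>
        rw [derivedSeriesOfIdeal_succ]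
        have h1 : ⁅v i, y⁆ ∈ derivedSeriesOfIdeal ℂ L k I := lie_mem_left ℂ L _ _ _ ih
        have h2 := LieSubmodule.lie_mem_lie h1 ih
        rw [h] at h2
        have h3 := Submodule.smul_mem _ c⁻¹ h2
        rwa [inv_smul_smul₀ hc] at h3
    obtain ⟨k, hk⟩ := (isSolvable_iff ℂ I).1 inferInstance
    rw [LieIdeal.derivedSeries_eq_bot_iff] at hk
    have := key k
    rw [hk, LieSubmodule.mem_bot] at this
    exact hv0 i this
  -- The radical is `K`-stable, so it is the sum of its intersections with `K` and the root spaces.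
  -- The latter are lines spanned by some `v i`, so they do not contribute.
  have hIK : I.restr K ≤ K.toLieSubmodule := by
    rw [lieIdeal_eq_inf_cartan_sup_biSup_inf_rootSpace]
    refine sup_le inf_le_right (iSup₂_le fun χ hχ => ?_)
    rintro x ⟨hx, hx'⟩
    obtain ⟨i, hi⟩ := exists_eq_of_mem_roots hab hv hspan (toLinear_mem_roots hχ)
    have h1 : x ∈ (rootSpace K χ).toSubmodule := hx'
    rw [rootSpace_eq_span hab hv hspan] at h1
    have h2 : Submodule.span ℂ ({y | (χ : K → ℂ) = 0 ∧ y ∈ K} ∪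
        {y | ∃ i, (w i : K → ℂ) = χ ∧ v i = y}) ≤ Submodule.span ℂ {v i} := by
      refine Submodule.span_mono ?_
      rintro y (⟨h, -⟩ | ⟨j, hj, rfl⟩)
      · exact absurd h hχ
      · have : j = i := hinj (by rw [hi]; exact DFunLike.coe_injective hj)
        rw [this]
        rfl
    obtain ⟨c, rfl⟩ := Submodule.mem_span_singleton.1 (h2 h1)
    by_cases hc : c = 0
    · rw [hc, zero_smul]
      exact zero_mem _
    · refine absurd ?_ (hnot i)
      have h3 : c⁻¹ • c • v i ∈ I := Submodule.smul_mem _ c⁻¹ hx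
      rwa [inv_smul_smul₀ hc] at h3
  intro x hx
  have hxK : x ∈ K := hIK (show x ∈ I.restr K from hx)
  rw [mem_maxTrivSubmodule]
  -- An element of the radical in `K` scales each `v i` to an element of the radical, so the scalar
  -- is zero.
  have h1 : LinearMap.ker (ad ℂ L x : L →ₗ[ℂ] L) = ⊤ := by
    rw [eq_top_iff, ← hspan]
    refine sup_le (fun y hy => hab ⟨x, hxK⟩ ⟨y, hy⟩) (Submodule.span_le.2 ?_)
    rintro _ ⟨i, rfl⟩
    change ⁅x, v i⁆ = 0
    have h2 : ⁅x, v i⁆ = w i ⟨x, hxK⟩ • v i := hv i ⟨x, hxK⟩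
    rw [h2]
    by_cases hc : w i ⟨x, hxK⟩ = 0
    · rw [hc, zero_smul]
    · refine absurd ?_ (hnot i)
      have h3 : ⁅x, v i⁆ ∈ I := lie_mem_left ℂ L _ _ _ hx
      rw [h2] at h3
      have h4 : (w i ⟨x, hxK⟩)⁻¹ • w i ⟨x, hxK⟩ • v i ∈ I := Submodule.smul_mem _ _ h3
      rwa [inv_smul_smul₀ hc] at h4
  intro y
  have h2 : y ∈ LinearMap.ker (ad ℂ L x : L →ₗ[ℂ] L) := h1 ▸ trivial
  have h3 : ⁅x, y⁆ = 0 := h2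
  rw [← lie_skew, h3, neg_zero]

end RootDecomposition

end Reduction

/-! ### The Cartan subalgebra, roots and admissible quadruple of the reduction. -/

section ReducedQuadruple

open LieAlgebra LieModule

variable {g : Type*} [LieRing g] [LieAlgebra ℂ g] [FiniteDimensional ℂ g] [HasCentralRadical ℂ g]
  {κ : LinearMap.BilinForm ℂ g} {H : LieSubalgebra ℂ g} [H.IsCartanSubalgebra] {f : End ℂ g}

namespace AdmissibleQuadruple

variable {D : AdmissibleQuadruple κ H} (hF : IsFactorizable κ f) (hf : D.IsRecursive f)

lemma neg_mem_R₁ {α : Dual ℂ H} (hα : α ∈ D.R₁) : -α ∈ D.R₁ :=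
  ⟨neg_mem_roots hα.1, neg_mem hα.2⟩

omit [FiniteDimensional ℂ g] [HasCentralRadical ℂ g] in
lemma B₁_subset_R₁ : D.B₁ ⊆ D.R₁ :=
  fun _ hb => ⟨D.B₁_subset_roots hb, AddSubgroup.subset_closure hb⟩

omit [FiniteDimensional ℂ g] [HasCentralRadical ℂ g] in
lemma mem_span_of_mem_closure {α : Dual ℂ H} (hα : α ∈ AddSubgroup.closure D.B₁) :
    α ∈ Submodule.span ℂ D.B₁ :=
  (AddSubgroup.closure_le (K := (Submodule.span ℂ D.B₁).toAddSubgroup)).2 Submodule.subset_span hα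

section

include hF

/-- Since `f₀ - 1` is minus the adjoint of `f₀`, the orthogonal complement of its image is the
kernel of `f₀`. -/
lemma mem_NPerp_iff {x : H} : x ∈ D.NPerp ↔ D.f₀ x = 0 := by
  have key : ∀ z : H, κ ((D.f₀ z - z : H) : g) (x : g) = - κ (z : g) (D.f₀ x : g) := fun z => by
    have := D.f₀_add_adjoint z x
    rw [AddSubgroupClass.coe_sub, map_sub, LinearMap.sub_apply, ← this]
    abel
  constructor
  · intro h
    refine hF.isInvariantForm.restrict_nondegenerate.2 _ fun z => ?_
    have := h (D.f₀ z - z) ⟨z, rfl⟩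
    rwa [key, neg_eq_zero] at this
  · rintro h _ ⟨z, rfl⟩
    change κ ((D.f₀ z - z : H) : g) (x : g) = 0
    rw [key, h, ZeroMemClass.coe_zero, map_zero, neg_zero]

lemma NPerp_le_N : D.NPerp ≤ D.N := fun x hx =>
  ⟨-x, by simp [(mem_NPerp_iff hF).1 hx]⟩

lemma dualVec_mem_N {α : Dual ℂ H} (hα : α ∈ Submodule.span ℂ D.B₁) :
    hF.isInvariantForm.dualVec α ∈ D.N := by
  have : Submodule.span ℂ D.B₁ ≤ D.N.comap (hF.isInvariantForm.dualVec (H := H)).toLinearMap := by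
    rw [Submodule.span_le]
    intro b hb
    -- The condition linking `f₀` and τ gives `h_b = (f₀ - 1) (h_{τb} - h_b)`.
    refine ⟨hF.isInvariantForm.dualVec (D.τ b) - hF.isInvariantForm.dualVec b, ?_⟩
    have h := (TauRel.of_mem hb).f₀_dualVec hF.isInvariantForm
    rw [LinearMap.sub_apply, Module.End.one_apply, map_sub, h]
    simp
  exact this hα

lemma apply_eq_zero_of_mem_NPerp {α : Dual ℂ H} (hα : α ∈ Submodule.span ℂ D.B₁) {x : H}
    (hx : x ∈ D.NPerp) : α x = 0 := by
  rw [← hF.isInvariantForm.dualVec_apply]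
  exact hx _ (dualVec_mem_N hF hα)

/-- The image of `f₀ - 1` contains the vectors dual to `B₁`, so positivity applies; this gives
injectivity of `α ↦ α̃`. -/
lemma eq_zero_of_forall_mem_N {α : Dual ℂ H} (hα : α ∈ Submodule.span ℂ D.B₁)
    (h : ∀ n ∈ D.N, α n = 0) : α = 0 :=
  D.eq_zero_of_mem_span_of_apply_dualVec_eq_zero hF.isInvariantForm D.B₁_subset_roots hα
    fun _ hb => h _ (dualVec_mem_N hF (Submodule.subset_span hb))

include hf

lemma coe_mem_c₁ {n : H} (hn : n ∈ D.N) : (n : g) ∈ hF.c₁ := by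
  obtain ⟨x, rfl⟩ := hn
  exact hF.mem_c₁_of_mem_graph (hf.generator_mem_graph hF.isInvariantForm (.cartan x))

lemma e_mem_c₁ {α : Dual ℂ H} (hα : α ∈ D.R₁) : D.e α ∈ hF.c₁ :=
  hF.mem_c₁_of_mem_graph
    (hf.generator_mem_graph hF.isInvariantForm (.tau hα.1 (D.tauRel_tauHat hα.2)))

lemma e_mem_c₁_of_mem_posRoots {α : Dual ℂ H} (hα : α ∈ D.posRoots) : D.e α ∈ hF.c₁ := by
  by_cases h : α ∈ AddSubgroup.closure D.B₁
  · exact e_mem_c₁ hF hf ⟨hα.1, h⟩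
  · exact hF.mem_c₁_of_mem_graph (hf.generator_mem_graph hF.isInvariantForm (.pos hα h))

lemma toRed_e_eq_zero {α : Dual ℂ H} (hα : α ∈ D.posRoots) (h : α ∉ AddSubgroup.closure D.B₁) :
    hF.toRed (D.e α) = 0 :=
  (hF.toRed_eq_zero_iff (e_mem_c₁_of_mem_posRoots hF hf hα)).2 (hf.pos_of_notMem α hα h)

lemma toRed_e_ne_zero {α : Dual ℂ H} (hα : α ∈ D.R₁) : hF.toRed (D.e α) ≠ 0 := by
  intro h
  have h1 := hF.redForm_toRed (e_mem_c₁ hF hf hα) (e_mem_c₁ hF hf (neg_mem_R₁ hα))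
  rw [h, D.form_e_neg hα.1, map_zero, LinearMap.zero_apply] at h1
  exact zero_ne_one h1

lemma toRed_eq_zero_iff_mem_NPerp {n : H} (hn : n ∈ D.N) :
    hF.toRed (n : g) = 0 ↔ n ∈ D.NPerp := by
  rw [hF.toRed_eq_zero_iff (coe_mem_c₁ hF hf hn), hf.map_cartan, mem_NPerp_iff hF,
    ZeroMemClass.coe_eq_zero]

end

/-- The natural map from `Im (f₀ - 1)` to the reduction. -/
noncomputable def toRedN (D : AdmissibleQuadruple κ H) (hF : IsFactorizable κ f) :
    D.N →ₗ[ℂ] hF.Red :=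
  hF.toRed ∘ₗ H.toSubmodule.subtype ∘ₗ D.N.subtype

omit [FiniteDimensional ℂ g] [HasCentralRadical ℂ g] in
lemma toRedN_apply (n : D.N) : D.toRedN hF n = hF.toRed ((n : H) : g) := rfl

/-- The image of `Im (f₀ - 1)` in the reduction. -/
noncomputable def redCartan (hf : D.IsRecursive f) : LieSubalgebra ℂ hF.Red where
  __ := LinearMap.range (D.toRedN hF)
  lie_mem' := by
    rintro _ _ ⟨m, rfl⟩ ⟨n, rfl⟩
    rw [toRedN_apply, toRedN_apply, hF.lie_toRed (coe_mem_c₁ hF hf m.2) (coe_mem_c₁ hF hf n.2),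
      lie_eq_zero_of_mem_cartan, map_zero]
    exact zero_mem (LinearMap.range (D.toRedN hF))

lemma toRed_mem_redCartan {n : H} (hn : n ∈ D.N) : hF.toRed (n : g) ∈ redCartan hF hf :=
  ⟨⟨n, hn⟩, rfl⟩

lemma ker_toRedN (hf : D.IsRecursive f) :
    D.NPerp.submoduleOf D.N = LinearMap.ker (D.toRedN hF) := by
  ext n
  exact (toRed_eq_zero_iff_mem_NPerp hF hf n.2).symm

/-- The identification of `Im (f₀ - 1) / Im (f₀ - 1)^⊥` with its image in the reduction. -/
noncomputable def redEquiv : D.HTilde ≃ₗ[ℂ] redCartan hF hf :=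
  (Submodule.quotEquivOfEq _ _ (ker_toRedN hF hf)).trans (D.toRedN hF).quotKerEquivRange

lemma coe_redEquiv_mk (n : D.N) :
    (redEquiv hF hf (Submodule.Quotient.mk n) : hF.Red) = hF.toRed ((n : H) : g) := rfl

lemma exists_redLift : ∃ ξ : redCartan hF hf →ₗ[ℂ] D.N, ∀ y, D.toRedN hF (ξ y) = y := by
  obtain ⟨ξ, hξ⟩ := LinearMap.exists_rightInverse_of_surjective (D.toRedN hF).rangeRestrict
    (LinearMap.range_rangeRestrict _)
  exact ⟨ξ, fun y => congr_arg Subtype.val (LinearMap.congr_fun hξ y)⟩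

/-- A linear section of the natural map from `Im (f₀ - 1)` to the reduction. -/
noncomputable def redLift : redCartan hF hf →ₗ[ℂ] D.N := (exists_redLift hF hf).choose

lemma toRed_redLift (y : redCartan hF hf) : hF.toRed ((redLift hF hf y : H) : g) = y :=
  (exists_redLift hF hf).choose_spec y

/-- The map from functionals on the Cartan subalgebra to functionals on the reduced one. -/
noncomputable def redRoot : Dual ℂ H →ₗ[ℂ] Dual ℂ (redCartan hF hf) :=
  (D.N.subtype ∘ₗ redLift hF hf).dualMap

lemma redRoot_apply (α : Dual ℂ H) (y : redCartan hF hf) :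
    redRoot hF hf α y = α (redLift hF hf y) := rfl

/-- On the span of `B₁` the functional kills `D.NPerp`, so its value does not depend on the section
chosen in `redLift`. -/
lemma redRoot_apply_toRed {α : Dual ℂ H} (hα : α ∈ Submodule.span ℂ D.B₁) {n : H} (hn : n ∈ D.N)
    {y : redCartan hF hf} (hy : (y : hF.Red) = hF.toRed (n : g)) : redRoot hF hf α y = α n := by
  rw [redRoot_apply, ← sub_eq_zero, ← map_sub]
  refine apply_eq_zero_of_mem_NPerp hF hα
    ((toRed_eq_zero_iff_mem_NPerp hF hf (sub_mem (redLift hF hf y).2 hn)).1 ?_)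
  rw [AddSubgroupClass.coe_sub, map_sub, toRed_redLift, hy, sub_self]

lemma eq_zero_of_redRoot_eq_zero {α : Dual ℂ H} (hα : α ∈ Submodule.span ℂ D.B₁)
    (h : redRoot hF hf α = 0) : α = 0 := by
  refine eq_zero_of_forall_mem_N hF hα fun n hn => ?_
  rw [← redRoot_apply_toRed hF hf hα hn (y := ⟨_, toRed_mem_redCartan hF hf hn⟩) rfl, h,
    LinearMap.zero_apply]

lemma exists_liftRoot : ∃ σ : Dual ℂ (redCartan hF hf) →ₗ[ℂ] Dual ℂ H,
    ∀ α ∈ Submodule.span ℂ D.B₁, σ (redRoot hF hf α) = α := by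
  have hker : LinearMap.ker ((redRoot hF hf).domRestrict (Submodule.span ℂ D.B₁)) = ⊥ := by
    rw [LinearMap.ker_eq_bot']
    intro α hα
    exact Subtype.ext (eq_zero_of_redRoot_eq_zero hF hf α.2 hα)
  obtain ⟨σ, hσ⟩ := LinearMap.exists_leftInverse_of_injective _ hker
  exact ⟨(Submodule.span ℂ D.B₁).subtype ∘ₗ σ, fun α hα =>
    congr_arg Subtype.val (LinearMap.congr_fun hσ ⟨α, hα⟩)⟩

/-- A linear left inverse of `redRoot` on the span of `B₁`. -/
noncomputable def liftRoot : Dual ℂ (redCartan hF hf) →ₗ[ℂ] Dual ℂ H :=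
  (exists_liftRoot hF hf).choose

lemma liftRoot_redRoot {α : Dual ℂ H} (hα : α ∈ AddSubgroup.closure D.B₁) :
    liftRoot hF hf (redRoot hF hf α) = α :=
  (exists_liftRoot hF hf).choose_spec α (mem_span_of_mem_closure hα)

lemma redRoot_injOn_R₁ : Set.InjOn (redRoot hF hf) D.R₁ := fun α hα β hβ h => by
  rw [← liftRoot_redRoot hF hf hα.2, h, liftRoot_redRoot hF hf hβ.2]

section RootDecomposition

lemma redCartan_lie (x y : redCartan hF hf) : ⁅(x : hF.Red), (y : hF.Red)⁆ = 0 := by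
  rw [← toRed_redLift hF hf x, ← toRed_redLift hF hf y,
    hF.lie_toRed (coe_mem_c₁ hF hf (redLift hF hf x).2) (coe_mem_c₁ hF hf (redLift hF hf y).2),
    lie_eq_zero_of_mem_cartan, map_zero]

lemma redCartan_lie_toRed_e (α : D.R₁) (x : redCartan hF hf) :
    ⁅(x : hF.Red), hF.toRed (D.e α)⁆ = redRoot hF hf α x • hF.toRed (D.e α) := by
  rw [← toRed_redLift hF hf x,
    hF.lie_toRed (coe_mem_c₁ hF hf (redLift hF hf x).2) (e_mem_c₁ hF hf α.2), D.lie_e α.2.1,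
    map_smul, redRoot_apply]

/-- First components of the generators of the graph span `c₁`, and those attached to positive roots
outside `ℤB₁` have class zero. -/
lemma redCartan_sup_span_eq_top : (redCartan hF hf).toSubmodule ⊔
    Submodule.span ℂ (Set.range fun α : D.R₁ => hF.toRed (D.e α)) = ⊤ := by
  set p := (redCartan hF hf).toSubmodule ⊔
    Submodule.span ℂ (Set.range fun α : D.R₁ => hF.toRed (D.e α)) with hp
  have h1 : Submodule.span ℂ {u | D.IsGenerator u} ≤
      p.comap (hF.toRed ∘ₗ LinearMap.fst ℂ g g) := by
    rw [Submodule.span_le]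
    intro u hu
    change hF.toRed u.1 ∈ p
    cases hu with
    | @tau α β hα h =>
      exact Submodule.mem_sup_right (Submodule.subset_span ⟨⟨α, hα, h.mem_left⟩, rfl⟩)
    | @pos α hα h =>
      change hF.toRed (D.e α) ∈ p
      rw [toRed_e_eq_zero hF hf hα h]
      exact zero_mem _
    | neg hα h =>
      change hF.toRed 0 ∈ p
      rw [map_zero]
      exact zero_mem _
    | cartan x => exact Submodule.mem_sup_left (toRed_mem_redCartan hF hf ⟨x, rfl⟩)
  rw [eq_top_iff]
  rintro y -
  obtain ⟨x, ⟨z, rfl⟩, rfl⟩ := hF.exists_toRed_eq y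
  exact h1 (hf.graph_le_span hF.isInvariantForm (mk_mem_graph f z))

lemma redRoot_ne_zero (α : D.R₁) : redRoot hF hf α ≠ 0 := fun h =>
  α.2.1.1 (eq_zero_of_redRoot_eq_zero hF hf (mem_span_of_mem_closure α.2.2) h)

lemma isCartanSubalgebra_redCartan : (redCartan hF hf).IsCartanSubalgebra :=
  isCartanSubalgebra_of_root_decomposition (redCartan_lie hF hf) (redCartan_lie_toRed_e hF hf)
    (redCartan_sup_span_eq_top hF hf) (redRoot_ne_zero hF hf)

instance : (redCartan hF hf).IsCartanSubalgebra := isCartanSubalgebra_redCartan hF hf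

include hf in
lemma lie_toRed_e_e_neg {α : Dual ℂ H} (hα : α ∈ D.R₁) :
    ⁅hF.toRed (D.e α), hF.toRed (D.e (-α))⁆ = hF.toRed (hF.isInvariantForm.dualVec α : H) := by
  rw [hF.lie_toRed (e_mem_c₁ hF hf hα) (e_mem_c₁ hF hf (neg_mem_R₁ hα)),
    D.lie_e_e_neg hF.isInvariantForm hα.1]

include hf in
lemma hasCentralRadical_red : HasCentralRadical ℂ hF.Red := by
  refine hasCentralRadical_of_root_decomposition (redCartan_lie hF hf) (redCartan_lie_toRed_e hF hf)
    (redCartan_sup_span_eq_top hF hf) (redRoot_ne_zero hF hf)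
    (fun α β h => Subtype.ext (redRoot_injOn_R₁ hF hf α.2 β.2 h))
    (fun α => toRed_e_ne_zero hF hf α.2) fun α => ?_
  -- With `y` the class of `e_{-α}`, the constant is `α (h_α)`, which is nonzero.
  refine ⟨hF.toRed (D.e (-α)), _, D.apply_dualVec_self_ne_zero hF.isInvariantForm α.2.1, ?_⟩
  have hN := dualVec_mem_N hF (mem_span_of_mem_closure α.2.2)
  rw [lie_toRed_e_e_neg hF hf α.2, hF.lie_toRed (coe_mem_c₁ hF hf hN) (e_mem_c₁ hF hf α.2),
    D.lie_e α.2.1, map_smul]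

lemma redRoot_mem_roots {α : Dual ℂ H} (hα : α ∈ D.R₁) :
    redRoot hF hf α ∈ roots (redCartan hF hf) :=
  mem_roots_of_ne_zero (redCartan_lie_toRed_e hF hf) (i := (⟨α, hα⟩ : D.R₁))
    (redRoot_ne_zero hF hf ⟨α, hα⟩) (toRed_e_ne_zero hF hf hα)

lemma exists_redRoot_eq {μ : Dual ℂ (redCartan hF hf)} (hμ : μ ∈ roots (redCartan hF hf)) :
    ∃ α ∈ D.R₁, redRoot hF hf α = μ := by
  obtain ⟨α, hα⟩ := exists_eq_of_mem_roots (redCartan_lie hF hf) (redCartan_lie_toRed_e hF hf)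
    (redCartan_sup_span_eq_top hF hf) hμ
  exact ⟨α, α.2, hα⟩

lemma bijOn_redRoot : Set.BijOn (redRoot hF hf) D.R₁ (roots (redCartan hF hf)) :=
  ⟨fun _ => redRoot_mem_roots hF hf, redRoot_injOn_R₁ hF hf, fun _ => exists_redRoot_eq hF hf⟩

lemma liftRoot_mem_R₁ {μ : Dual ℂ (redCartan hF hf)} (hμ : μ ∈ roots (redCartan hF hf)) :
    liftRoot hF hf μ ∈ D.R₁ := by
  obtain ⟨α, hα, rfl⟩ := exists_redRoot_eq hF hf hμ
  rwa [liftRoot_redRoot hF hf hα.2]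

lemma redRoot_liftRoot {μ : Dual ℂ (redCartan hF hf)} (hμ : μ ∈ roots (redCartan hF hf)) :
    redRoot hF hf (liftRoot hF hf μ) = μ := by
  obtain ⟨α, hα, rfl⟩ := exists_redRoot_eq hF hf hμ
  rw [liftRoot_redRoot hF hf hα.2]

end RootDecomposition

/-- The restriction of `τ` to the elements of `B₁` which it maps to `B₁`: its domain. -/
def redB₁ (D : AdmissibleQuadruple κ H) : Set (Dual ℂ H) := D.B₁ ∩ D.τ ⁻¹' (D.B₁ ∩ D.B₂)

lemma redTau_redRoot {b : Dual ℂ H} (hb : b ∈ D.B₁) :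
    redRoot hF hf (D.τ (liftRoot hF hf (redRoot hF hf b))) = redRoot hF hf (D.τ b) := by
  rw [liftRoot_redRoot hF hf (B₁_subset_R₁ hb).2]

lemma redRoot_mem_closure {α : Dual ℂ H} (hα : α ∈ AddSubmonoid.closure D.B₁) :
    redRoot hF hf α ∈ AddSubmonoid.closure (redRoot hF hf '' D.B₁) := by
  have := AddMonoidHom.map_mclosure (redRoot hF hf).toAddMonoidHom D.B₁
  exact this ▸ AddSubmonoid.mem_map_of_mem _ hα

lemma liftRoot_mem_closure {μ : Dual ℂ (redCartan hF hf)}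
    (hμ : μ ∈ AddSubmonoid.closure (redRoot hF hf '' D.B₁)) :
    liftRoot hF hf μ ∈ AddSubmonoid.closure D.B₁ := by
  have h := AddMonoidHom.map_mclosure (redRoot hF hf).toAddMonoidHom D.B₁
  rw [LinearMap.toAddMonoidHom_coe] at h
  rw [← h] at hμ
  obtain ⟨α, hα, rfl⟩ := AddSubmonoid.mem_map.1 hμ
  change liftRoot hF hf (redRoot hF hf α) ∈ _
  rwa [liftRoot_redRoot hF hf (closure_le_addSubgroup_closure hα)]

lemma isBase_redRoot_image : IsBase (redCartan hF hf) (redRoot hF hf '' D.B₁) where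
  subset := by
    rintro _ ⟨b, hb, rfl⟩
    exact redRoot_mem_roots hF hf (B₁_subset_R₁ hb)
  linearIndepOn := by
    have h1 : LinearIndepOn ℂ id D.B₁ := D.isBase.linearIndepOn.mono D.B₁_subset
    refine LinearIndepOn.id_image (LinearIndepOn.of_comp (liftRoot hF hf) ?_)
    refine h1.congr fun b hb => ?_
    exact (liftRoot_redRoot hF hf (B₁_subset_R₁ hb).2).symm
  pos_or_neg := by
    intro μ hμ
    obtain ⟨α, hα, rfl⟩ := exists_redRoot_eq hF hf hμ
    refine (D.isBase.pos_or_neg α hα.1).imp (fun h => ?_) fun h => ?_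
    · exact redRoot_mem_closure hF hf
        (D.isBase.mem_closure_of_mem_addSubgroup_closure D.B₁_subset h hα.2)
    · rw [← map_neg]
      exact redRoot_mem_closure hF hf
        (D.isBase.mem_closure_of_mem_addSubgroup_closure D.B₁_subset h (neg_mem hα.2))

/-- The second conclusion ensures that, for a root `μ`, the lift of `ν` is again in `R₁`, so that
its root vector lies in `c₁`. -/
lemma tauRel_liftRoot {μ ν : Dual ℂ (redCartan hF hf)}
    (h : TauRel (fun μ => redRoot hF hf (D.τ (liftRoot hF hf μ))) (redRoot hF hf '' D.redB₁) μ ν) :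
    TauRel D.τ D.B₁ (liftRoot hF hf μ) (liftRoot hF hf ν) ∧
      liftRoot hF hf ν ∈ AddSubgroup.closure D.B₁ := by
  refine tauRel_induction (P := fun μ ν => TauRel D.τ D.B₁ (liftRoot hF hf μ) (liftRoot hF hf ν) ∧
    liftRoot hF hf ν ∈ AddSubgroup.closure D.B₁) ?_ ?_ ?_ ?_ h
  · rintro _ ⟨b, hb, rfl⟩
    rw [redTau_redRoot hF hf hb.1, liftRoot_redRoot hF hf (B₁_subset_R₁ hb.1).2,
      liftRoot_redRoot hF hf (B₁_subset_R₁ hb.2.1).2]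
    exact ⟨TauRel.of_mem hb.1, (B₁_subset_R₁ hb.2.1).2⟩
  · rw [map_zero]
    exact ⟨(AddSubgroup.closure _).zero_mem, zero_mem _⟩
  · intro α β α' β' h h'
    rw [map_add, map_add]
    exact ⟨h.1.add h'.1, add_mem h.2 h'.2⟩
  · intro α β h
    rw [map_neg, map_neg]
    exact ⟨h.1.neg, neg_mem h.2⟩

lemma tauRel_redRoot {α : Dual ℂ H} (hα : α ∈ AddSubgroup.closure D.redB₁) :
    TauRel (fun μ => redRoot hF hf (D.τ (liftRoot hF hf μ))) (redRoot hF hf '' D.redB₁)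
      (redRoot hF hf α) (redRoot hF hf (D.tauHat α)) := by
  induction hα using AddSubgroup.closure_induction with
  | mem b hb =>
    have h := TauRel.of_mem (τ := fun μ => redRoot hF hf (D.τ (liftRoot hF hf μ)))
      (Set.mem_image_of_mem (redRoot hF hf) hb)
    rwa [redTau_redRoot hF hf hb.1, ← D.tauHat_apply hb.1] at h
  | zero =>
    rw [map_zero, map_zero, map_zero]
    exact (AddSubgroup.closure _).zero_mem
  | add x y _ _ hx hy => simpa only [map_add] using hx.add hy
  | neg x _ hx => simpa only [map_neg] using hx.neg

omit [FiniteDimensional ℂ g] [HasCentralRadical ℂ g] in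
-- The number of simple roots outside `B₁` occurring in `τα` is zero, so τ sends every simple root
-- occurring in `α` into `B₁`.
lemma mem_closure_redB₁ {α : Dual ℂ H} (hα : α ∈ AddSubmonoid.closure D.B₁)
    (h : D.tauHat α ∈ AddSubgroup.closure D.B₁) : α ∈ AddSubmonoid.closure D.redB₁ := by
  obtain ⟨F, hF0, hF1, -⟩ := exists_counting_functional D.isBase.linearIndepOn D.B₁
  have key : ∃ n : ℕ, F (D.tauHat α) = n ∧ (n = 0 → α ∈ AddSubmonoid.closure D.redB₁) := by
    clear h
    induction hα using AddSubmonoid.closure_induction with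
    | mem b hb =>
      have hb2 := D.bijOn.mapsTo hb
      rw [D.tauHat_apply hb]
      by_cases h : D.τ b ∈ D.B₁
      · exact ⟨0, by rw [hF0 _ ⟨D.B₂_subset hb2, h⟩, Nat.cast_zero],
          fun _ => AddSubmonoid.subset_closure ⟨hb, h, hb2⟩⟩
      · exact ⟨1, by rw [hF1 _ ⟨D.B₂_subset hb2, h⟩, Nat.cast_one], fun h => absurd h one_ne_zero⟩
    | zero => exact ⟨0, by simp, fun _ => zero_mem _⟩
    | add x y _ _ hx hy =>
      obtain ⟨m, hm, hm'⟩ := hx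
      obtain ⟨n, hn, hn'⟩ := hy
      exact ⟨m + n, by rw [map_add, map_add, hm, hn, Nat.cast_add],
        fun h => add_mem (hm' (by omega)) (hn' (by omega))⟩
  obtain ⟨n, hn, h1⟩ := key
  refine h1 ?_
  rw [map_eq_zero_of_mem_closure (fun b hb => hF0 b ⟨D.B₁_subset hb, hb⟩) h] at hn
  exact_mod_cast hn.symm

lemma coe_mem_redCartan_map {y : hF.Red} (hy : y ∈ redCartan hF hf) :
    hF.redOp y ∈ redCartan hF hf := by
  obtain ⟨n, rfl⟩ := hy
  rw [toRedN_apply, hF.redOp_toRed (coe_mem_c₁ hF hf n.2), hf.map_cartan]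
  exact toRed_mem_redCartan hF hf (D.f₀_mem_N n.2)

/-- The admissible quadruple induced on the reduction. -/
noncomputable def redQuadruple : AdmissibleQuadruple hF.redForm (redCartan hF hf) where
  B := redRoot hF hf '' D.B₁
  isBase := isBase_redRoot_image hF hf
  B₁ := redRoot hF hf '' D.redB₁
  B₂ := (fun μ => redRoot hF hf (D.τ (liftRoot hF hf μ))) '' (redRoot hF hf '' D.redB₁)
  B₁_subset := Set.image_mono Set.inter_subset_left
  B₂_subset := by
    rintro _ ⟨_, ⟨b, hb, rfl⟩, rfl⟩
    dsimp only
    rw [redTau_redRoot hF hf hb.1]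
    exact ⟨_, hb.2.1, rfl⟩
  e μ := hF.toRed (D.e (liftRoot hF hf μ))
  e_mem := by
    intro μ hμ
    obtain ⟨α, hα, rfl⟩ := exists_redRoot_eq hF hf hμ
    rw [liftRoot_redRoot hF hf hα.2]
    exact weightSpace_le_genWeightSpace _ _
      ((mem_weightSpace _ _).2 (redCartan_lie_toRed_e hF hf ⟨α, hα⟩))
  form_e := by
    intro μ hμ ν hν
    obtain ⟨α, hα, rfl⟩ := exists_redRoot_eq hF hf hμ
    obtain ⟨β, hβ, rfl⟩ := exists_redRoot_eq hF hf hν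
    rw [liftRoot_redRoot hF hf hα.2, liftRoot_redRoot hF hf hβ.2,
      hF.redForm_toRed (e_mem_c₁ hF hf hα) (e_mem_c₁ hF hf hβ), D.form_e α hα.1 β hβ.1]
    rw [← map_neg]
    have hiff := (redRoot_injOn_R₁ hF hf).eq_iff hα (neg_mem_R₁ hβ)
    by_cases h : α = -β
    · rw [if_pos h, if_pos (hiff.2 h)]
    · rw [if_neg h, if_neg fun h' => h (hiff.1 h')]
  τ μ := redRoot hF hf (D.τ (liftRoot hF hf μ))
  bijOn := by
    refine Set.InjOn.bijOn_image ?_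
    rintro _ ⟨a, ha, rfl⟩ _ ⟨b, hb, rfl⟩ h
    dsimp only at h
    rw [redTau_redRoot hF hf ha.1, redTau_redRoot hF hf hb.1] at h
    rw [D.bijOn.injOn ha.1 hb.1
      (redRoot_injOn_R₁ hF hf (B₁_subset_R₁ ha.2.1) (B₁_subset_R₁ hb.2.1) h)]
  isometry := by
    rintro _ ⟨a, ha, rfl⟩ _ ⟨b, hb, rfl⟩
    have ha1 := B₁_subset_R₁ ha.1
    have hb1 := B₁_subset_R₁ hb.1
    have ha2 := B₁_subset_R₁ ha.2.1
    have hb2 := B₁_subset_R₁ hb.2.1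
    simp only [map_neg, liftRoot_redRoot hF hf ha1.2, liftRoot_redRoot hF hf hb1.2,
      liftRoot_redRoot hF hf ha2.2, liftRoot_redRoot hF hf hb2.2]
    have hc : ∀ {α}, α ∈ D.R₁ → (hF.isInvariantForm.dualVec α : g) ∈ hF.c₁ := fun hα =>
      coe_mem_c₁ hF hf (dualVec_mem_N hF (mem_span_of_mem_closure hα.2))
    rw [lie_toRed_e_e_neg hF hf ha1, lie_toRed_e_e_neg hF hf hb1, lie_toRed_e_e_neg hF hf ha2,
      lie_toRed_e_e_neg hF hf hb2, hF.redForm_toRed (hc ha1) (hc hb1),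
      hF.redForm_toRed (hc ha2) (hc hb2), hF.isInvariantForm.dualVec_apply,
      hF.isInvariantForm.dualVec_apply, tau_isometry hF.isInvariantForm ha.1 hb.1]
  nilpotent := by
    rintro _ ⟨b, hb, rfl⟩
    by_contra! hcon
    obtain ⟨t, ht⟩ := D.nilpotent b hb.1
    -- If the induced map never left its domain, its iterates would be the images of those of τ,
    -- which would then remain in `B₁` forever.
    have key : ∀ t : ℕ, (fun μ => redRoot hF hf (D.τ (liftRoot hF hf μ)))^[t] (redRoot hF hf b) =
        redRoot hF hf (D.τ^[t] b) ∧ D.τ^[t] b ∈ D.B₁ := by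
      intro t
      induction t with
      | zero => exact ⟨rfl, hb.1⟩
      | succ t ih =>
        have h1 := hcon t
        rw [ih.1] at h1
        obtain ⟨c, hc, hc'⟩ := h1
        have h2 : c = D.τ^[t] b :=
          redRoot_injOn_R₁ hF hf (B₁_subset_R₁ hc.1) (B₁_subset_R₁ ih.2) hc'
        rw [Function.iterate_succ_apply', Function.iterate_succ_apply', ih.1, ← h2,
          redTau_redRoot hF hf hc.1]
        exact ⟨rfl, hc.2.1⟩
    exact ht (key t).2
  compatible := by
    intro μ hμ ν hν hμν μ' ν' hμ' hν' c hc
    have h1 := tauRel_liftRoot hF hf hμ'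
    have h2 := tauRel_liftRoot hF hf hν'
    have hα := liftRoot_mem_R₁ hF hf hμ
    have hβ := liftRoot_mem_R₁ hF hf hν
    have hαβ := liftRoot_mem_R₁ hF hf hμν
    have hα' : liftRoot hF hf μ' ∈ D.R₁ := ⟨h1.1.mem_roots hF.isInvariantForm hα.1, h1.2⟩
    have hβ' : liftRoot hF hf ν' ∈ D.R₁ := ⟨h2.1.mem_roots hF.isInvariantForm hβ.1, h2.2⟩
    rw [map_add] at hc hαβ ⊢
    rw [hF.lie_toRed (e_mem_c₁ hF hf hα) (e_mem_c₁ hF hf hβ)] at hc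
    -- The relation in the reduction holds already in `g`: the bracket is a multiple of `e_{α+β}`,
    -- whose class is nonzero, so the class determines the scalar.
    have hc' : ⁅D.e (liftRoot hF hf μ), D.e (liftRoot hF hf ν)⁆ =
        c • D.e (liftRoot hF hf μ + liftRoot hF hf ν) := by
      rcases exists_lie_e_e (D := D) hα.1 hβ.1 hαβ.1.1 with ⟨-, d, hd⟩ | ⟨h, -⟩
      · rw [hd, map_smul] at hc
        rw [hd, smul_left_injective ℂ (toRed_e_ne_zero hF hf hαβ) hc]
      · exact absurd hαβ.1 h
    rw [hF.lie_toRed (e_mem_c₁ hF hf hα') (e_mem_c₁ hF hf hβ'),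
      D.compatible _ hα.1 _ hβ.1 hαβ.1 _ _ h1.1 h2.1 c hc', map_smul]
  -- Taking the restriction of `f̃` makes agreement on the Cartan subalgebra definitional;
  -- `redQuadruple_f₀` compares it with `f̃₀`.
  f₀ := hF.redOp.restrict (p := (redCartan hF hf).toSubmodule)
    (q := (redCartan hF hf).toSubmodule) fun _ => coe_mem_redCartan_map hF hf
  f₀_add_adjoint x y := hF.isFactorizable_red.add_adjoint x y
  f₀_tau := by
    rintro _ ⟨b, hb, rfl⟩ h h' hh hh'
    have h1 := B₁_subset_R₁ hb.1
    have h2 := B₁_subset_R₁ hb.2.1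
    simp only [map_neg, liftRoot_redRoot hF hf h1.2, liftRoot_redRoot hF hf h2.2] at hh hh'
    rw [lie_toRed_e_e_neg hF hf h1] at hh
    rw [lie_toRed_e_e_neg hF hf h2] at hh'
    have hc : ∀ {α}, α ∈ D.R₁ → (hF.isInvariantForm.dualVec α : g) ∈ hF.c₁ := fun hα =>
      coe_mem_c₁ hF hf (dualVec_mem_N hF (mem_span_of_mem_closure hα.2))
    refine Subtype.ext ?_
    change hF.redOp h = hF.redOp h' - h'
    rw [hh, hh', hF.redOp_toRed (hc h1), hF.redOp_toRed (hc h2), ← map_sub, hf.map_cartan,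
      hf.map_cartan, (TauRel.of_mem hb.1).f₀_dualVec hF.isInvariantForm]
    rfl

lemma liftRoot_mem_posRoots {μ : Dual ℂ (redCartan hF hf)}
    (hμ : μ ∈ (redQuadruple hF hf).posRoots) : liftRoot hF hf μ ∈ D.posRoots :=
  ⟨(liftRoot_mem_R₁ hF hf hμ.1).1,
    AddSubmonoid.closure_mono D.B₁_subset (liftRoot_mem_closure hF hf hμ.2)⟩

/-- The operator induced on the reduction is associated to the induced quadruple. -/
lemma isRecursive_redOp : (redQuadruple hF hf).IsRecursive hF.redOp where
  pos_tau μ hμ ν h := by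
    have h1 := (tauRel_liftRoot hF hf h).1
    have hα := liftRoot_mem_posRoots hF hf hμ
    have hβ := (h1.mem_posRoots_iff hF.isInvariantForm).2 hα
    change hF.redOp (hF.toRed (D.e _)) = hF.redOp (hF.toRed (D.e _)) - hF.toRed (D.e _)
    rw [hF.redOp_toRed (e_mem_c₁_of_mem_posRoots hF hf hα),
      hF.redOp_toRed (e_mem_c₁_of_mem_posRoots hF hf hβ), hf.pos_tau _ hα _ h1, map_sub]
  pos_of_notMem μ hμ h := by
    have hα := liftRoot_mem_posRoots hF hf hμ
    have hα' := liftRoot_mem_R₁ hF hf hμ.1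
    have h1 := D.tauRel_tauHat hα'.2
    have hβ := (h1.mem_posRoots_iff hF.isInvariantForm).2 hα
    -- The root lies in `R₁` but outside the domain of the induced map, so τ takes it out of `ℤB₁`.
    -- Then `f` kills `e_{τα}` and its class is zero, so the recursion gives 0.
    have hβ' : D.tauHat (liftRoot hF hf μ) ∉ AddSubgroup.closure D.B₁ := by
      intro hβ'
      refine h ?_
      have h2 := closure_le_addSubgroup_closure
        (mem_closure_redB₁ (liftRoot_mem_closure hF hf hμ.2) hβ')
      have h3 := (tauRel_iff (F := (redQuadruple hF hf).tauHat.toAddMonoidHom)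
        fun _ => (redQuadruple hF hf).tauHat_apply).1 (tauRel_redRoot hF hf h2)
      rw [redRoot_liftRoot hF hf hμ.1] at h3
      exact h3.1
    change hF.redOp (hF.toRed (D.e _)) = 0
    rw [hF.redOp_toRed (e_mem_c₁_of_mem_posRoots hF hf hα), hf.pos_tau _ hα _ h1, map_sub,
      hf.pos_of_notMem _ hβ hβ', toRed_e_eq_zero hF hf hβ hβ', map_zero, sub_zero]
  neg_tau ν hν μ h := by
    obtain ⟨h1, h2⟩ := tauRel_liftRoot hF hf h
    have hβ := liftRoot_mem_posRoots hF hf hν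
    have hα := (h1.mem_posRoots_iff hF.isInvariantForm).1 hβ
    have hβ' := neg_mem_R₁ (liftRoot_mem_R₁ hF hf hν.1)
    have hα' : -liftRoot hF hf μ ∈ D.R₁ := neg_mem_R₁ ⟨hα.1, h1.mem_left⟩
    change hF.redOp (hF.toRed (D.e (liftRoot hF hf (-ν)))) =
      hF.redOp (hF.toRed (D.e (liftRoot hF hf (-μ)))) + hF.toRed (D.e (liftRoot hF hf (-ν)))
    rw [map_neg, map_neg, hF.redOp_toRed (e_mem_c₁ hF hf hβ'),
      hF.redOp_toRed (e_mem_c₁ hF hf hα'), hf.neg_tau _ hβ _ h1, map_add]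
  neg_of_notMem ν hν h := by
    have hβ := liftRoot_mem_posRoots hF hf hν
    have hβ' := liftRoot_mem_R₁ hF hf hν.1
    -- If the lifted root were `τα`, then, as it lies in `ℤB₁`, `α` would be a combination of
    -- `D.redB₁` and `ν` would be in the range of the induced map.
    have h1 : liftRoot hF hf ν ∉ AddSubgroup.closure D.B₂ := by
      intro h1
      obtain ⟨α, h2⟩ := exists_tauRel_of_mem h1
      have hα := (h2.mem_posRoots_iff hF.isInvariantForm).1 hβ
      have hα' : α ∈ AddSubmonoid.closure D.redB₁ := mem_closure_redB₁
        (D.isBase.mem_closure_of_mem_addSubgroup_closure D.B₁_subset hα.2 h2.mem_left)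
        (by rw [h2.tauHat_eq]; exact hβ'.2)
      have h3 := tauRel_redRoot hF hf (closure_le_addSubgroup_closure hα')
      rw [h2.tauHat_eq, redRoot_liftRoot hF hf hν.1] at h3
      exact h (TauRel.mem_right (D := redQuadruple hF hf) h3)
    change hF.redOp (hF.toRed (D.e (liftRoot hF hf (-ν)))) =
      hF.toRed (D.e (liftRoot hF hf (-ν)))
    rw [map_neg, hF.redOp_toRed (e_mem_c₁ hF hf (neg_mem_R₁ hβ')), hf.neg_of_notMem _ hβ h1]
  map_cartan _ := rfl

lemma redQuadruple_pairing {α β : Dual ℂ H} (hα : α ∈ D.R₁) (hβ : β ∈ D.R₁) :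
    (redQuadruple hF hf).pairing (redRoot hF hf α) (redRoot hF hf β) = D.pairing α β := by
  have hc : ∀ {α}, α ∈ D.R₁ → (hF.isInvariantForm.dualVec α : g) ∈ hF.c₁ := fun hα =>
    coe_mem_c₁ hF hf (dualVec_mem_N hF (mem_span_of_mem_closure hα.2))
  have h : ∀ {α}, α ∈ D.R₁ → ⁅(redQuadruple hF hf).e (redRoot hF hf α),
      (redQuadruple hF hf).e (-redRoot hF hf α)⁆ =
        hF.toRed (hF.isInvariantForm.dualVec α : H) := by
    intro α hα
    change ⁅hF.toRed (D.e (liftRoot hF hf _)), hF.toRed (D.e (liftRoot hF hf _))⁆ = _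
    rw [map_neg, liftRoot_redRoot hF hf hα.2, lie_toRed_e_e_neg hF hf hα]
  rw [pairing, pairing, h hα, h hβ, hF.redForm_toRed (hc hα) (hc hβ),
    D.lie_e_e_neg hF.isInvariantForm hα.1, D.lie_e_e_neg hF.isInvariantForm hβ.1]

lemma redQuadruple_f₀ (x : D.HTilde) :
    (redQuadruple hF hf).f₀ (redEquiv hF hf x) = redEquiv hF hf (D.f₀Tilde x) := by
  obtain ⟨n, rfl⟩ := Submodule.mkQ_surjective _ x
  refine Subtype.ext ?_
  change hF.redOp (hF.toRed ((n : H) : g)) = hF.toRed (D.f₀ n : H)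
  rw [hF.redOp_toRed (coe_mem_c₁ hF hf n.2), hf.map_cartan]

end AdmissibleQuadruple

end ReducedQuadruple

end BelavinDrinfeld

theorem mainTheorem6 {g : Type*} [LieRing g] [LieAlgebra ℂ g] [FiniteDimensional ℂ g]
    [LieAlgebra.HasCentralRadical ℂ g]
    (κ : LinearMap.BilinForm ℂ g) (hsymm : κ.IsSymm) (hnondeg : κ.Nondegenerate)
    (hinv : κ.lieInvariant g)
    (H : LieSubalgebra ℂ g) [H.IsCartanSubalgebra]
    (D : BelavinDrinfeld.AdmissibleQuadruple κ H) :
    -- the associated operator exists and is unique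
    (∃! f : Module.End ℂ g, D.IsOperator f) ∧
    ∀ f : Module.End ℂ g, D.IsOperator f →
    ∃ hF : BelavinDrinfeld.IsFactorizable κ f,
      LieAlgebra.HasCentralRadical ℂ hF.Red ∧
      BelavinDrinfeld.IsFactorizable hF.redForm hF.redOp ∧
      D.NPerp ≤ D.N ∧
      ∃ (H' : LieSubalgebra ℂ hF.Red) (_ : H'.IsCartanSubalgebra)
        (φ : D.HTilde ≃ₗ[ℂ] H')
        (ρ : Module.Dual ℂ H → Module.Dual ℂ H')
        (D' : BelavinDrinfeld.AdmissibleQuadruple hF.redForm H'),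
        -- the Cartan subalgebra is the image of `Im (f₀ - 1)`, via the natural map
        (∀ n : D.N, hF.IsClass ((n : H) : g) (φ (Submodule.Quotient.mk n))) ∧
        -- the roots are the functionals induced by the elements of `R₁`
        (∀ α ∈ D.R₁, ∀ n : D.N, ρ α (φ (Submodule.Quotient.mk n)) = α n) ∧
        Set.BijOn ρ D.R₁ (BelavinDrinfeld.roots H') ∧
        (∀ α ∈ D.R₁, ∀ β ∈ D.R₁, D'.pairing (ρ α) (ρ β) = D.pairing α β) ∧
        -- the quadruple is the induced one
        D'.B = ρ '' D.B₁ ∧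
        D'.B₁ = ρ '' (D.B₁ ∩ D.τ ⁻¹' (D.B₁ ∩ D.B₂)) ∧
        (∀ α ∈ D.B₁ ∩ D.τ ⁻¹' (D.B₁ ∩ D.B₂), D'.τ (ρ α) = ρ (D.τ α)) ∧
        (∀ α ∈ D.R₁, hF.IsClass (D.e α) (D'.e (ρ α))) ∧
        (∀ x : D.HTilde, D'.f₀ (φ x) = φ (D.f₀Tilde x)) ∧
        D'.IsOperator hF.redOp := by
  have hκ : BelavinDrinfeld.IsInvariantForm κ := ⟨hsymm, hnondeg, hinv⟩
  refine ⟨D.existsUnique_isOperator hκ, fun f hf' => ?_⟩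
  have hf := (BelavinDrinfeld.AdmissibleQuadruple.isOperator_iff_isRecursive hκ).1 hf'
  have hF := hf.isFactorizable hκ
  have hrad := BelavinDrinfeld.AdmissibleQuadruple.hasCentralRadical_red hF hf
  open BelavinDrinfeld BelavinDrinfeld.AdmissibleQuadruple in
  exact ⟨hF, hrad, hF.isFactorizable_red, NPerp_le_N hF, redCartan hF hf,
    isCartanSubalgebra_redCartan hF hf, redEquiv hF hf, redRoot hF hf, redQuadruple hF hf,
    fun n => by
      rw [coe_redEquiv_mk]
      exact hF.isClass_toRed (coe_mem_c₁ hF hf n.2),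
    fun α hα n => redRoot_apply_toRed hF hf (mem_span_of_mem_closure hα.2) n.2
      (coe_redEquiv_mk hF hf n),
    bijOn_redRoot hF hf, fun α hα β hβ => redQuadruple_pairing hF hf hα hβ, rfl, rfl,
    fun α hα => redTau_redRoot hF hf hα.1,
    fun α hα => by
      change hF.IsClass (D.e α) (hF.toRed (D.e (liftRoot hF hf (redRoot hF hf α))))
      rw [liftRoot_redRoot hF hf hα.2]
      exact hF.isClass_toRed (e_mem_c₁ hF hf hα),
    redQuadruple_f₀ hF hf,
    (isOperator_iff_isRecursive hF.isFactorizable_red.isInvariantForm).2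
      (isRecursive_redOp hF hf)⟩
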